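/- Let $(t,x)=(t,x_1,\dots,x_n)\in\mathbb{C}_t\times\mathbb{C}_x^n$, let $\Lambda=\{(i,\alpha)\in\mathbb{N}\times\mathbb{N}^n : i+|\alpha|\le 2,\ i<2\}$, $N=\#\Lambda$, and let $F(t,x,z)$, with $z=\{z_{i,\alpha}\}_{(i,\alpha)\in\Lambda}$, be a holomorphic function on an open neighborhood $\Delta$ of the origin of $\mathbb{C}_t\times\mathbb{C}_x^n\times\mathbb{C}_z^N$ such that, for all $x$ with $(0,x,0)\in\Delta$, one has $F(0,x,0)=0$, and $(\partial F/\partial z_{i,\alpha})(0,x,0)=0$ whenever $|\alpha|>0$. Suppose that both roots $\lambda_1(0),\lambda_2(0)$ of $$\lambda^2-\sum_{i<2}\frac{\partial F}{\partial z_{i,0}}(0,0,0)\,\lambda^i=0$$ have negative real part. Consider the equation $$\Bigl(t\frac{\partial}{\partial t}\Bigr)^2u=F\Bigl(t,x,\Bigl\{\Bigl(t\frac{\partial}{\partial t}\Bigr)^i\Bigl(\frac{\partial}{\partial x}\Bigr)^\alpha u\Bigr\}_{(i,\alpha)\in\Lambda}\Bigr).\qquad(*)$$ For a nonempty open interval $I$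 and $r,R>0$ let $S_I(r)$ be the set of points $t$ of the universal covering space of $\mathbb{C}\setminus\{0\}$ with $\arg t\in I$ and $0<|t|<r$, and let $D_R=\{x\in\mathbb{C}^n : \max_j|x_j|<R\}$. **Theorem (Analytic continuation).** Let $u(t,x)$ be a holomorphic solution of $(*)$ on $S_I(r_0)\times D_{R_0}$ for some nonempty open interval $I$, $r_0>0$ and $R_0>0$ (in particular, the argument of $F$ in $(*)$ stays in $\Delta$ there). If $$\varlimsup_{R\to+0}\Bigl[\lim_{r\to+0}\Bigl(\frac1{R^4}\sup_{S_I(r)\times D_R}|u(t,x)|\Bigr)\Bigr]=0,$$ then $u$ can be continued holomorphically up to a neighborhood of $(0,0)\in\mathbb{C}_t\times\mathbb{C}_x^n$: there are an open neighborhood $U$ of $(0,0)$ and a holomorphic function $v$ on $U$ such that $v(t,x)=u(t,x)$ at every point of $S_I(r_0)\times D_{R_0}$ whose projection to $\mathbb{C}_t\times\mathbb{C}_x^n$ lies in $U$. -/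

import Mathlib

open Filter Topology
open scoped ENNReal

/-- The universal covering space of `ℂ ∖ {0}`, realised as the plane `ℂ` of the logarithms
`s = log t`, with the covering map `s ↦ exp s`. -/
abbrev LogCover : Type := ℂ

namespace LogCover

/-- The covering map onto `ℂ ∖ {0}`: the point `t = exp s` lying under `s`. -/
noncomputable def proj (s : LogCover) : ℂ := Complex.exp s

/-- The argument of a point of the covering space (a real number, not taken modulo `2π`). -/
def arg (s : LogCover) : ℝ := Complex.im s

/-- `t = |t| exp (i arg t)`. -/
theorem proj_eq (s : LogCover) :
    proj s = (‖proj s‖ : ℂ) * Complex.exp (arg s * Complex.I) := by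
  rw [proj, arg, Complex.norm_exp, Complex.ofReal_exp, ← Complex.exp_add, Complex.re_add_im]

end LogCover

/-- The sector `S_I(r) = {t ; arg t ∈ I, 0 < |t| < r}` in the universal cover of `ℂ ∖ {0}`
(where `0 < |t|` is automatic). -/
def sector (I : Set ℝ) (r : ℝ) : Set LogCover :=
  {s | LogCover.arg s ∈ I ∧ ‖LogCover.proj s‖ < r}

/-- The polydisc `D_R = {x ∈ ℂⁿ ; max_j |x_j| < R}` (`‖x‖` is the maximum norm). -/
def polydisc (n : ℕ) (R : ℝ) : Set (Fin n → ℂ) := {x | ‖x‖ < R}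

/-- The index set `Λ = {(i, α) ∈ ℕ × ℕⁿ ; i + |α| ≤ 2, i < 2}`. -/
def JetIndex (n : ℕ) : Type := {p : ℕ × (Fin n → ℕ) // p.1 + ∑ j, p.2 j ≤ 2 ∧ p.1 < 2}

namespace JetIndex

instance instFinite (n : ℕ) : Finite (JetIndex n) := by
  have h : ({p : ℕ × (Fin n → ℕ) | p.1 + ∑ j, p.2 j ≤ 2 ∧ p.1 < 2}).Finite := by
    refine ((Set.finite_Iic (2 : ℕ)).prod
      (Set.finite_Iic (fun _ : Fin n => (2 : ℕ)))).subset ?_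
    rintro ⟨i, α⟩ ⟨h1, h2⟩
    refine ⟨by simp at h2 ⊢; omega, fun j => ?_⟩
    have := Finset.single_le_sum (f := α) (fun _ _ => Nat.zero_le _) (Finset.mem_univ j)
    simp only at h1
    show α j ≤ 2
    omega
  exact h.to_subtype

noncomputable instance instFintype (n : ℕ) : Fintype (JetIndex n) := Fintype.ofFinite _

noncomputable instance instDecidableEq (n : ℕ) : DecidableEq (JetIndex n) :=
  Classical.decEq _

/-- The order `i` of the derivation `t ∂/∂t`. -/
def ord {n : ℕ} (k : JetIndex n) : ℕ := k.1.1

/-- The multi-index `α` of the derivation in `x`. -/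
def multi {n : ℕ} (k : JetIndex n) : Fin n → ℕ := k.1.2

/-- The index `(i, 0)`, for `i = 0, 1`. -/
def pure (n : ℕ) (i : Fin 2) : JetIndex n :=
  ⟨(i, 0), by simp only [Pi.zero_apply, Finset.sum_const_zero]; omega, i.2⟩

end JetIndex

/-- The space `ℂ_t × ℂ_xⁿ × ℂ_z^N` with `z = (z_{i,α})`, `(i, α) ∈ Λ`. -/
abbrev JetSpace (n : ℕ) : Type := ℂ × (Fin n → ℂ) × (JetIndex n → ℂ)

/-- The partial derivative `∂F/∂z_{i,α}`, where `k = (i, α)`. -/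
noncomputable def partialZ {n : ℕ} (F : JetSpace n → ℂ) (k : JetIndex n) (p : JetSpace n) : ℂ :=
  fderiv ℂ F p (0, 0, Pi.single k 1)

/-- `lam` is a characteristic exponent at `x`: a root of
`λ² - ∑_{i<2} (∂F/∂z_{i,0})(0,x,0) λ^i = 0`. -/
def IsCharExponent {n : ℕ} (F : JetSpace n → ℂ) (x : Fin n → ℂ) (lam : ℂ) : Prop :=
  lam ^ 2 - ∑ i : Fin 2, partialZ F (JetIndex.pure n i) (0, x, 0) * lam ^ (i : ℕ) = 0

/-- The operator `t ∂/∂t` on functions `u(t,x)` with `t` in the universal cover of `ℂ ∖ {0}`;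
in the coordinate `s = log t` it is `∂/∂s`. -/
noncomputable def eulerOp {n : ℕ} (u : LogCover × (Fin n → ℂ) → ℂ) :
    LogCover × (Fin n → ℂ) → ℂ :=
  fun p => fderiv ℂ u p (1, 0)

/-- On functions that come from the base, `eulerOp` is the operator `t ∂/∂t`. -/
theorem eulerOp_comp_proj {n : ℕ} (v : ℂ × (Fin n → ℂ) → ℂ) (s : LogCover) (x : Fin n → ℂ)
    (hv : DifferentiableAt ℂ v (LogCover.proj s, x)) :
    eulerOp (fun p => v (LogCover.proj p.1, p.2)) (s, x)
      = LogCover.proj s * deriv (fun t => v (t, x)) (LogCover.proj s) := by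
  have h1 : HasFDerivAt (fun p : ℂ × (Fin n → ℂ) => (LogCover.proj p.1, p.2))
      (((Complex.exp s) • ContinuousLinearMap.fst ℂ ℂ (Fin n → ℂ)).prod
        (ContinuousLinearMap.snd ℂ ℂ (Fin n → ℂ))) (s, x) := by
    refine HasFDerivAt.prodMk ?_ hasFDerivAt_snd
    exact (Complex.hasDerivAt_exp s).comp_hasFDerivAt (s, x) hasFDerivAt_fst
  have h2 := HasFDerivAt.comp (s, x) (g := v) hv.hasFDerivAt h1
  have h3 : HasDerivAt (fun t : ℂ => (t, x)) ((1 : ℂ), (0 : Fin n → ℂ)) (LogCover.proj s) :=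
    (hasDerivAt_id _).prodMk (hasDerivAt_const _ _)
  have h4 := HasFDerivAt.comp_hasDerivAt (LogCover.proj s) (l := v) hv.hasFDerivAt h3
  have h5 : deriv (fun t => v (t, x)) (LogCover.proj s)
      = fderiv ℂ v (LogCover.proj s, x) (1, 0) := h4.deriv
  have h6 : fderiv ℂ (fun p : ℂ × (Fin n → ℂ) => v (LogCover.proj p.1, p.2)) (s, x) = _ :=
    h2.fderiv
  rw [eulerOp, h5, h6]
  have h7 : ((Complex.exp s, 0) : ℂ × (Fin n → ℂ)) = Complex.exp s • ((1 : ℂ), 0) := by simp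
  simp [LogCover.proj, h7, -Prod.smul_mk]

/-- The operator `∂/∂x_j`. -/
noncomputable def partialX {n : ℕ} (j : Fin n) (u : LogCover × (Fin n → ℂ) → ℂ) :
    LogCover × (Fin n → ℂ) → ℂ :=
  fun p => fderiv ℂ u p (0, Pi.single j 1)

/-- The operator `(∂/∂x)^α = (∂/∂x_1)^{α_1} ⋯ (∂/∂x_n)^{α_n}`. -/
noncomputable def partialXMulti {n : ℕ} (α : Fin n → ℕ) (u : LogCover × (Fin n → ℂ) → ℂ) :
    LogCover × (Fin n → ℂ) → ℂ :=
  (List.finRange n).foldr (fun j g => (partialX j)^[α j] g) u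

/-- The point `(t, x, {(t ∂/∂t)^i (∂/∂x)^α u (t,x)}_{(i,α) ∈ Λ})`. -/
noncomputable def jet {n : ℕ} (u : LogCover × (Fin n → ℂ) → ℂ) (p : LogCover × (Fin n → ℂ)) :
    JetSpace n :=
  (LogCover.proj p.1, p.2, fun k => eulerOp^[k.ord] (partialXMulti k.multi u) p)

/-- `u` is a holomorphic solution, on the open subset `Ω` of `(universal cover) × ℂⁿ`, of
`(t ∂/∂t)² u = F(t, x, {(t ∂/∂t)^i (∂/∂x)^α u})`, where `F` is a function on `Δ`. -/
structure IsHolomorphicSolution {n : ℕ} (Δ : Set (JetSpace n)) (F : JetSpace n → ℂ)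
    (Ω : Set (LogCover × (Fin n → ℂ))) (u : LogCover × (Fin n → ℂ) → ℂ) : Prop where
  holomorphic : AnalyticOnNhd ℂ u Ω
  jet_mem : ∀ p ∈ Ω, jet u p ∈ Δ
  equation : ∀ p ∈ Ω, eulerOp^[2] u p = F (jet u p)

/-- `(1/R⁴) sup_{S_I(r) × D_R} |u|`, as an element of `[0, ∞]`. -/
noncomputable def scaledSup {n : ℕ} (I : Set ℝ) (u : LogCover × (Fin n → ℂ) → ℂ) (R r : ℝ) :
    ℝ≥0∞ :=
  (⨆ p ∈ sector I r ×ˢ polydisc n R, ‖u p‖ₑ) / ENNReal.ofReal (R ^ 4)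

/-- The growth condition
`limsup_{R → +0} [ lim_{r → +0} ( (1/R⁴) sup_{S_I(r) × D_R} |u| ) ] = 0`,
where `L R` is the inner limit. -/
def GrowthCondition {n : ℕ} (I : Set ℝ) (u : LogCover × (Fin n → ℂ) → ℂ) : Prop :=
  ∃ L : ℝ → ℝ≥0∞,
    (∀ᶠ R in 𝓝[>] (0 : ℝ), Tendsto (scaledSup I u R) (𝓝[>] (0 : ℝ)) (𝓝 (L R))) ∧
    limsup L (𝓝[>] (0 : ℝ)) = 0

/-! In the coordinate `s = log t` the operator `t∂ₜ` is `∂/∂s`, and `t → 0` along a ray reads `s -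
σ`, `σ → +∞`. Splitting off the linear part of `F` at the origin turns the equation into `(t∂ₜ -
λ₁)(t∂ₜ - λ₂)u = remainder (jet u)`. As `Re λᵢ < 0`, the homogeneous solutions `t^λᵢ` are unbounded
at `t = 0`. Hence, among functions bounded on rays, each factor is inverted uniquely by an integral
along the ray (`rayInt`), and no branch of `t^λᵢ` enters.

The right-hand side contains `x`-derivatives up to second order, the same order as the operator, so
two of them have to be paid for. The derivative of `F` in `z_{i,α}`, `α ≠ 0`, vanishes at `(0, x,
0)`, so these terms carry a factor `O(|t| + |z|)`. This factor is spent in Nagumo-type weighted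
norms on the cones `‖x‖ + K|t|^(1/7) < R`. An `x`-derivative costs one power of `gap`. A ray
integration can regain it, together with a factor `1/K`, at the price of one power of `|t|^(1/7)`
(`norm_le_of_ray_weighted`). The terms with `α = 0` lose no weight and have a coefficient `O(‖x‖)`
after the linear part at `0` is removed. So for large `K` and small `R` the right-hand side is a
contraction (`remainder_jet_contraction`).

The exponent 7 makes the powers balance. A source of size `|t| = wt^7` gives jets of size `wt^5 /
gap^3`; on a slightly smaller cone `gap` dominates `wt`, which leaves `wt^2`. This is the smallness
of the jets that sends `wt^5` back to `wt^7` in the next step.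

The contraction gives a solution `w` defined for all arguments and `2πi`-periodic in `s`
(`exists_periodic_solution`), and uniqueness among solutions with small jets
(`eqOn_of_charOp_eq_remainder`). The growth hypothesis forces `u = O(|t|)` on a smaller sector
(`exists_linear_bound_of_growthCondition`): the exponent 4 is the one at which the quadratic term,
divided by the fourth power of the loss of radius in `x`, can be iterated. So `u = w` on a cone. By
periodicity and boundedness `w` descends to a holomorphic function near the origin
(`exists_descent`), and the identity theorem carries the equality to the whole sector
(`eq_of_eqOn_cone`). -/

/-! ### Holomorphic functions of several variables: Cauchy formula, analyticity, integrals and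
series with parameters. -/

open MeasureTheory Set in
theorem torusIntegral_prod_sub_inv_mul {m : ℕ} {f : (Fin m → ℂ) → ℂ} {c z : Fin m → ℂ} {R R' : ℝ}
    (hR : 0 < R) (hRR' : R < R') (hf : DifferentiableOn ℂ f (Metric.ball c R'))
    (hz : z ∈ Metric.ball c R) :
    torusIntegral (fun ζ => (∏ j, (ζ j - z j)⁻¹) * f ζ) c (fun _ => R)
      = (2 * Real.pi * Complex.I) ^ m * f z := by
  induction m with
  | zero => simp; congr 1; exact Subsingleton.elim _ _
  | succ m ih =>
    have hz' : ∀ j, dist (z j) (c j) < R := fun j => (dist_pi_lt_iff hR).1 hz j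
    have hmem : ∀ θ, torusMap c (fun _ => R) θ ∈ Metric.ball c R' := fun θ => by
      refine (dist_pi_lt_iff (hR.trans hRR')).2 fun j => ?_
      simpa [torusMap, dist_eq_norm, abs_of_pos hR, Complex.norm_exp] using hRR'
    have hne : ∀ θ j, torusMap c (fun _ => R) θ j - z j ≠ 0 := fun θ j h => by
      have h1 : torusMap c (fun _ => R) θ j = z j := sub_eq_zero.1 h
      have := hz' j
      rw [← h1] at this
      simp [torusMap, dist_eq_norm, abs_of_pos hR, Complex.norm_exp] at this
    have hcont : Continuous fun θ => torusMap c (fun _ => R) θ := by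
      unfold torusMap; fun_prop
    have hint : TorusIntegrable (fun ζ => (∏ j, (ζ j - z j)⁻¹) * f ζ) c (fun _ => R) := by
      refine Continuous.integrableOn_Icc (Continuous.mul ?_ ?_)
      · refine continuous_finsetProd _ fun j _ => Continuous.inv₀ ?_ (fun θ => hne θ j)
        exact ((continuous_apply j).comp hcont).sub continuous_const
      · exact hf.continuousOn.comp_continuous hcont hmem
    rw [torusIntegral_succ hint]
    have hcons : ∀ x (y : Fin m → ℂ), dist x (c 0) < R' → dist y (c ∘ Fin.succ) < R' →
        (Fin.cons x y : Fin (m + 1) → ℂ) ∈ Metric.ball c R' := fun x y hx hy => by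
      refine (dist_pi_lt_iff (hR.trans hRR')).2 fun j => ?_
      refine Fin.cases ?_ (fun i => ?_) j
      · simpa using hx
      · simpa using (dist_pi_lt_iff (hR.trans hRR')).1 hy i
    have hztail : (z ∘ Fin.succ) ∈ Metric.ball (c ∘ Fin.succ) R :=
      (dist_pi_lt_iff hR).2 fun j => hz' _
    have hzt' : dist (z ∘ Fin.succ) (c ∘ Fin.succ) < R' := (Metric.mem_ball.1 hztail).trans hRR'
    -- The induction hypothesis in the last `m` variables reduces the torus integral to the
    -- one-variable Cauchy formula in the first.
    have hinner : ∀ x ∈ Metric.sphere (c 0) R,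
        torusIntegral (fun y : Fin m → ℂ => (∏ j, ((Fin.cons x y : Fin (m + 1) → ℂ) j - z j)⁻¹) *
          f (Fin.cons x y)) (c ∘ Fin.succ) (fun _ => R)
        = (2 * Real.pi * Complex.I) ^ m * ((x - z 0)⁻¹ • f (Fin.cons x (z ∘ Fin.succ))) := by
      intro x hx
      have hx' : dist x (c 0) < R' := by rw [Metric.mem_sphere.1 hx]; exact hRR'
      have hg : DifferentiableOn ℂ (fun y : Fin m → ℂ => f (Fin.cons x y))
          (Metric.ball (c ∘ Fin.succ) R') := by
        refine hf.comp (t := Metric.ball c R') (f := fun y : Fin m → ℂ => (Fin.cons x y : Fin (m + 1) → ℂ)) ?_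
          (fun y hy => hcons x y hx' hy)
        refine differentiableOn_pi.2 fun j => ?_
        refine Fin.cases ?_ (fun i => ?_) j
        · simp
        · simp only [Fin.cons_succ]; fun_prop
      have := ih hg hztail
      simp only [Fin.prod_univ_succ, Fin.cons_zero, Fin.cons_succ, mul_assoc,
        torusIntegral_const_mul]
      simp only [Function.comp] at this ⊢
      rw [this]
      simp only [smul_eq_mul]; ring
    have hg0 : DifferentiableOn ℂ (fun x : ℂ => f (Fin.cons x (z ∘ Fin.succ)))
        (Metric.closedBall (c 0) R) := by
      refine hf.comp (t := Metric.ball c R') (f := fun x : ℂ => (Fin.cons x (z ∘ Fin.succ) : Fin (m + 1) → ℂ)) ?_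
        (fun x hx => hcons x _ ((Metric.mem_closedBall.1 hx).trans_lt hRR') hzt')
      refine differentiableOn_pi.2 fun j => ?_
      refine Fin.cases ?_ (fun i => ?_) j
      · simp only [Fin.cons_zero]; fun_prop
      · simp
    have h1 := hg0.circleIntegral_sub_inv_smul (hz' 0)
    calc _ = circleIntegral (fun x => (2 * Real.pi * Complex.I) ^ m *
            ((x - z 0)⁻¹ • f (Fin.cons x (z ∘ Fin.succ)))) (c 0) R :=
          circleIntegral.integral_congr hR.le hinner
      _ = _ := by
          rw [circleIntegral.integral_const_mul, h1, smul_eq_mul]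
          have : (Fin.cons (z 0) (z ∘ Fin.succ) : Fin (m + 1) → ℂ) = z := by
            ext j; refine Fin.cases ?_ (fun i => ?_) j <;> simp
          rw [this]; ring

-- Cauchy's formula writes `f z` as a continuous linear functional `φ` on `C(K, ℂ)`, `K` the
-- parameter cube of the torus, applied to the product of the functions `(ζ j - z j)⁻¹`. Inversion
-- in a Banach algebra is analytic, hence so is `f`, with no explicit handling of multi-index power
-- series.
open MeasureTheory Set in
theorem analyticAt_of_differentiableOn_ball {m : ℕ} {f : (Fin m → ℂ) → ℂ} {c : Fin m → ℂ} {R' : ℝ}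
    (hR' : 0 < R') (hf : DifferentiableOn ℂ f (Metric.ball c R')) : AnalyticAt ℂ f c := by
  obtain ⟨R, hR, hRR'⟩ := exists_between hR'
  let K : Set (Fin m → ℝ) := Icc 0 (fun _ => 2 * Real.pi)
  have : CompactSpace K := isCompact_iff_compactSpace.1 isCompact_Icc
  have hcont : Continuous fun θ => torusMap c (fun _ => R) θ := by unfold torusMap; fun_prop
  have hmem : ∀ θ, torusMap c (fun _ => R) θ ∈ Metric.ball c R' := fun θ => by
    refine (dist_pi_lt_iff (hR.trans hRR')).2 fun j => ?_
    simpa [torusMap, dist_eq_norm, abs_of_pos hR, Complex.norm_exp] using hRR'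
  let W : (Fin m → ℝ) → ℂ := fun θ => (∏ i, (R : ℂ) * Complex.exp (θ i * Complex.I) * Complex.I) *
    f (torusMap c (fun _ => R) θ)
  have hW : Continuous W := by
    refine Continuous.mul (by fun_prop) (hf.continuousOn.comp_continuous hcont hmem)
  let μ : Measure K := Measure.comap Subtype.val volume
  have : IsFiniteMeasure μ := by
    refine ⟨?_⟩
    rw [Measure.comap_apply _ Subtype.val_injective
      (fun s hs => measurableSet_Icc.subtype_image hs) _ MeasurableSet.univ]
    simp only [image_univ, Subtype.range_coe_subtype]
    exact measure_Icc_lt_top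
  have hi : ∀ g : C(K, ℂ), Integrable (fun θ : K => W θ * g θ) μ := fun g => by
    have hc : Continuous fun θ : K => W θ * g θ := (hW.comp continuous_subtype_val).mul g.continuous
    obtain ⟨C, hC⟩ := isCompact_univ.exists_bound_of_continuousOn hc.continuousOn
    exact Integrable.of_bound hc.aestronglyMeasurable C (ae_of_all _ fun θ => hC θ trivial)
  obtain ⟨C, hC⟩ := (isCompact_univ (X := K)).exists_bound_of_continuousOn
    (hW.comp continuous_subtype_val).continuousOn
  let φ : C(K, ℂ) →L[ℂ] ℂ := LinearMap.mkContinuous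
    { toFun := fun g => ∫ θ : K, W θ * g θ ∂μ
      map_add' := fun g h => by
        simp only [ContinuousMap.add_apply, mul_add]; exact integral_add (hi g) (hi h)
      map_smul' := fun a g => by
        simp only [ContinuousMap.smul_apply, RingHom.id_apply, ← integral_smul]
        congr 1; ext θ; simp only [smul_eq_mul]; ring }
    (C * μ.real univ) (fun g => by
      simp only [LinearMap.coe_mk, AddHom.coe_mk]
      refine (norm_integral_le_of_norm_le_const (C := C * ‖g‖) (ae_of_all _ fun θ => ?_)).trans
        (le_of_eq (by ring))
      rw [norm_mul]
      gcongr
      · exact (norm_nonneg _).trans (hC θ trivial)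
      · exact hC θ trivial
      · exact g.norm_coe_le_norm θ)
  let a : Fin m → C(K, ℂ) := fun j =>
    ⟨fun θ => torusMap c (fun _ => R) θ j, ((continuous_apply j).comp hcont).comp continuous_subtype_val⟩
  -- The denominator `ζ j - z j` as a function on the torus, affine in `z`; it is a unit of `C(K,
  -- ℂ)` as long as `z` is inside the torus.
  let A : Fin m → (Fin m → ℂ) → C(K, ℂ) := fun j z => a j - (z j) • (1 : C(K, ℂ))
  have hA : ∀ j, AnalyticAt ℂ (A j) c := fun j => by
    refine analyticAt_const.fun_sub (AnalyticAt.fun_smul ?_ analyticAt_const)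
    exact (ContinuousLinearMap.proj (R := ℂ) (φ := fun _ : Fin m => ℂ) j).analyticAt c
  have hne : ∀ z ∈ Metric.ball c R, ∀ j (θ : K), A j z θ ≠ 0 := fun z hz j θ h => by
    have h0 : torusMap c (fun _ => R) θ j = z j := by
      have : torusMap c (fun _ => R) θ j - z j = 0 := by simpa [A, a] using h
      exact sub_eq_zero.1 this
    have := (dist_pi_lt_iff hR).1 hz j
    rw [← h0] at this
    simp [torusMap, dist_eq_norm, abs_of_pos hR, Complex.norm_exp] at this
  have hunit : ∀ z ∈ Metric.ball c R, ∀ j, IsUnit (A j z) := fun z hz j =>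
    ContinuousMap.isUnit_iff_forall_ne_zero _ |>.2 (hne z hz j)
  have hinv : ∀ j, AnalyticAt ℂ (fun z => Ring.inverse (A j z)) c := fun j => by
    obtain ⟨u, hu⟩ := hunit c (Metric.mem_ball_self hR) j
    refine AnalyticAt.comp (g := Ring.inverse) (f := A j) ?_ (hA j)
    rw [← hu]; exact analyticAt_inverse u
  have hP : AnalyticAt ℂ (fun z => φ (∏ j, Ring.inverse (A j z))) c :=
    (φ.analyticAt _).comp (Finset.analyticAt_fun_prod _ fun j _ => hinv j)
  have hval : ∀ z ∈ Metric.ball c R, ∀ j (θ : K), Ring.inverse (A j z) θ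
      = (torusMap c (fun _ => R) θ j - z j)⁻¹ := fun z hz j θ => by
    have h1 := Ring.inverse_mul_cancel _ (hunit z hz j)
    have h2 := congrArg (fun g : C(K, ℂ) => g θ) h1
    have h3 : A j z θ = torusMap c (fun _ => R) θ j - z j := by simp [A, a]
    simp only [ContinuousMap.mul_apply, ContinuousMap.one_apply] at h2
    rw [← h3]; exact eq_inv_of_mul_eq_one_left h2
  have hkey : ∀ z ∈ Metric.ball c R, f z
      = ((2 * Real.pi * Complex.I) ^ m)⁻¹ * φ (∏ j, Ring.inverse (A j z)) := fun z hz => by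
    have h1 := torusIntegral_prod_sub_inv_mul hR hRR' hf hz
    have h2 : φ (∏ j, Ring.inverse (A j z))
        = torusIntegral (fun ζ => (∏ j, (ζ j - z j)⁻¹) * f ζ) c (fun _ => R) := by
      simp only [φ, LinearMap.mkContinuous_apply, LinearMap.coe_mk, AddHom.coe_mk, torusIntegral]
      rw [← integral_subtype_comap measurableSet_Icc]
      refine integral_congr_ae (ae_of_all _ fun θ => ?_)
      simp only [W, ContinuousMap.prod_apply, hval z hz, smul_eq_mul]
      ring
    rw [h2, h1, inv_mul_cancel_left₀]
    exact pow_ne_zero _ (by simp [Real.pi_ne_zero])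
  refine (analyticAt_const.mul hP).congr ?_ (f := fun z => ((2 * Real.pi * Complex.I) ^ m)⁻¹ *
    φ (∏ j, Ring.inverse (A j z)))
  filter_upwards [Metric.ball_mem_nhds c hR] with z hz using (hkey z hz).symm

/-- A complex differentiable function of several variables on an open set is analytic. -/
theorem analyticOnNhd_of_differentiableOn {E : Type*} [NormedAddCommGroup E] [NormedSpace ℂ E]
    [FiniteDimensional ℂ E] {f : E → ℂ} {U : Set E} (hU : IsOpen U) (hf : DifferentiableOn ℂ f U) :
    AnalyticOnNhd ℂ f U := by
  intro x hx
  let e : E ≃L[ℂ] (Fin (Module.finrank ℂ E) → ℂ) :=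
    ContinuousLinearEquiv.ofFinrankEq (by simp)
  have hopen : IsOpen (e.symm ⁻¹' U) := hU.preimage e.symm.continuous
  obtain ⟨r, hr, hball⟩ := Metric.isOpen_iff.1 hopen (e x) (by simpa using hx)
  have h1 : AnalyticAt ℂ (f ∘ e.symm) (e x) :=
    analyticAt_of_differentiableOn_ball hr
      (hf.comp e.symm.differentiable.differentiableOn hball)
  have h2 : AnalyticAt ℂ ((f ∘ e.symm) ∘ e) x := h1.comp (e.analyticAt x)
  simpa [Function.comp_def] using h2

theorem norm_fderiv_le_of_norm_le {E : Type*} [NormedAddCommGroup E] [NormedSpace ℂ E]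
    {f : E → ℂ} {c : E} {r M : ℝ} (hr : 0 < r) (hf : DifferentiableOn ℂ f (Metric.ball c r))
    (hM : ∀ x ∈ Metric.ball c r, ‖f x‖ ≤ M) : ‖fderiv ℂ f c‖ ≤ 2 * M / r := by
  refine Complex.norm_fderiv_le_div_of_mapsTo_ball hf (fun x hx => ?_) hr
  rw [Metric.mem_closedBall, dist_eq_norm]
  calc ‖f x - f c‖ ≤ ‖f x‖ + ‖f c‖ := norm_sub_le _ _
    _ ≤ 2 * M := by linarith [hM x hx, hM c (Metric.mem_ball_self hr)]

-- For holomorphic integrands a local bound on `f` is enough: on the ball of half the radius,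
-- Cauchy's estimate turns it into an integrable bound on the derivative.
open MeasureTheory in
theorem hasFDerivAt_integral_of_locally_bounded {E α : Type*} [NormedAddCommGroup E]
    [NormedSpace ℂ E] [MeasurableSpace α] {μ : Measure α} {f : E → α → ℂ} {U : Set E}
    (hU : IsOpen U)
    (hf : ∀ᵐ a ∂μ, DifferentiableOn ℂ (fun x => f x a) U)
    (hm : ∀ x ∈ U, AEStronglyMeasurable (f x) μ)
    (hm' : ∀ x ∈ U, AEStronglyMeasurable (fun a => fderiv ℂ (fun y => f y a) x) μ)
    (hb : ∀ x ∈ U, ∃ r > 0, ∃ b : α → ℝ, Integrable b μ ∧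
      ∀ᵐ a ∂μ, ∀ y ∈ Metric.ball x r, ‖f y a‖ ≤ b a) :
    ∀ x ∈ U, Integrable (fun a => fderiv ℂ (fun y => f y a) x) μ ∧
      HasFDerivAt (fun x => ∫ a, f x a ∂μ) (∫ a, fderiv ℂ (fun y => f y a) x ∂μ) x := by
  intro x hx
  obtain ⟨r₁, hr₁, b, hbi, hbb⟩ := hb x hx
  obtain ⟨r₂, hr₂, hball⟩ := Metric.isOpen_iff.1 hU x hx
  set r := min r₁ r₂ with hrdef
  have hr : 0 < r := lt_min hr₁ hr₂
  have hsub : ∀ y ∈ Metric.ball x (r / 2), Metric.ball y (r / 2) ⊆ Metric.ball x r := fun y hy => by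
    refine Metric.ball_subset_ball' ?_
    have := Metric.mem_ball.1 hy
    linarith
  have hU' : Metric.ball x r ⊆ U :=
    (Metric.ball_subset_ball (min_le_right _ _)).trans hball
  have hB' : Metric.ball x r ⊆ Metric.ball x r₁ := Metric.ball_subset_ball (min_le_left _ _)
  have hbd : ∀ᵐ a ∂μ, ∀ y ∈ Metric.ball x (r / 2),
      ‖fderiv ℂ (fun y => f y a) y‖ ≤ 2 * b a / (r / 2) := by
    filter_upwards [hbb, hf] with a ha hfa y hy
    exact norm_fderiv_le_of_norm_le (half_pos hr) (hfa.mono ((hsub y hy).trans hU'))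
      (fun z hz => ha z (hB' (hsub y hy hz)))
  refine ⟨((hbi.const_mul 2).div_const _).mono' (hm' x hx) (by
    filter_upwards [hbd] with a ha using ha x (Metric.mem_ball_self (half_pos hr))), ?_⟩
  exact hasFDerivAt_integral_of_dominated_of_fderiv_le (𝕜 := ℂ) (μ := μ) (F := f)
    (F' := fun y a => fderiv ℂ (fun y => f y a) y) (x₀ := x) (bound := fun a => 2 * b a / (r / 2))
    (s := Metric.ball x (r / 2)) (Metric.ball_mem_nhds x (half_pos hr))
    (by filter_upwards [hU.mem_nhds hx] with y hy using hm y hy)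
    (hbi.mono' (hm x hx) (by
      filter_upwards [hbb] with a ha using ha x (Metric.mem_ball_self hr₁)))
    (hm' x hx)
    hbd
    ((hbi.const_mul 2).div_const _)
    (by
      filter_upwards [hf] with a hfa y hy
      have hyU : y ∈ U := hU' (Metric.ball_subset_ball (by linarith) hy)
      exact ((hfa y hyU).differentiableAt (hU.mem_nhds hyU)).hasFDerivAt)

theorem differentiableOn_tsum_of_locally_summable {E : Type*} [NormedAddCommGroup E]
    [NormedSpace ℂ E] {f : ℕ → E → ℂ} {U : Set E} (hU : IsOpen U)
    (hf : ∀ m, DifferentiableOn ℂ (f m) U)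
    (hb : ∀ x ∈ U, ∃ r > 0, ∃ b : ℕ → ℝ, Summable b ∧
      ∀ m, ∀ y ∈ Metric.ball x r, ‖f m y‖ ≤ b m) :
    DifferentiableOn ℂ (fun x => ∑' m, f m x) U := by
  -- A real structure is needed only to know that balls are convex, hence preconnected.
  let _ : NormedSpace ℝ E := NormedSpace.restrictScalars ℝ ℂ E
  intro x hx
  obtain ⟨r₁, hr₁, b, hbi, hbb⟩ := hb x hx
  obtain ⟨r₂, hr₂, hball⟩ := Metric.isOpen_iff.1 hU x hx
  set r := min r₁ r₂ with hrdef
  have hr : 0 < r := lt_min hr₁ hr₂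
  have hsub : ∀ y ∈ Metric.ball x (r / 2), Metric.ball y (r / 2) ⊆ Metric.ball x r := fun y hy => by
    refine Metric.ball_subset_ball' ?_
    have := Metric.mem_ball.1 hy
    linarith
  have hU' : Metric.ball x r ⊆ U :=
    (Metric.ball_subset_ball (min_le_right _ _)).trans hball
  have hB' : Metric.ball x r ⊆ Metric.ball x r₁ := Metric.ball_subset_ball (min_le_left _ _)
  have key := hasFDerivAt_tsum_of_isPreconnected (𝕜 := ℂ) (f := f)
    (f' := fun m y => fderiv ℂ (f m) y) (u := fun m => 2 * b m / (r / 2)) (x₀ := x) (x := x)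
    ((hbi.mul_left 2).div_const _) Metric.isOpen_ball
    (convex_ball x (r / 2)).isPreconnected
    (fun m y hy => by
      have hyU : y ∈ U := hU' (Metric.ball_subset_ball (by linarith) hy)
      exact ((hf m y hyU).differentiableAt (hU.mem_nhds hyU)).hasFDerivAt)
    (fun m y hy => norm_fderiv_le_of_norm_le (half_pos hr) ((hf m).mono ((hsub y hy).trans hU'))
        (fun z hz => hbb m z (hB' (hsub y hy hz))))
    (Metric.mem_ball_self (half_pos hr))
    (Summable.of_norm_bounded hbi fun m => hbb m x (Metric.mem_ball_self hr₁))
    (Metric.mem_ball_self (half_pos hr))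
  exact key.differentiableAt.differentiableWithinAt

/-! ### Directional derivatives and the components of the jet. -/

section

variable {n : ℕ}

/-- The derivative of `u` in the direction `v`. -/
noncomputable def dirDeriv (v : LogCover × (Fin n → ℂ)) (u : LogCover × (Fin n → ℂ) → ℂ) :
    LogCover × (Fin n → ℂ) → ℂ :=
  fun p => fderiv ℂ u p v

theorem eulerOp_eq_dirDeriv (u : LogCover × (Fin n → ℂ) → ℂ) : eulerOp u = dirDeriv (1, 0) u := rfl

theorem AnalyticOnNhd.dirDeriv {u : LogCover × (Fin n → ℂ) → ℂ} {Ω : Set (LogCover × (Fin n → ℂ))}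
    (hu : AnalyticOnNhd ℂ u Ω) (v : LogCover × (Fin n → ℂ)) :
    AnalyticOnNhd ℂ (dirDeriv v u) Ω := fun p hp =>
  ((ContinuousLinearMap.apply ℂ ℂ v).analyticAt _).comp (hu p hp).fderiv

theorem dirDeriv_congr {u u' : LogCover × (Fin n → ℂ) → ℂ} {Ω : Set (LogCover × (Fin n → ℂ))}
    (hΩ : IsOpen Ω) (h : Set.EqOn u u' Ω) (v : LogCover × (Fin n → ℂ)) :
    Set.EqOn (dirDeriv v u) (dirDeriv v u') Ω := fun p hp => by
  have : u =ᶠ[𝓝 p] u' := by filter_upwards [hΩ.mem_nhds hp] with q hq using h hq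
  simp only [dirDeriv, this.fderiv_eq]

theorem dirDeriv_comm {u : LogCover × (Fin n → ℂ) → ℂ} {p : LogCover × (Fin n → ℂ)}
    (hu : AnalyticAt ℂ u p) (v w : LogCover × (Fin n → ℂ)) :
    dirDeriv v (dirDeriv w u) p = dirDeriv w (dirDeriv v u) p := by
  have hd : DifferentiableAt ℂ (fderiv ℂ u) p := hu.fderiv.differentiableAt
  have h : ∀ a b, dirDeriv a (dirDeriv b u) p = fderiv ℂ (fderiv ℂ u) p a b := fun a b => by
    have := ((ContinuousLinearMap.apply ℂ ℂ b).hasFDerivAt).comp p hd.hasFDerivAt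
    change fderiv ℂ (fun q => fderiv ℂ u q b) p a = _
    have h2 : fderiv ℂ (fun q => fderiv ℂ u q b) p = _ := this.fderiv
    rw [h2]; rfl
  have hs : IsSymmSndFDerivAt ℂ u p :=
    (hu.contDiffAt (n := ⊤)).isSymmSndFDerivAt_of_omega
  rw [h, h, hs v w]

theorem dirDeriv_sub {u u' : LogCover × (Fin n → ℂ) → ℂ} {Ω : Set (LogCover × (Fin n → ℂ))}
    (hu : AnalyticOnNhd ℂ u Ω) (hu' : AnalyticOnNhd ℂ u' Ω) (v : LogCover × (Fin n → ℂ)) :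
    Set.EqOn (dirDeriv v (fun p => u p - u' p)) (fun p => dirDeriv v u p - dirDeriv v u' p) Ω :=
  fun p hp => by
  simp only [dirDeriv]
  rw [fderiv_fun_sub (hu p hp).differentiableAt (hu' p hp).differentiableAt]; rfl

theorem dirDeriv_add_period {u : LogCover × (Fin n → ℂ) → ℂ} {a : LogCover × (Fin n → ℂ)}
    (h : ∀ p, u (p + a) = u p) (v p : LogCover × (Fin n → ℂ)) :
    dirDeriv v u (p + a) = dirDeriv v u p := by
  simp only [dirDeriv]
  rw [← fderiv_comp_add_right]
  simp only [h]

theorem hasDerivAt_line {u : LogCover × (Fin n → ℂ) → ℂ} {p v : LogCover × (Fin n → ℂ)} {z : ℂ}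
    (hu : DifferentiableAt ℂ u (p + z • v)) :
    HasDerivAt (fun z : ℂ => u (p + z • v)) (dirDeriv v u (p + z • v)) z := by
  have h1 : HasDerivAt (fun z : ℂ => p + z • v) v z := by
    simpa using ((hasDerivAt_id z).smul_const v).const_add p
  exact hu.hasFDerivAt.comp_hasDerivAt z h1

/-- Cauchy's estimate on a single complex line, so that only the disc in the direction `v` has to
lie in `Ω`. -/
theorem norm_dirDeriv_le {u : LogCover × (Fin n → ℂ) → ℂ} {Ω : Set (LogCover × (Fin n → ℂ))}
    (hu : AnalyticOnNhd ℂ u Ω) {p v : LogCover × (Fin n → ℂ)} {δ M : ℝ} (hδ : 0 < δ)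
    (hΩ : ∀ z : ℂ, ‖z‖ < δ → p + z • v ∈ Ω) (hM : ∀ z : ℂ, ‖z‖ < δ → ‖u (p + z • v)‖ ≤ M) :
    ‖dirDeriv v u p‖ ≤ 2 * M / δ := by
  have h1 : ∀ z : ℂ, ‖z‖ < δ →
      HasDerivAt (fun z : ℂ => u (p + z • v)) (dirDeriv v u (p + z • v)) z := fun z hz =>
    hasDerivAt_line (hu _ (hΩ z hz)).differentiableAt
  have h2 := norm_fderiv_le_of_norm_le (f := fun z : ℂ => u (p + z • v)) (c := 0) (M := M) hδ
    (fun z hz => (h1 z (by simpa using hz)).differentiableAt.differentiableWithinAt)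
    (fun z hz => hM z (by simpa using hz))
  have h3 := (h1 0 (by simpa using hδ)).deriv
  rw [← norm_deriv_eq_norm_fderiv, h3] at h2
  simpa using h2

/-- The component of `jet u` of index `k`. -/
noncomputable def jetOp (k : JetIndex n) (u : LogCover × (Fin n → ℂ) → ℂ) :
    LogCover × (Fin n → ℂ) → ℂ :=
  eulerOp^[k.ord] (partialXMulti k.multi u)

theorem jet_eq (u : LogCover × (Fin n → ℂ) → ℂ) (p : LogCover × (Fin n → ℂ)) :
    jet u p = (LogCover.proj p.1, p.2, fun k => jetOp k u p) := rfl

theorem partialXMulti_eq_foldr (α : Fin n → ℕ) :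
    ∃ L : List (Fin n), L.length = ∑ j, α j ∧
      ∀ u, partialXMulti α u = L.foldr (fun j g => partialX j g) u := by
  have hrep : ∀ (j : Fin n) (m : ℕ) u,
      (List.replicate m j).foldr (fun j g => partialX j g) u = (partialX j)^[m] u := by
    intro j m
    induction m with
    | zero => intro u; rfl
    | succ m ih => intro u; rw [List.replicate_succ, List.foldr_cons, ih, Function.iterate_succ_apply']
  have key : ∀ l : List (Fin n), ∃ L : List (Fin n), L.length = (l.map α).sum ∧
      ∀ u, l.foldr (fun j g => (partialX j)^[α j] g) u = L.foldr (fun j g => partialX j g) u := by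
    intro l
    induction l with
    | nil => exact ⟨[], rfl, fun u => rfl⟩
    | cons j l ih =>
      obtain ⟨L, hL, h⟩ := ih
      refine ⟨List.replicate (α j) j ++ L, by simp [hL], fun u => ?_⟩
      rw [List.foldr_cons, List.foldr_append, hrep, h]
  obtain ⟨L, hL, h⟩ := key (List.finRange n)
  refine ⟨L, hL.trans ?_, h⟩
  rw [← List.ofFn_eq_map, List.sum_ofFn]

theorem jetOp_pure_zero (u : LogCover × (Fin n → ℂ) → ℂ) : jetOp (JetIndex.pure n 0) u = u := by
  obtain ⟨L, hL, h⟩ := partialXMulti_eq_foldr (JetIndex.pure n 0).multi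
  have : L = [] := by
    rw [← List.length_eq_zero_iff, hL]; simp [JetIndex.pure, JetIndex.multi]
  subst this
  exact h u

theorem jetOp_pure_one (u : LogCover × (Fin n → ℂ) → ℂ) :
    jetOp (JetIndex.pure n 1) u = eulerOp u := by
  obtain ⟨L, hL, h⟩ := partialXMulti_eq_foldr (JetIndex.pure n 1).multi
  have : L = [] := by
    rw [← List.length_eq_zero_iff, hL]; simp [JetIndex.pure, JetIndex.multi]
  subst this
  exact congrArg eulerOp (h u)

/-- The derivations occurring in a jet. -/
theorem jetIndex_cases (k : JetIndex n) :
    k = JetIndex.pure n 0 ∨ k = JetIndex.pure n 1 ∨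
    (0 < ∑ j, k.multi j ∧ ((∃ j, ∀ u, jetOp k u = partialX j u) ∨
      (∃ j, ∀ u, jetOp k u = eulerOp (partialX j u)) ∨
      (∃ j l, ∀ u, jetOp k u = partialX j (partialX l u)))) := by
  obtain ⟨⟨i, α⟩, h1, h2⟩ := k
  simp only at h1 h2
  rcases Nat.eq_zero_or_pos (∑ j, α j) with h0 | h0
  · have hα : α = 0 := by
      funext j
      have := Finset.single_le_sum (f := α) (fun _ _ => Nat.zero_le _) (Finset.mem_univ j)
      simpa [h0] using this
    subst hα
    interval_cases i
    · left; rfl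
    · right; left; rfl
  · right; right
    refine ⟨h0, ?_⟩
    obtain ⟨L, hL, h⟩ := partialXMulti_eq_foldr α
    have hj : ∀ u, jetOp (⟨(i, α), h1, h2⟩ : JetIndex n) u
        = eulerOp^[i] (L.foldr (fun j g => partialX j g) u) := fun u => congrArg _ (h u)
    rw [← hL] at h0 h1
    match L, hj, h0, h1 with
    | [j], hj, _, h1 =>
      have : i = 0 ∨ i = 1 := by simp at h1; omega
      rcases this with rfl | rfl
      · exact Or.inl ⟨j, fun u => hj u⟩
      · exact Or.inr (Or.inl ⟨j, fun u => hj u⟩)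
    | [j, l], hj, _, h1 =>
      have : i = 0 := by simp at h1; omega
      subst this
      exact Or.inr (Or.inr ⟨j, l, fun u => hj u⟩)
    | _ :: _ :: _ :: _, _, _, h1 => simp at h1; omega

/-- Each jet component is a word in directional derivatives, so that analyticity, linearity and
periodicity of jets follow by induction on the word. -/
theorem jetOp_eq_foldr (k : JetIndex n) :
    ∃ L : List (LogCover × (Fin n → ℂ)), ∀ u, jetOp k u = L.foldr dirDeriv u := by
  rcases jetIndex_cases k with rfl | rfl | ⟨-, ⟨j, h⟩ | ⟨j, h⟩ | ⟨j, l, h⟩⟩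
  · exact ⟨[], fun u => jetOp_pure_zero u⟩
  · exact ⟨[(1, 0)], fun u => jetOp_pure_one u⟩
  · exact ⟨[(0, Pi.single j 1)], h⟩
  · exact ⟨[(1, 0), (0, Pi.single j 1)], h⟩
  · exact ⟨[(0, Pi.single j 1), (0, Pi.single l 1)], h⟩

theorem AnalyticOnNhd.jetOp {u : LogCover × (Fin n → ℂ) → ℂ} {Ω : Set (LogCover × (Fin n → ℂ))}
    (hu : AnalyticOnNhd ℂ u Ω) (k : JetIndex n) : AnalyticOnNhd ℂ (jetOp k u) Ω := by
  obtain ⟨L, hL⟩ := jetOp_eq_foldr k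
  rw [hL]
  induction L generalizing k with
  | nil => exact hu
  | cons v L ih =>
    rw [List.foldr_cons]
    refine AnalyticOnNhd.dirDeriv ?_ v
    clear hL ih
    induction L with
    | nil => exact hu
    | cons w L ih => exact ih.dirDeriv w

theorem jetOp_sub {u u' : LogCover × (Fin n → ℂ) → ℂ} {Ω : Set (LogCover × (Fin n → ℂ))}
    (hΩ : IsOpen Ω) (hu : AnalyticOnNhd ℂ u Ω) (hu' : AnalyticOnNhd ℂ u' Ω) (k : JetIndex n) :
    Set.EqOn (jetOp k (fun p => u p - u' p)) (fun p => jetOp k u p - jetOp k u' p) Ω := by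
  obtain ⟨L, hL⟩ := jetOp_eq_foldr k
  simp only [hL]
  clear hL
  have han : ∀ (L : List (LogCover × (Fin n → ℂ))) {u : LogCover × (Fin n → ℂ) → ℂ},
      AnalyticOnNhd ℂ u Ω → AnalyticOnNhd ℂ (L.foldr dirDeriv u) Ω := fun L u hu => by
    induction L with
    | nil => exact hu
    | cons w L ih => exact ih.dirDeriv w
  induction L with
  | nil => exact fun p _ => rfl
  | cons v L ih =>
    exact (dirDeriv_congr hΩ ih v).trans (dirDeriv_sub (han L hu) (han L hu') v)

theorem jetOp_add_period {u : LogCover × (Fin n → ℂ) → ℂ} {a : LogCover × (Fin n → ℂ)}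
    (h : ∀ p, u (p + a) = u p) (k : JetIndex n) (p : LogCover × (Fin n → ℂ)) :
    jetOp k u (p + a) = jetOp k u p := by
  obtain ⟨L, hL⟩ := jetOp_eq_foldr k
  simp only [hL]
  clear hL
  induction L generalizing p with
  | nil => exact h p
  | cons v L ih => exact dirDeriv_add_period ih v p

theorem eulerOp_partialX_comm {u : LogCover × (Fin n → ℂ) → ℂ}
    {Ω : Set (LogCover × (Fin n → ℂ))} (hu : AnalyticOnNhd ℂ u Ω) (j : Fin n)
    {p : LogCover × (Fin n → ℂ)} (hp : p ∈ Ω) :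
    eulerOp (partialX j u) p = partialX j (eulerOp u) p :=
  dirDeriv_comm (hu p hp) _ _

/-! ### Conical neighbourhoods of the origin in the logarithmic variable -/

/-- `|t|^(1/7)` in the logarithmic variable. -/
noncomputable def wt (s : LogCover) : ℝ := Real.exp (Complex.re s / 7)

theorem wt_pos (s : LogCover) : 0 < wt s := Real.exp_pos _

theorem wt_pow_seven (s : LogCover) : wt s ^ 7 = ‖LogCover.proj s‖ := by
  rw [wt, ← Real.exp_nat_mul, LogCover.proj, Complex.norm_exp]; congr 1; push_cast; ring

theorem continuous_wt : Continuous wt := by unfold wt; fun_prop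

/-- The function `R - ‖x‖ - K |t|^(1/7)`. -/
noncomputable def gap (R K : ℝ) (p : LogCover × (Fin n → ℂ)) : ℝ := R - ‖p.2‖ - K * wt p.1

theorem continuous_gap (R K : ℝ) : Continuous (gap (n := n) R K) := by
  unfold gap
  exact (continuous_const.sub continuous_snd.norm).sub
    (continuous_const.mul (continuous_wt.comp continuous_fst))

/-- The set of all `(t, x)` with `arg t ∈ I`, `log |t| < T` and `‖x‖ + K |t|^(1/7) < R`. -/
def cone (n : ℕ) (I : Set ℝ) (T R K : ℝ) : Set (LogCover × (Fin n → ℂ)) :=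
  {p | Complex.im p.1 ∈ I ∧ Complex.re p.1 < T ∧ 0 < gap R K p}

theorem isOpen_cone {I : Set ℝ} (hI : IsOpen I) (T R K : ℝ) : IsOpen (cone n I T R K) := by
  refine (hI.preimage (Complex.continuous_im.comp continuous_fst)).inter (IsOpen.inter ?_ ?_)
  · exact isOpen_lt (Complex.continuous_re.comp continuous_fst) continuous_const
  · exact isOpen_lt continuous_const (continuous_gap R K)

theorem gap_le_gap_sub {R K : ℝ} (hK : 0 ≤ K) (p : LogCover × (Fin n → ℂ)) {σ : ℝ} (hσ : 0 ≤ σ) :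
    gap R K p ≤ gap R K (p.1 - σ, p.2) := by
  have : wt (p.1 - σ) ≤ wt p.1 := by
    unfold wt; apply Real.exp_le_exp.2; simp; linarith
  unfold gap
  have := mul_le_mul_of_nonneg_left this hK
  simp only; linarith

theorem cone_sub_mem {I : Set ℝ} {T R K : ℝ} (hK : 0 ≤ K) {p : LogCover × (Fin n → ℂ)}
    (hp : p ∈ cone n I T R K) {σ : ℝ} (hσ : 0 ≤ σ) : (p.1 - σ, p.2) ∈ cone n I T R K := by
  obtain ⟨h1, h2, h3⟩ := hp
  refine ⟨by simpa using h1, ?_, h3.trans_le (gap_le_gap_sub hK p hσ)⟩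
  simp; linarith

/-- Cauchy's estimate on a disc of radius `gap / 2`, on which `gap` at most halves. A derivative in
`x` thus costs exactly one power of `gap`, and a weight in `s` alone passes through unchanged. -/
theorem norm_partialX_le_of_weighted {I : Set ℝ} {T R K : ℝ} {g : LogCover × (Fin n → ℂ) → ℂ}
    (hg : AnalyticOnNhd ℂ g (cone n I T R K)) {M : LogCover → ℝ} {q : ℕ}
    (hM : ∀ p ∈ cone n I T R K, ‖g p‖ ≤ M p.1 / gap R K p ^ q) (j : Fin n)
    {p : LogCover × (Fin n → ℂ)} (hp : p ∈ cone n I T R K) :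
    ‖partialX j g p‖ ≤ 2 ^ (q + 2) * M p.1 / gap R K p ^ (q + 1) := by
  obtain ⟨h1, h2, h3⟩ := hp
  have hM0 : 0 ≤ M p.1 := by
    have := (norm_nonneg _).trans (hM p ⟨h1, h2, h3⟩)
    by_contra hneg
    have := div_neg_of_neg_of_pos (not_le.1 hneg) (pow_pos h3 q)
    linarith
  have hgap : ∀ z : ℂ, ‖z‖ < gap R K p / 2 →
      gap R K p / 2 ≤ gap R K (p + z • ((0, Pi.single j 1) : LogCover × (Fin n → ℂ))) := by
    intro z hz
    have h5 : ‖z • (Pi.single j 1 : Fin n → ℂ)‖ = ‖z‖ := by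
      rw [norm_smul, Pi.norm_single]; simp
    have h4 := norm_add_le p.2 (z • (Pi.single j 1 : Fin n → ℂ))
    rw [h5] at h4
    simp only [gap, Prod.snd_add, Prod.smul_snd, Prod.fst_add, Prod.smul_fst, smul_zero,
      add_zero] at hz ⊢
    linarith
  have hmem : ∀ z : ℂ, ‖z‖ < gap R K p / 2 →
      p + z • ((0, Pi.single j 1) : LogCover × (Fin n → ℂ)) ∈ cone n I T R K := fun z hz =>
    ⟨by simpa using h1, by simpa using h2, (half_pos h3).trans_le (hgap z hz)⟩
  have key := norm_dirDeriv_le hg (p := p) (v := (0, Pi.single j 1))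
    (M := M p.1 / (gap R K p / 2) ^ q) (half_pos h3) hmem (fun z hz => by
      refine (hM _ (hmem z hz)).trans ?_
      have : (p + z • ((0, Pi.single j 1) : LogCover × (Fin n → ℂ))).1 = p.1 := by simp
      rw [this]
      have := hgap z hz
      gcongr)
  refine key.trans (le_of_eq ?_)
  rw [div_pow]
  field_simp
  ring

theorem shift_eq_line (p : LogCover × (Fin n → ℂ)) (σ : ℝ) :
    ((p.1 - σ, p.2) : LogCover × (Fin n → ℂ)) = p + (-(σ : ℂ)) • (1, 0) := by
  ext <;> simp [sub_eq_add_neg]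

theorem hasDerivAt_ray {w : LogCover × (Fin n → ℂ) → ℂ} {p : LogCover × (Fin n → ℂ)} {σ : ℝ}
    (hw : AnalyticAt ℂ w (p.1 - σ, p.2)) :
    HasDerivAt (fun σ : ℝ => w (p.1 - σ, p.2)) (-eulerOp w (p.1 - σ, p.2)) σ := by
  have h1 : HasDerivAt (fun σ : ℝ => -(σ : ℂ)) (-1) σ := (Complex.ofRealCLM.hasDerivAt (x := σ)).neg
  rw [shift_eq_line] at hw
  have h2 := (hasDerivAt_line hw.differentiableAt).comp σ h1
  simp only [shift_eq_line]
  simpa [Function.comp_def, eulerOp_eq_dirDeriv] using h2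

/-- The function `h σ = exp (lam σ) w (s - σ, x)` has derivative `-exp (lam σ) (eulerOp w - lam w)`,
whose norm is at most the rate of decrease of `φ`. As `w` is bounded on the ray and `Re lam < 0`,
`h` vanishes at infinity, so `h 0 = w p` is bounded by the total decrease of `φ`, at most `φ 0`. -/
theorem norm_le_of_ray_comparison {lam : ℂ} (hlam : lam.re < 0) {w : LogCover × (Fin n → ℂ) → ℂ}
    {p : LogCover × (Fin n → ℂ)} (hw : ∀ σ : ℝ, 0 ≤ σ → AnalyticAt ℂ w (p.1 - σ, p.2)) {M : ℝ}
    (hM : ∀ σ : ℝ, 0 ≤ σ → ‖w (p.1 - σ, p.2)‖ ≤ M) {φ φ' : ℝ → ℝ}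
    (hφ : ∀ σ, 0 ≤ σ → HasDerivAt φ (φ' σ) σ) (hφ0 : ∀ σ, 0 ≤ σ → 0 ≤ φ σ)
    (hg : ∀ σ : ℝ, 0 ≤ σ → Real.exp (lam.re * σ) *
      ‖eulerOp w (p.1 - σ, p.2) - lam * w (p.1 - σ, p.2)‖ ≤ -φ' σ) :
    ‖w p‖ ≤ φ 0 := by
  let h : ℝ → ℂ := fun σ => Complex.exp (lam * σ) * w (p.1 - σ, p.2)
  have hn : ∀ σ : ℝ, ‖Complex.exp (lam * σ)‖ = Real.exp (lam.re * σ) := fun σ => by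
    rw [Complex.norm_exp]; simp
  have hd : ∀ σ : ℝ, 0 ≤ σ → HasDerivAt h
      (-(Complex.exp (lam * σ) * (eulerOp w (p.1 - σ, p.2) - lam * w (p.1 - σ, p.2)))) σ := by
    intro σ hσ
    have h1 : HasDerivAt (fun σ : ℝ => Complex.exp (lam * σ)) (Complex.exp (lam * σ) * lam) σ := by
      have := ((Complex.ofRealCLM.hasDerivAt (x := σ)).const_mul lam).cexp
      simpa using this
    refine (h1.mul (hasDerivAt_ray (hw σ hσ))).congr_deriv ?_
    ring
  have hle : ∀ S : ℝ, 0 ≤ S → ‖w p‖ ≤ φ 0 + Real.exp (lam.re * S) * M := by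
    intro S hS
    have key := image_norm_le_of_norm_deriv_right_le_deriv_boundary' (f := fun σ => h σ - h 0)
      (f' := fun σ => -(Complex.exp (lam * σ) *
        (eulerOp w (p.1 - σ, p.2) - lam * w (p.1 - σ, p.2)))) (a := 0) (b := S)
      (fun σ hσ => ((hd σ hσ.1).sub_const _).continuousAt.continuousWithinAt)
      (fun σ hσ => ((hd σ hσ.1).sub_const _).hasDerivWithinAt)
      (B := fun σ => φ 0 - φ σ) (B' := fun σ => -φ' σ) (by simp)
      (fun σ hσ => ((hφ σ hσ.1).const_sub _).continuousAt.continuousWithinAt)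
      (fun σ hσ => ((hφ σ hσ.1).const_sub _).hasDerivWithinAt)
      (fun σ hσ => by rw [norm_neg, norm_mul, hn]; exact hg σ hσ.1)
      (Set.right_mem_Icc.2 hS)
    have h0 : h 0 = w p := by simp [h]
    have h2 : ‖w p‖ ≤ ‖h S - h 0‖ + ‖h S‖ := by
      rw [← h0, ← norm_neg (h S - h 0)]
      calc ‖h 0‖ = ‖-(h S - h 0) + h S‖ := by congr 1; ring
        _ ≤ _ := norm_add_le _ _
    have h3 : ‖h S‖ ≤ Real.exp (lam.re * S) * M := by
      simp only [h]; rw [norm_mul, hn]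
      exact mul_le_mul_of_nonneg_left (hM S hS) (Real.exp_pos _).le
    have := hφ0 S hS
    linarith
  have hlim : Tendsto (fun S : ℝ => φ 0 + Real.exp (lam.re * S) * M) atTop (𝓝 (φ 0 + 0 * M)) := by
    refine tendsto_const_nhds.add (Tendsto.mul_const M ?_)
    exact Real.tendsto_exp_atBot.comp (tendsto_id.const_mul_atTop_of_neg hlam)
  rw [zero_mul, add_zero] at hlim
  exact ge_of_tendsto hlim (by filter_upwards [eventually_ge_atTop 0] with S hS using hle S hS)

theorem norm_le_of_ray_bound {lam : ℂ} (hlam : lam.re < 0) {w : LogCover × (Fin n → ℂ) → ℂ}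
    {p : LogCover × (Fin n → ℂ)} (hw : ∀ σ : ℝ, 0 ≤ σ → AnalyticAt ℂ w (p.1 - σ, p.2)) {M : ℝ}
    (hM : ∀ σ : ℝ, 0 ≤ σ → ‖w (p.1 - σ, p.2)‖ ≤ M) {A : ℝ}
    (hg : ∀ σ : ℝ, 0 ≤ σ → ‖eulerOp w (p.1 - σ, p.2) - lam * w (p.1 - σ, p.2)‖ ≤ A) :
    ‖w p‖ ≤ A / -lam.re := by
  have hA : 0 ≤ A := (norm_nonneg _).trans (hg 0 le_rfl)
  have h := norm_le_of_ray_comparison hlam hw hM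
    (φ := fun σ => A / -lam.re * Real.exp (lam.re * σ))
    (φ' := fun σ => A / -lam.re * (Real.exp (lam.re * σ) * lam.re)) ?_ ?_ ?_
  · simpa using h
  · intro σ _
    have := (((hasDerivAt_id σ).const_mul lam.re).exp).const_mul (A / -lam.re)
    simpa using this
  · intro σ _
    have : 0 < -lam.re := by linarith
    positivity
  · intro σ hσ
    have h1 : -(A / -lam.re * (Real.exp (lam.re * σ) * lam.re)) = Real.exp (lam.re * σ) * A := by
      have := hlam.ne
      field_simp
    rw [h1]
    exact mul_le_mul_of_nonneg_left (hg σ hσ) (Real.exp_pos _).le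

theorem wt_sub_le (s : LogCover) {σ : ℝ} (hσ : 0 ≤ σ) : wt (s - σ) ≤ wt s := by
  unfold wt; apply Real.exp_le_exp.2; simp; linarith

/-- Towards `t = 0` the gap grows at a rate proportional to `K`; this is the source of every factor
`1 / K`. -/
theorem hasDerivAt_gap_ray (R K : ℝ) (p : LogCover × (Fin n → ℂ)) (σ : ℝ) :
    HasDerivAt (fun σ : ℝ => gap R K (p.1 - σ, p.2)) (K * wt (p.1 - σ) / 7) σ := by
  have h1 : HasDerivAt (fun σ : ℝ => wt (p.1 - σ)) (-(wt (p.1 - σ) / 7)) σ := by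
    have : HasDerivAt (fun σ : ℝ => Real.exp ((p.1.re - σ) / 7))
      (Real.exp ((p.1.re - σ) / 7) * (-1 / 7)) σ :=
      (((hasDerivAt_id σ).const_sub p.1.re).div_const 7).exp
    unfold wt
    simp only [Complex.sub_re, Complex.ofReal_re]
    refine this.congr_deriv ?_
    ring
  have h2 := (h1.const_mul K).const_sub (R - ‖p.2‖)
  unfold gap
  refine h2.congr_deriv ?_
  ring

/-- One factor `wt` of the source, together with `K / 7`, is the derivative of `gap` along the ray,
so integration lowers the power of `gap` by one. The other `a` factors are frozen at their value at
`p`, and the exponential is bounded by `1`. -/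
theorem norm_le_of_ray_weighted {lam : ℂ} (hlam : lam.re < 0) {I : Set ℝ} {T R K B : ℝ}
    (hK : 0 < K) (hB : 0 ≤ B) {w : LogCover × (Fin n → ℂ) → ℂ}
    (hw : AnalyticOnNhd ℂ w (cone n I T R K)) {p : LogCover × (Fin n → ℂ)}
    (hp : p ∈ cone n I T R K) {M : ℝ} (hM : ∀ σ : ℝ, 0 ≤ σ → ‖w (p.1 - σ, p.2)‖ ≤ M) {a b : ℕ}
    (hg : ∀ q ∈ cone n I T R K,
      ‖eulerOp w q - lam * w q‖ ≤ B * wt q.1 ^ (a + 1) / gap R K q ^ (b + 2)) :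
    ‖w p‖ ≤ 7 * B / K * wt p.1 ^ a / gap R K p ^ (b + 1) := by
  have hmem := fun (σ : ℝ) (hσ : 0 ≤ σ) => cone_sub_mem hK.le hp hσ
  have h := norm_le_of_ray_comparison hlam (fun σ hσ => hw _ (hmem σ hσ)) hM
    (φ := fun σ => 7 * B / K * wt p.1 ^ a * (gap R K (p.1 - σ, p.2) ^ (b + 1))⁻¹)
    (φ' := fun σ => 7 * B / K * wt p.1 ^ a * (-(((b + 1 : ℕ) : ℝ) * gap R K (p.1 - σ, p.2) ^ b *
      (K * wt (p.1 - σ) / 7)) / (gap R K (p.1 - σ, p.2) ^ (b + 1)) ^ 2)) ?_ ?_ ?_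
  · refine h.trans (le_of_eq ?_)
    simp [div_eq_mul_inv]
  · intro σ hσ
    have h1 := (hasDerivAt_gap_ray R K p σ).pow (b + 1)
    have h2 := (h1.inv (pow_ne_zero _ (hmem σ hσ).2.2.ne')).const_mul (7 * B / K * wt p.1 ^ a)
    simpa using! h2
  · intro σ hσ
    have := (hmem σ hσ).2.2
    have := wt_pos p.1
    positivity
  · intro σ hσ
    have hG := (hmem σ hσ).2.2
    have hW := wt_pos (p.1 - σ)
    have hWp := wt_pos p.1
    have hWle := wt_sub_le p.1 hσ
    have he : Real.exp (lam.re * σ) ≤ 1 := Real.exp_le_one_iff.2 (by nlinarith)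
    have hgσ := hg _ (hmem σ hσ)
    have e1 : -(7 * B / K * wt p.1 ^ a * (-(((b + 1 : ℕ) : ℝ) * gap R K (p.1 - σ, p.2) ^ b *
      (K * wt (p.1 - σ) / 7)) / (gap R K (p.1 - σ, p.2) ^ (b + 1)) ^ 2))
        = ((b + 1 : ℕ) : ℝ) * (B * (wt p.1 ^ a * wt (p.1 - σ)) / gap R K (p.1 - σ, p.2) ^ (b + 2)) := by
      field_simp
      ring
    rw [e1]
    refine (mul_le_mul he hgσ (norm_nonneg _) zero_le_one).trans ?_
    have h1 : (1 : ℝ) ≤ ((b + 1 : ℕ) : ℝ) := by push_cast; linarith [Nat.cast_nonneg (α := ℝ) b]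
    refine mul_le_mul h1 ?_ (by positivity) (by positivity)
    rw [pow_succ]
    simp only
    gcongr

/-! ### Solving `eulerOp w - lam * w = f` by integration along rays -/

/-- Local boundedness, uniformly on the rays `σ ↦ (s - σ, x)`, `σ ≥ 0`. -/
def RayBounded (Ω : Set (LogCover × (Fin n → ℂ))) (f : LogCover × (Fin n → ℂ) → ℂ) : Prop :=
  ∀ p ∈ Ω, ∃ r > 0, ∃ M, ∀ q ∈ Metric.ball p r, ∀ σ : ℝ, 0 ≤ σ → ‖f (q.1 - σ, q.2)‖ ≤ M

theorem RayBounded.mono {Ω Ω' : Set (LogCover × (Fin n → ℂ))} {f : LogCover × (Fin n → ℂ) → ℂ}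
    (h : RayBounded Ω f) (hs : Ω' ⊆ Ω) : RayBounded Ω' f := fun p hp => h p (hs hp)

theorem RayBounded.sub {Ω : Set (LogCover × (Fin n → ℂ))} {f g : LogCover × (Fin n → ℂ) → ℂ}
    (hf : RayBounded Ω f) (hg : RayBounded Ω g) : RayBounded Ω (fun p => f p - g p) := by
  intro p hp
  obtain ⟨r, hr, M, hM⟩ := hf p hp
  obtain ⟨r', hr', M', hM'⟩ := hg p hp
  refine ⟨min r r', lt_min hr hr', M + M', fun q hq σ hσ => (norm_sub_le _ _).trans ?_⟩
  exact add_le_add (hM q (Metric.ball_subset_ball (min_le_left _ _) hq) σ hσ)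
    (hM' q (Metric.ball_subset_ball (min_le_right _ _) hq) σ hσ)

theorem RayBounded.exists_bound {Ω : Set (LogCover × (Fin n → ℂ))}
    {f : LogCover × (Fin n → ℂ) → ℂ} (h : RayBounded Ω f) {p : LogCover × (Fin n → ℂ)}
    (hp : p ∈ Ω) : ∃ M, ∀ σ : ℝ, 0 ≤ σ → ‖f (p.1 - σ, p.2)‖ ≤ M := by
  obtain ⟨r, hr, M, hM⟩ := h p hp
  exact ⟨M, hM p (Metric.mem_ball_self hr)⟩

/-- The solution `∫₀^∞ exp (lam σ) f (s - σ, x) dσ` of `eulerOp w - lam * w = f`. -/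
noncomputable def rayInt (lam : ℂ) (f : LogCover × (Fin n → ℂ) → ℂ) :
    LogCover × (Fin n → ℂ) → ℂ :=
  fun p => ∫ σ in Set.Ioi (0 : ℝ), Complex.exp (lam * σ) * f (p.1 - σ, p.2)

theorem rayInt_add_period (lam : ℂ) {f : LogCover × (Fin n → ℂ) → ℂ}
    {a : LogCover × (Fin n → ℂ)} (h : ∀ p, f (p + a) = f p) (p : LogCover × (Fin n → ℂ)) :
    rayInt lam f (p + a) = rayInt lam f p := by
  unfold rayInt
  congr 1; ext σ
  rw [← h (p.1 - σ, p.2)]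
  congr 2
  ext <;> simp; ring

theorem integrableOn_norm_exp_Ioi {lam : ℂ} (hlam : lam.re < 0) :
    MeasureTheory.IntegrableOn (fun σ : ℝ => Real.exp (lam.re * σ)) (Set.Ioi 0) := by
  have := exp_neg_integrableOn_Ioi 0 (b := -lam.re) (by linarith)
  simpa using this

section

variable {lam : ℂ} {f : LogCover × (Fin n → ℂ) → ℂ} {Ω : Set (LogCover × (Fin n → ℂ))}

-- Differentiation under the integral sign: `RayBounded` bounds `f` on the rays through a whole
-- neighbourhood, and `exp (Re lam σ)` makes the bound integrable.
open MeasureTheory in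
theorem hasFDerivAt_rayInt (hlam : lam.re < 0)
    (hΩ : IsOpen Ω) (hray : ∀ p ∈ Ω, ∀ σ : ℝ, 0 ≤ σ → (p.1 - σ, p.2) ∈ Ω)
    (hf : AnalyticOnNhd ℂ f Ω) (hb : RayBounded Ω f) {p : LogCover × (Fin n → ℂ)} (hp : p ∈ Ω) :
    IntegrableOn (fun σ : ℝ => Complex.exp (lam * σ) • fderiv ℂ f (p.1 - σ, p.2)) (Set.Ioi 0) ∧
    HasFDerivAt (rayInt lam f)
      (∫ σ in Set.Ioi (0 : ℝ), Complex.exp (lam * σ) • fderiv ℂ f (p.1 - σ, p.2)) p := by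
  have hsh : ∀ (q : LogCover × (Fin n → ℂ)) (σ : ℝ), ((q.1 - σ, q.2) : LogCover × (Fin n → ℂ))
      = q + (-(σ : ℂ), 0) := fun q σ => by ext <;> simp [sub_eq_add_neg]
  have hfd : ∀ q ∈ Ω, ∀ σ : ℝ, 0 < σ →
      HasFDerivAt (fun q : LogCover × (Fin n → ℂ) => Complex.exp (lam * σ) * f (q.1 - σ, q.2))
        (Complex.exp (lam * σ) • fderiv ℂ f (q.1 - σ, q.2)) q := fun q hq σ hσ => by
    have h1 := (hf _ (hray q hq σ hσ.le)).differentiableAt.hasFDerivAt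
    simp only [hsh] at h1 ⊢
    exact ((hasFDerivAt_comp_add_right _).2 h1).const_mul _
  have hcr : ∀ q : LogCover × (Fin n → ℂ),
      Continuous fun σ : ℝ => ((q.1 - σ, q.2) : LogCover × (Fin n → ℂ)) := fun q =>
    (continuous_const.sub Complex.continuous_ofReal).prodMk continuous_const
  have key := hasFDerivAt_integral_of_locally_bounded (μ := volume.restrict (Set.Ioi (0 : ℝ)))
    (f := fun (q : LogCover × (Fin n → ℂ)) (σ : ℝ) =>
      Complex.exp (lam * σ) * f (q.1 - σ, q.2)) hΩ ?_ ?_ ?_ ?_ p hp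
  · have he : (fun σ : ℝ => fderiv ℂ (fun q : LogCover × (Fin n → ℂ) =>
          Complex.exp (lam * σ) * f (q.1 - σ, q.2)) p) =ᵐ[volume.restrict (Set.Ioi (0 : ℝ))]
        fun σ : ℝ => Complex.exp (lam * σ) • fderiv ℂ f (p.1 - σ, p.2) := by
      filter_upwards [ae_restrict_mem measurableSet_Ioi] with σ hσ using (hfd p hp σ hσ).fderiv
    rw [integral_congr_ae he] at key
    exact ⟨(integrable_congr he).1 key.1, key.2⟩
  · filter_upwards [ae_restrict_mem measurableSet_Ioi] with σ hσ q hq using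
      (hfd q hq σ hσ).differentiableAt.differentiableWithinAt
  · intro q hq
    refine ContinuousOn.aestronglyMeasurable ?_ measurableSet_Ioi
    refine ContinuousOn.mul (by fun_prop) ?_
    exact hf.continuousOn.comp (hcr q).continuousOn fun σ hσ => hray q hq σ (le_of_lt hσ)
  · intro q hq
    have : AEStronglyMeasurable
        (fun σ : ℝ => Complex.exp (lam * σ) • fderiv ℂ f (q.1 - σ, q.2))
        (volume.restrict (Set.Ioi (0 : ℝ))) := by
      refine ContinuousOn.aestronglyMeasurable ?_ measurableSet_Ioi
      have hexp : ContinuousOn (fun σ : ℝ => Complex.exp (lam * σ)) (Set.Ioi 0) := by fun_prop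
      refine hexp.smul ?_
      exact hf.fderiv.continuousOn.comp (hcr q).continuousOn fun σ hσ => hray q hq σ (le_of_lt hσ)
    refine this.congr ?_
    filter_upwards [ae_restrict_mem measurableSet_Ioi] with σ hσ using (hfd q hq σ hσ).fderiv.symm
  · intro q hq
    obtain ⟨r, hr, M, hM⟩ := hb q hq
    refine ⟨r, hr, fun σ => Real.exp (lam.re * σ) * M,
      (integrableOn_norm_exp_Ioi hlam).mul_const M, ?_⟩
    filter_upwards [ae_restrict_mem measurableSet_Ioi] with σ hσ y hy
    rw [norm_mul, Complex.norm_exp]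
    have := hM y hy σ (le_of_lt hσ)
    simp only [Complex.mul_re, Complex.ofReal_re, Complex.ofReal_im, mul_zero, sub_zero]
    gcongr

theorem analyticOnNhd_rayInt (hlam : lam.re < 0)
    (hΩ : IsOpen Ω) (hray : ∀ p ∈ Ω, ∀ σ : ℝ, 0 ≤ σ → (p.1 - σ, p.2) ∈ Ω)
    (hf : AnalyticOnNhd ℂ f Ω) (hb : RayBounded Ω f) : AnalyticOnNhd ℂ (rayInt lam f) Ω :=
  analyticOnNhd_of_differentiableOn hΩ fun _ hp =>
    (hasFDerivAt_rayInt hlam hΩ hray hf hb hp).2.differentiableAt.differentiableWithinAt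

open MeasureTheory in
theorem rayBounded_rayInt (hlam : lam.re < 0) (hb : RayBounded Ω f) :
    RayBounded Ω (rayInt lam f) := by
  intro p hp
  obtain ⟨r, hr, M, hM⟩ := hb p hp
  refine ⟨r, hr, ∫ σ in Set.Ioi (0 : ℝ), Real.exp (lam.re * σ) * M, fun q hq σ hσ => ?_⟩
  refine norm_integral_le_of_norm_le ((integrableOn_norm_exp_Ioi hlam).mul_const M) ?_
  filter_upwards [ae_restrict_mem measurableSet_Ioi] with τ hτ
  rw [norm_mul, Complex.norm_exp]
  have := hM q hq (σ + τ) (add_nonneg hσ (le_of_lt hτ))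
  simp only [Complex.mul_re, Complex.ofReal_re, Complex.ofReal_im, mul_zero, sub_zero]
  push_cast at this
  rw [← sub_sub] at this
  gcongr

-- Integration by parts along the ray: the `σ`-derivative of `exp (lam σ) f (s - σ, x)` integrates
-- to `-f p`, the end at infinity contributing nothing.
open MeasureTheory in
theorem eulerOp_rayInt (hlam : lam.re < 0)
    (hΩ : IsOpen Ω) (hray : ∀ p ∈ Ω, ∀ σ : ℝ, 0 ≤ σ → (p.1 - σ, p.2) ∈ Ω)
    (hf : AnalyticOnNhd ℂ f Ω) (hb : RayBounded Ω f) {p : LogCover × (Fin n → ℂ)} (hp : p ∈ Ω) :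
    eulerOp (rayInt lam f) p = lam * rayInt lam f p + f p := by
  obtain ⟨hint, hder⟩ := hasFDerivAt_rayInt hlam hΩ hray hf hb hp
  have h1 : eulerOp (rayInt lam f) p
      = ∫ σ in Set.Ioi (0 : ℝ), Complex.exp (lam * σ) * eulerOp f (p.1 - σ, p.2) := by
    unfold eulerOp
    rw [hder.fderiv, ContinuousLinearMap.integral_apply hint]
    rfl
  obtain ⟨M, hM⟩ := hb.exists_bound hp
  have hn : ∀ σ : ℝ, ‖Complex.exp (lam * σ)‖ = Real.exp (lam.re * σ) := fun σ => by
    rw [Complex.norm_exp]; simp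
  have hcr : Continuous fun σ : ℝ => ((p.1 - σ, p.2) : LogCover × (Fin n → ℂ)) :=
    (continuous_const.sub Complex.continuous_ofReal).prodMk continuous_const
  have hi1 : IntegrableOn (fun σ : ℝ => Complex.exp (lam * σ) * f (p.1 - σ, p.2)) (Set.Ioi 0) := by
    refine ((integrableOn_norm_exp_Ioi hlam).mul_const M).mono' ?_ ?_
    · refine ContinuousOn.aestronglyMeasurable ?_ measurableSet_Ioi
      refine ContinuousOn.mul (by fun_prop) ?_
      exact hf.continuousOn.comp hcr.continuousOn fun σ hσ => hray p hp σ (le_of_lt hσ)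
    · filter_upwards [ae_restrict_mem measurableSet_Ioi] with σ hσ
      rw [norm_mul, hn]
      have := hM σ (le_of_lt hσ)
      gcongr
  have hi2 : IntegrableOn (fun σ : ℝ => Complex.exp (lam * σ) * eulerOp f (p.1 - σ, p.2))
      (Set.Ioi 0) := by
    have := hint.apply_continuousLinearMap (1, 0)
    exact this
  have hd : ∀ σ ∈ Set.Ici (0 : ℝ), HasDerivAt
      (fun σ : ℝ => Complex.exp (lam * σ) * f (p.1 - σ, p.2))
      (lam * (Complex.exp (lam * σ) * f (p.1 - σ, p.2))
        - Complex.exp (lam * σ) * eulerOp f (p.1 - σ, p.2)) σ := by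
    intro σ hσ
    have h1 : HasDerivAt (fun σ : ℝ => Complex.exp (lam * σ)) (Complex.exp (lam * σ) * lam) σ := by
      have := ((Complex.ofRealCLM.hasDerivAt (x := σ)).const_mul lam).cexp
      simpa using this
    refine (h1.mul (hasDerivAt_ray (hf _ (hray p hp σ hσ)))).congr_deriv ?_
    ring
  have hlim : Tendsto (fun σ : ℝ => Complex.exp (lam * σ) * f (p.1 - σ, p.2)) atTop (𝓝 0) := by
    have h2 : Tendsto (fun S : ℝ => Real.exp (lam.re * S) * M) atTop (𝓝 (0 * M)) :=
      Tendsto.mul_const M (Real.tendsto_exp_atBot.comp (tendsto_id.const_mul_atTop_of_neg hlam))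
    rw [zero_mul] at h2
    refine squeeze_zero_norm' ?_ h2
    filter_upwards [eventually_ge_atTop 0] with σ hσ
    rw [norm_mul, hn]
    have := hM σ hσ
    gcongr
  have h3 := integral_Ioi_of_hasDerivAt_of_tendsto' hd ((hi1.const_mul lam).sub hi2) hlim
  rw [integral_sub (hi1.const_mul lam) hi2, integral_const_mul, ← h1] at h3
  simp only [Complex.ofReal_zero, mul_zero, Complex.exp_zero, one_mul, sub_zero, zero_sub] at h3
  change lam * rayInt lam f p - _ = _ at h3
  linear_combination -h3

end

/-! ### Splitting the equation into its linear part at the origin and a remainder. -/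

/-- The operator `(t∂ₜ - lam₁)(t∂ₜ - lam₂)`. -/
noncomputable def charOp (lam₁ lam₂ : ℂ) (v : LogCover × (Fin n → ℂ) → ℂ) :
    LogCover × (Fin n → ℂ) → ℂ :=
  fun p => eulerOp (eulerOp v) p - (lam₁ + lam₂) * eulerOp v p + lam₁ * lam₂ * v p

/-- The right-hand side `F` without its principal linear part. -/
noncomputable def remainder (F : JetSpace n → ℂ) (lam₁ lam₂ : ℂ) (q : JetSpace n) : ℂ :=
  F q - (lam₁ + lam₂) * q.2.2 (JetIndex.pure n 1) + lam₁ * lam₂ * q.2.2 (JetIndex.pure n 0)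

theorem eulerOp_eulerOp_eq_iff {F : JetSpace n → ℂ} {lam₁ lam₂ : ℂ}
    {v : LogCover × (Fin n → ℂ) → ℂ} {p : LogCover × (Fin n → ℂ)} :
    eulerOp^[2] v p = F (jet v p) ↔ charOp lam₁ lam₂ v p = remainder F lam₁ lam₂ (jet v p) := by
  have h0 : (jet v p).2.2 (JetIndex.pure n 0) = v p := by
    change jetOp (JetIndex.pure n 0) v p = _; rw [jetOp_pure_zero]
  have h1 : (jet v p).2.2 (JetIndex.pure n 1) = eulerOp v p := by
    change jetOp (JetIndex.pure n 1) v p = _; rw [jetOp_pure_one]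
  rw [charOp, remainder, h0, h1]
  change eulerOp (eulerOp v) p = _ ↔ _
  constructor <;> intro h
  · rw [h]
  · linear_combination h

/-- The quadratic formula with a complex square root `s` of the discriminant; the last two
identities are Vieta's. A double root is allowed. -/
theorem exists_charExponents {F : JetSpace n → ℂ}
    (hexp : ∀ lam : ℂ, IsCharExponent F 0 lam → lam.re < 0) :
    ∃ lam₁ lam₂ : ℂ, lam₁.re < 0 ∧ lam₂.re < 0 ∧
      lam₁ + lam₂ = partialZ F (JetIndex.pure n 1) 0 ∧
      -(lam₁ * lam₂) = partialZ F (JetIndex.pure n 0) 0 := by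
  set c₀ := partialZ F (JetIndex.pure n 0) 0 with hc₀
  set c₁ := partialZ F (JetIndex.pure n 1) 0 with hc₁
  obtain ⟨s, hs⟩ := IsAlgClosed.exists_pow_nat_eq (c₁ ^ 2 + 4 * c₀) (n := 2) (by norm_num)
  have hroot : ∀ lam : ℂ, lam ^ 2 - (c₀ + c₁ * lam) = 0 → lam.re < 0 := fun lam h => by
    refine hexp lam ?_
    rw [IsCharExponent, Fin.sum_univ_two]
    have e : ((0, (0 : Fin n → ℂ), 0) : JetSpace n) = 0 := rfl
    simpa [e] using h
  refine ⟨(c₁ + s) / 2, (c₁ - s) / 2, hroot _ ?_, hroot _ ?_, by ring, ?_⟩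
  · linear_combination hs / 4
  · linear_combination hs / 4
  · linear_combination hs / 4

/-- The comparison is with the derivative of `F` at `(0, x, 0)`, not at the origin. There the
components with `α ≠ 0` vanish exactly, so the general bound `a` on `z - z'` meets only the
Lipschitz factor `‖t‖ + m`. The error `‖x‖` in freezing the linear part at `x = 0` meets only the
bound `b` on the two pure components. -/
theorem exists_remainder_bound {Δ : Set (JetSpace n)} {F : JetSpace n → ℂ}
    (hΔ : IsOpen Δ) (hΔ0 : (0 : JetSpace n) ∈ Δ) (hA1 : AnalyticOnNhd ℂ F Δ)
    (hA2 : ∀ x : Fin n → ℂ, ((0, x, 0) : JetSpace n) ∈ Δ → F (0, x, 0) = 0)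
    (hA3 : ∀ k : JetIndex n, 0 < ∑ j, k.multi j →
      ∀ x : Fin n → ℂ, ((0, x, 0) : JetSpace n) ∈ Δ → partialZ F k (0, x, 0) = 0)
    {lam₁ lam₂ : ℂ} (h1 : lam₁ + lam₂ = partialZ F (JetIndex.pure n 1) 0)
    (h0 : -(lam₁ * lam₂) = partialZ F (JetIndex.pure n 0) 0) :
    ∃ ρ C : ℝ, 0 < ρ ∧ ρ ≤ 1 ∧ 1 ≤ C ∧
      (∀ (t : ℂ) (x : Fin n → ℂ) (z : JetIndex n → ℂ), ‖t‖ < ρ → ‖x‖ < ρ → ‖z‖ < ρ →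
        ((t, x, z) : JetSpace n) ∈ Δ) ∧
      (∀ (t : ℂ) (x : Fin n → ℂ), ‖t‖ < ρ → ‖x‖ < ρ →
        ‖remainder F lam₁ lam₂ (t, x, 0)‖ ≤ C * ‖t‖) ∧
      ∀ (t : ℂ) (x : Fin n → ℂ) (z z' : JetIndex n → ℂ) (m a b : ℝ), ‖t‖ < ρ → ‖x‖ < ρ → m < ρ →
        ‖z‖ ≤ m → ‖z'‖ ≤ m → (∀ k, ‖z k - z' k‖ ≤ a) →
        (∀ i, ‖z (JetIndex.pure n i) - z' (JetIndex.pure n i)‖ ≤ b) →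
        ‖remainder F lam₁ lam₂ (t, x, z) - remainder F lam₁ lam₂ (t, x, z')‖
          ≤ C * (‖t‖ + m) * a + C * ‖x‖ * b := by
  have hF0 := hA1 0 hΔ0
  obtain ⟨L₁, s₁, hs₁, hL₁⟩ :=
    (hF0.fderiv.contDiffAt (n := 1)).exists_lipschitzOnWith
  obtain ⟨L₂, s₂, hs₂, hL₂⟩ := (hF0.contDiffAt (n := 1)).exists_lipschitzOnWith
  obtain ⟨ρ₀, hρ₀, hball⟩ := Metric.mem_nhds_iff.1
    (inter_mem (inter_mem hs₁ hs₂) (hΔ.mem_nhds hΔ0))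
  have hmem : ∀ (t : ℂ) (x : Fin n → ℂ) (z : JetIndex n → ℂ), ‖t‖ < min ρ₀ 1 → ‖x‖ < min ρ₀ 1 →
      ‖z‖ < min ρ₀ 1 → ((t, x, z) : JetSpace n) ∈ (s₁ ∩ s₂) ∩ Δ := fun t x z ht hx hz => by
    refine hball ?_
    rw [mem_ball_zero_iff, Prod.norm_mk, Prod.norm_mk]
    have := min_le_left ρ₀ 1
    exact max_lt (ht.trans_le this) (max_lt (hx.trans_le this) (hz.trans_le this))
  have hρ : 0 < min ρ₀ 1 := lt_min hρ₀ one_pos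
  have hz0 : ‖(0 : JetIndex n → ℂ)‖ < min ρ₀ 1 := by simpa using hρ
  have ht0 : ‖(0 : ℂ)‖ < min ρ₀ 1 := by simpa using hρ
  have hx0 : ‖(0 : Fin n → ℂ)‖ < min ρ₀ 1 := by simpa using hρ
  refine ⟨min ρ₀ 1, 1 + 2 * L₁ + L₂, hρ, min_le_right _ _, ?_,
    fun t x z ht hx hz => (hmem t x z ht hx hz).2, ?_, ?_⟩
  · linarith [L₁.coe_nonneg, L₂.coe_nonneg]
  · intro t x ht hx
    have h2 := hL₂.norm_sub_le (hmem t x 0 ht hx hz0).1.2 (hmem 0 x 0 ht0 hx hz0).1.2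
    rw [hA2 x (hmem 0 x 0 ht0 hx hz0).2] at h2
    have h3 : ‖((t, x, 0) : JetSpace n) - (0, x, 0)‖ = ‖t‖ := by simp [Prod.norm_def]
    rw [h3, sub_zero] at h2
    simp only [remainder, Pi.zero_apply, mul_zero, sub_zero, add_zero]
    refine h2.trans ?_
    have : (0 : ℝ) ≤ 1 + 2 * L₁ := by linarith [L₁.coe_nonneg]
    nlinarith [norm_nonneg t]
  · intro t x z z' m a b ht hx hm hz hz' ha hb
    have hm0 : 0 ≤ m := (norm_nonneg _).trans hz
    have ha0 : 0 ≤ a := (norm_nonneg _).trans (ha (JetIndex.pure n 0))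
    have hb0 : 0 ≤ b := (norm_nonneg _).trans (hb 0)
    set A := fderiv ℂ F (0, x, 0) with hA
    have hx' := hmem 0 x 0 ht0 hx hz0
    -- A slice with `t` and `x` fixed: convex, so that the mean value inequality applies in `z`.
    let s : Set (JetSpace n) := {q | q.1 = t ∧ q.2.1 = x ∧ ‖q.2.2‖ ≤ m}
    have hsmem : ∀ q ∈ s, q ∈ (s₁ ∩ s₂) ∩ Δ := by
      rintro ⟨t', x', w⟩ ⟨h1, h2, h3⟩
      simp only at h1 h2 h3
      subst h1 h2
      exact hmem _ _ _ ht hx (h3.trans_lt hm)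
    have hconv : Convex ℝ s := by
      rintro ⟨t₁, x₁, w₁⟩ ⟨h1, h2, h3⟩ ⟨t₂, x₂, w₂⟩ ⟨h1', h2', h3'⟩ c d hc hd hcd
      simp only at h1 h2 h3 h1' h2' h3'
      subst h1 h2
      subst h1' h2'
      refine ⟨?_, ?_, ?_⟩
      · simp [← add_smul, hcd, ← add_mul, ← Complex.ofReal_add]
      · simp [← add_smul, hcd]
      · calc ‖c • w₁ + d • w₂‖ ≤ c * ‖w₁‖ + d * ‖w₂‖ := by
              refine (norm_add_le _ _).trans ?_
              rw [norm_smul, norm_smul, Real.norm_of_nonneg hc, Real.norm_of_nonneg hd]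
          _ ≤ c * m + d * m := by gcongr
          _ = m := by rw [← add_mul, hcd, one_mul]
    have h2 := Convex.norm_image_sub_le_of_norm_fderiv_le' (𝕜 := ℂ) (f := F) (s := s) (φ := A)
      (C := L₁ * (‖t‖ + m))
      (x := (t, x, z')) (y := (t, x, z)) (fun q hq => (hA1 q (hsmem q hq).2).differentiableAt)
      (fun q hq => by
        refine (hL₁.norm_sub_le (hsmem q hq).1.1 hx'.1.1).trans ?_
        obtain ⟨h1, h2, h3⟩ := hq
        refine mul_le_mul_of_nonneg_left ?_ L₁.coe_nonneg
        rw [Prod.norm_def, Prod.norm_def]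
        simp only [Prod.fst_sub, Prod.snd_sub, h1, h2, sub_zero, sub_self, norm_zero]
        have := norm_nonneg t
        exact max_le (by linarith) (max_le (by linarith) (by linarith)))
      hconv ⟨rfl, rfl, hz'⟩ ⟨rfl, rfl, hz⟩
    set ζ := z - z' with hζ
    have h3 : ((t, x, z) : JetSpace n) - (t, x, z') = (0, 0, ζ) := by simp [hζ]
    rw [h3] at h2
    have h4 : ‖((0, 0, ζ) : JetSpace n)‖ ≤ a := by
      have : ‖ζ‖ ≤ a := (pi_norm_le_iff_of_nonneg ha0).2 fun k => ha k
      simpa [Prod.norm_def] using this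
    have h5 : A (0, 0, ζ) = ζ (JetIndex.pure n 0) * partialZ F (JetIndex.pure n 0) (0, x, 0)
        + ζ (JetIndex.pure n 1) * partialZ F (JetIndex.pure n 1) (0, x, 0) := by
      have e1 : ((0, 0, ζ) : JetSpace n)
          = ∑ k, ζ k • ((0, 0, Pi.single k 1) : JetSpace n) := by
        have e2 : ζ = ∑ k, ζ k • (Pi.single k 1 : JetIndex n → ℂ) := by
          ext k
          simp [Finset.sum_apply, Pi.single_apply]
        refine Prod.ext (by simp [Prod.fst_sum]) (Prod.ext ?_ ?_)
        · simp [Prod.snd_sum, Prod.fst_sum]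
        · simp only [Prod.snd_sum, Prod.smul_snd]
          exact e2
      have hne : JetIndex.pure n 0 ≠ JetIndex.pure n 1 := fun h => by
        have := congrArg JetIndex.ord h
        simp [JetIndex.pure, JetIndex.ord] at this
      rw [e1, map_sum]
      rw [← Finset.sum_subset (Finset.subset_univ {JetIndex.pure n 0, JetIndex.pure n 1}),
        Finset.sum_pair hne]
      · simp only [map_smul, smul_eq_mul]; rfl
      · intro k _ hk
        simp only [Finset.mem_insert, Finset.mem_singleton, not_or] at hk
        rcases jetIndex_cases k with h | h | ⟨h, -⟩
        · exact absurd h hk.1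
        · exact absurd h hk.2
        · have := hA3 k h x hx'.2
          rw [map_smul]
          change ζ k • partialZ F k (0, x, 0) = 0
          rw [this, smul_zero]
    have h6 : ∀ k : JetIndex n, ‖partialZ F k (0, x, 0) - partialZ F k 0‖ ≤ L₁ * ‖x‖ := by
      intro k
      have e1 := hL₁.norm_sub_le hx'.1.1 (hmem 0 0 0 ht0 hx0 hz0).1.1
      have e2 : ‖((0, x, 0) : JetSpace n) - (0, 0, 0)‖ = ‖x‖ := by simp [Prod.norm_def]
      rw [e2] at e1
      have e3 := (fderiv ℂ F (0, x, 0) - fderiv ℂ F (0, 0, 0)).le_opNorm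
        ((0, 0, Pi.single k 1) : JetSpace n)
      have e4 : ‖((0, 0, Pi.single k 1) : JetSpace n)‖ = 1 := by
        simp only [Prod.norm_def, norm_zero, Pi.norm_single, norm_one]; norm_num
      rw [e4, mul_one] at e3
      exact e3.trans e1
    have h7 : remainder F lam₁ lam₂ (t, x, z) - remainder F lam₁ lam₂ (t, x, z')
        = (F (t, x, z) - F (t, x, z') - A (0, 0, ζ))
          + (ζ (JetIndex.pure n 0) *
              (partialZ F (JetIndex.pure n 0) (0, x, 0) - partialZ F (JetIndex.pure n 0) 0)
          + ζ (JetIndex.pure n 1) *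
              (partialZ F (JetIndex.pure n 1) (0, x, 0) - partialZ F (JetIndex.pure n 1) 0)) := by
      rw [h5, ← h0, ← h1]
      simp only [remainder, hζ, Pi.sub_apply]
      ring
    rw [h7]
    have h8 : ∀ i : Fin 2, ‖ζ (JetIndex.pure n i) *
        (partialZ F (JetIndex.pure n i) (0, x, 0) - partialZ F (JetIndex.pure n i) 0)‖
        ≤ b * (L₁ * ‖x‖) := fun i => by
      rw [norm_mul]
      exact mul_le_mul (hb i) (h6 _) (norm_nonneg _) hb0
    have h9 := norm_add_le (F (t, x, z) - F (t, x, z') - A (0, 0, ζ))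
      (ζ (JetIndex.pure n 0) *
              (partialZ F (JetIndex.pure n 0) (0, x, 0) - partialZ F (JetIndex.pure n 0) 0)
          + ζ (JetIndex.pure n 1) *
              (partialZ F (JetIndex.pure n 1) (0, x, 0) - partialZ F (JetIndex.pure n 1) 0))
    have h10 := (norm_add_le (ζ (JetIndex.pure n 0) *
        (partialZ F (JetIndex.pure n 0) (0, x, 0) - partialZ F (JetIndex.pure n 0) 0))
      (ζ (JetIndex.pure n 1) *
        (partialZ F (JetIndex.pure n 1) (0, x, 0) - partialZ F (JetIndex.pure n 1) 0))).trans
      (add_le_add (h8 0) (h8 1))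
    have h11 : L₁ * (‖t‖ + m) * ‖((0, 0, ζ) : JetSpace n)‖ ≤ L₁ * (‖t‖ + m) * a :=
      mul_le_mul_of_nonneg_left h4 (by positivity)
    have h12 : (L₁ : ℝ) * (‖t‖ + m) * a ≤ (1 + 2 * L₁ + L₂) * (‖t‖ + m) * a := by
      have := L₁.coe_nonneg
      have := L₂.coe_nonneg
      gcongr
      linarith
    have h13 : 2 * (b * (L₁ * ‖x‖)) ≤ (1 + 2 * L₁ + L₂) * ‖x‖ * b := by
      have : (2 * L₁ : ℝ) ≤ 1 + 2 * L₁ + L₂ := by linarith [L₂.coe_nonneg]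
      calc 2 * (b * (L₁ * ‖x‖)) = 2 * L₁ * ‖x‖ * b := by ring
        _ ≤ _ := by gcongr
    linarith

/-! ### Weighted estimates for the second-order characteristic operator and its inverse. -/

theorem eulerOp_sub_const_mul {u v : LogCover × (Fin n → ℂ) → ℂ} {p : LogCover × (Fin n → ℂ)}
    (hu : AnalyticAt ℂ u p) (hv : AnalyticAt ℂ v p) (c : ℂ) :
    eulerOp (fun q => u q - c * v q) p = eulerOp u p - c * eulerOp v p := by
  unfold eulerOp
  rw [fderiv_fun_sub hu.differentiableAt (hv.differentiableAt.const_mul c),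
    fderiv_const_mul hv.differentiableAt]
  rfl

/-- The factorisation of `charOp`. -/
theorem charOp_eq {lam₁ lam₂ : ℂ} {v : LogCover × (Fin n → ℂ) → ℂ}
    {Ω : Set (LogCover × (Fin n → ℂ))} (hv : AnalyticOnNhd ℂ v Ω) {p : LogCover × (Fin n → ℂ)}
    (hp : p ∈ Ω) :
    charOp lam₁ lam₂ v p = eulerOp (fun q => eulerOp v q - lam₁ * v q) p
      - lam₂ * (eulerOp v p - lam₁ * v p) := by
  have hev : AnalyticAt ℂ (eulerOp v) p := (hv.dirDeriv (1, 0)) p hp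
  rw [eulerOp_sub_const_mul hev (hv p hp), charOp]
  ring

theorem weight_ray_le {I : Set ℝ} {T R K : ℝ} (hK : 0 ≤ K) {p : LogCover × (Fin n → ℂ)}
    (hp : p ∈ cone n I T R K) {B : ℝ} (hB : 0 ≤ B) (a b : ℕ) {σ : ℝ} (hσ : 0 ≤ σ) :
    B * wt (p.1 - σ) ^ a / gap R K (p.1 - σ, p.2) ^ b ≤ B * wt p.1 ^ a / gap R K p ^ b := by
  have h1 := wt_sub_le p.1 hσ
  have h2 := gap_le_gap_sub (R := R) hK p hσ
  have h3 := hp.2.2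
  have h4 := wt_pos (p.1 - σ)
  have h5 := wt_pos p.1
  gcongr

/-- Ray estimates for the solutions of `charOp lam₁ lam₂ v = g`. -/
theorem exists_charOp_estimates {lam₁ lam₂ : ℂ} (h₁ : lam₁.re < 0) (h₂ : lam₂.re < 0) :
    ∃ C : ℝ, 1 ≤ C ∧ ∀ (I : Set ℝ) (T R K B : ℝ) (v : LogCover × (Fin n → ℂ) → ℂ),
      1 ≤ K → 0 ≤ B →
      AnalyticOnNhd ℂ v (cone n I T R K) → RayBounded (cone n I T R K) v →
      RayBounded (cone n I T R K) (eulerOp v) →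
      (∀ p ∈ cone n I T R K, ‖charOp lam₁ lam₂ v p‖ ≤ B * wt p.1 ^ 7 / gap R K p ^ 3) →
      ∀ p ∈ cone n I T R K,
        ‖v p‖ ≤ C * B * wt p.1 ^ 7 / gap R K p ^ 3 ∧
        ‖eulerOp v p‖ ≤ C * B * wt p.1 ^ 7 / gap R K p ^ 3 ∧
        ‖v p‖ ≤ C / K * B * wt p.1 ^ 6 / gap R K p ^ 2 ∧
        ‖eulerOp v p‖ ≤ C / K * B * wt p.1 ^ 6 / gap R K p ^ 2 ∧
        ‖v p‖ ≤ C / K * B * wt p.1 ^ 5 / gap R K p ^ 1 := by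
  set a₁ := -lam₁.re with ha₁
  set a₂ := -lam₂.re with ha₂
  have hp₁ : 0 < a₁ := by linarith
  have hp₂ : 0 < a₂ := by linarith
  set l := ‖lam₁‖ with hl
  have hl0 : 0 ≤ l := norm_nonneg _
  set C := 49 + 7 / a₁ + 7 + l * (7 / a₁) + 1 / a₂ / a₁ + 1 / a₂ + l * (1 / a₂ / a₁) with hC
  have q1 : 0 < 7 / a₁ := by positivity
  have q2 : 0 ≤ l * (7 / a₁) := by positivity
  have q3 : 0 < 1 / a₂ / a₁ := by positivity
  have q4 : 0 < 1 / a₂ := by positivity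
  have q5 : 0 ≤ l * (1 / a₂ / a₁) := by positivity
  refine ⟨C, by linarith, ?_⟩
  intro I T R K B v hK hB hv hb hbe hg
  have hK0 : 0 < K := by linarith
  set Ω := cone n I T R K with hΩ
  -- Two first-order problems, for `y` and then for `v`. Each can be integrated without loss of
  -- weight, with constant `1 / aᵢ`, or in the weighted way, trading `wt` for a power of `gap` and
  -- `1 / K`. The suffixes `0`, `1`, `2` below count the weighted integrations.
  let y : LogCover × (Fin n → ℂ) → ℂ := fun q => eulerOp v q - lam₁ * v q
  have hev : AnalyticOnNhd ℂ (eulerOp v) Ω := hv.dirDeriv (1, 0)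
  have hy : AnalyticOnNhd ℂ y Ω := fun p hp => (hev p hp).sub (analyticAt_const.mul (hv p hp))
  have hybd : ∀ p ∈ Ω, ∃ M, ∀ σ : ℝ, 0 ≤ σ → ‖y (p.1 - σ, p.2)‖ ≤ M := fun p hp => by
    obtain ⟨M, hM⟩ := hb.exists_bound hp
    obtain ⟨M', hM'⟩ := hbe.exists_bound hp
    refine ⟨M' + l * M, fun σ hσ => (norm_sub_le _ _).trans ?_⟩
    rw [norm_mul]
    have := hM σ hσ
    have := hM' σ hσ
    gcongr
  have hgy : ∀ p ∈ Ω, ‖eulerOp y p - lam₂ * y p‖ ≤ B * wt p.1 ^ 7 / gap R K p ^ 3 := fun p hp => by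
    have := hg p hp
    rwa [charOp_eq hv hp] at this
  have hmem := fun (p : LogCover × (Fin n → ℂ)) (hp : p ∈ Ω) (σ : ℝ) (hσ : 0 ≤ σ) =>
    cone_sub_mem hK0.le hp hσ
  have hY0 : ∀ p ∈ Ω, ‖y p‖ ≤ 1 / a₂ * B * wt p.1 ^ 7 / gap R K p ^ 3 := fun p hp => by
    obtain ⟨M, hM⟩ := hybd p hp
    refine (norm_le_of_ray_bound h₂ (fun σ hσ => hy _ (hmem p hp σ hσ)) hM
      (A := B * wt p.1 ^ 7 / gap R K p ^ 3) fun σ hσ => ?_).trans (le_of_eq ?_)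
    · exact (hgy _ (hmem p hp σ hσ)).trans (weight_ray_le hK0.le hp hB 7 3 hσ)
    · rw [← ha₂]; ring
  have hY1 : ∀ p ∈ Ω, ‖y p‖ ≤ 7 * B / K * wt p.1 ^ 6 / gap R K p ^ 2 := fun p hp => by
    obtain ⟨M, hM⟩ := hybd p hp
    exact norm_le_of_ray_weighted h₂ hK0 hB hy hp hM (a := 6) (b := 1) hgy
  have hV0 : ∀ p ∈ Ω, ‖v p‖ ≤ 1 / a₂ / a₁ * B * wt p.1 ^ 7 / gap R K p ^ 3 := fun p hp => by
    obtain ⟨M, hM⟩ := hb.exists_bound hp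
    refine (norm_le_of_ray_bound h₁ (fun σ hσ => hv _ (hmem p hp σ hσ)) hM
      (A := 1 / a₂ * B * wt p.1 ^ 7 / gap R K p ^ 3) fun σ hσ => ?_).trans (le_of_eq ?_)
    · exact (hY0 _ (hmem p hp σ hσ)).trans
        (weight_ray_le hK0.le hp (by positivity) 7 3 hσ)
    · rw [← ha₁]; ring
  have hV1 : ∀ p ∈ Ω, ‖v p‖ ≤ 7 / a₁ / K * B * wt p.1 ^ 6 / gap R K p ^ 2 := fun p hp => by
    obtain ⟨M, hM⟩ := hb.exists_bound hp
    refine (norm_le_of_ray_bound h₁ (fun σ hσ => hv _ (hmem p hp σ hσ)) hM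
      (A := 7 * B / K * wt p.1 ^ 6 / gap R K p ^ 2) fun σ hσ => ?_).trans (le_of_eq ?_)
    · exact (hY1 _ (hmem p hp σ hσ)).trans
        (weight_ray_le hK0.le hp (by positivity) 6 2 hσ)
    · rw [← ha₁]; ring
  have hV2 : ∀ p ∈ Ω, ‖v p‖ ≤ 49 / K / K * B * wt p.1 ^ 5 / gap R K p ^ 1 := fun p hp => by
    obtain ⟨M, hM⟩ := hb.exists_bound hp
    refine (norm_le_of_ray_weighted h₁ hK0 (B := 7 * B / K) (by positivity) hv hp hM
      (a := 5) (b := 0) (hY1)).trans (le_of_eq ?_)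
    ring
  intro p hp
  have hG := hp.2.2
  have hW := wt_pos p.1
  have he : ‖eulerOp v p‖ ≤ ‖y p‖ + l * ‖v p‖ := by
    calc ‖eulerOp v p‖ = ‖y p + lam₁ * v p‖ := by congr 1; simp only [y]; ring
      _ ≤ _ := (norm_add_le _ _).trans (by rw [norm_mul])
  have hmono : ∀ {c d : ℝ} (a b : ℕ), c ≤ d →
      c * B * wt p.1 ^ a / gap R K p ^ b ≤ d * B * wt p.1 ^ a / gap R K p ^ b := by
    intro c d a b h; gcongr
  refine ⟨(hV0 p hp).trans (hmono 7 3 (by linarith)), ?_, (hV1 p hp).trans (hmono 6 2 ?_), ?_,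
    (hV2 p hp).trans (hmono 5 1 ?_)⟩
  · calc ‖eulerOp v p‖ ≤ 1 / a₂ * B * wt p.1 ^ 7 / gap R K p ^ 3
          + l * (1 / a₂ / a₁ * B * wt p.1 ^ 7 / gap R K p ^ 3) :=
          he.trans (add_le_add (hY0 p hp) (mul_le_mul_of_nonneg_left (hV0 p hp) hl0))
      _ = (1 / a₂ + l * (1 / a₂ / a₁)) * B * wt p.1 ^ 7 / gap R K p ^ 3 := by ring
      _ ≤ _ := hmono 7 3 (by linarith)
  · gcongr; linarith
  · calc ‖eulerOp v p‖ ≤ 7 * B / K * wt p.1 ^ 6 / gap R K p ^ 2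
          + l * (7 / a₁ / K * B * wt p.1 ^ 6 / gap R K p ^ 2) :=
          he.trans (add_le_add (hY1 p hp) (mul_le_mul_of_nonneg_left (hV1 p hp) hl0))
      _ = ((7 + l * (7 / a₁)) / K) * B * wt p.1 ^ 6 / gap R K p ^ 2 := by ring
      _ ≤ _ := by
        refine hmono 6 2 ?_
        gcongr
        linarith
  -- Two weighted integrations give `1 / K ^ 2`; one factor suffices and the other is dropped by `1
  -- ≤ K`.
  · rw [div_div]
    refine div_le_div₀ (by linarith) (by linarith) hK0 (by nlinarith)

/-- The pure components of the jet of a solution of `charOp lam₁ lam₂ v = g` are as small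
as `g`, and the other components gain a factor `1 / K` at the price of `|t|^(2/7)`. -/
theorem exists_jet_estimates {lam₁ lam₂ : ℂ} (h₁ : lam₁.re < 0) (h₂ : lam₂.re < 0) :
    ∃ C : ℝ, 1 ≤ C ∧ ∀ (I : Set ℝ) (T R K B : ℝ) (v : LogCover × (Fin n → ℂ) → ℂ),
      IsOpen I → R ≤ 1 → 1 ≤ K → 0 ≤ B →
      AnalyticOnNhd ℂ v (cone n I T R K) → RayBounded (cone n I T R K) v →
      RayBounded (cone n I T R K) (eulerOp v) →
      (∀ p ∈ cone n I T R K, ‖charOp lam₁ lam₂ v p‖ ≤ B * wt p.1 ^ 7 / gap R K p ^ 3) →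
      ∀ p ∈ cone n I T R K,
        (∀ i, ‖jetOp (JetIndex.pure n i) v p‖ ≤ C * B * wt p.1 ^ 7 / gap R K p ^ 3) ∧
        ∀ k, ‖jetOp k v p‖ ≤ C / K * B * wt p.1 ^ 5 / gap R K p ^ 3 := by
  obtain ⟨C, hC1, hC⟩ := exists_charOp_estimates (n := n) h₁ h₂
  -- The worst case is `∂ⱼ∂ₗ`: two weighted Cauchy estimates, with factors `2 ^ 3` and `2 ^ 4`,
  -- applied to the bound with `gap ^ 1`.
  refine ⟨128 * C, by linarith, ?_⟩
  intro I T R K B v hI hR hK hB hv hb hbe hg p hp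
  have hest := hC I T R K B v hK hB hv hb hbe hg
  have hK0 : 0 < K := by linarith
  have hC0 : 0 < C := by linarith
  have hG := hp.2.2
  have hW := wt_pos p.1
  have hKW : K * wt p.1 ≤ 1 := by
    have : 0 < gap R K p := hG
    unfold gap at this
    linarith [norm_nonneg p.2]
  have hW1 : wt p.1 ≤ 1 := by nlinarith
  have hG1 : gap R K p ≤ 1 := by
    unfold gap; nlinarith [norm_nonneg p.2]
  have hev : AnalyticOnNhd ℂ (eulerOp v) (cone n I T R K) := hv.dirDeriv (1, 0)
  have hpure : ∀ i, ‖jetOp (JetIndex.pure n i) v p‖ ≤ 128 * C * B * wt p.1 ^ 7 / gap R K p ^ 3 := by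
    have hle : C * B * wt p.1 ^ 7 / gap R K p ^ 3 ≤ 128 * C * B * wt p.1 ^ 7 / gap R K p ^ 3 := by
      gcongr; linarith
    intro i
    fin_cases i
    · change ‖jetOp (JetIndex.pure n 0) v p‖ ≤ _
      rw [jetOp_pure_zero]; exact (hest p hp).1.trans hle
    · change ‖jetOp (JetIndex.pure n 1) v p‖ ≤ _
      rw [jetOp_pure_one]; exact (hest p hp).2.1.trans hle
  have hpure' : ∀ i, ‖jetOp (JetIndex.pure n i) v p‖
      ≤ 128 * C / K * B * wt p.1 ^ 5 / gap R K p ^ 3 := fun i => by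
    refine (hpure i).trans ?_
    -- On the cone `K * wt ≤ 1`, so the pure components also satisfy the weaker bound required of
    -- all components.
    have h5 : wt p.1 ^ 7 ≤ 1 / K * wt p.1 ^ 5 := by
      have h6 : wt p.1 ^ 2 ≤ 1 / K := by
        rw [le_div_iff₀ hK0]; nlinarith
      calc wt p.1 ^ 7 = wt p.1 ^ 2 * wt p.1 ^ 5 := by ring
        _ ≤ _ := by gcongr
    calc 128 * C * B * wt p.1 ^ 7 / gap R K p ^ 3
        ≤ 128 * C * B * (1 / K * wt p.1 ^ 5) / gap R K p ^ 3 := by gcongr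
      _ = _ := by ring
  have hfirst : ∀ (g : LogCover × (Fin n → ℂ) → ℂ), AnalyticOnNhd ℂ g (cone n I T R K) →
      (∀ q ∈ cone n I T R K, ‖g q‖ ≤ C / K * B * wt q.1 ^ 6 / gap R K q ^ 2) → ∀ j,
      ‖partialX j g p‖ ≤ 128 * C / K * B * wt p.1 ^ 5 / gap R K p ^ 3 := by
    intro g hga hgb j
    have := norm_partialX_le_of_weighted hga (M := fun s => C / K * B * wt s ^ 6) hgb j hp
    refine this.trans ?_
    have h6 : wt p.1 ^ 6 ≤ wt p.1 ^ 5 := pow_le_pow_of_le_one hW.le hW1 (by norm_num)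
    calc 2 ^ (2 + 2) * (C / K * B * wt p.1 ^ 6) / gap R K p ^ (2 + 1)
        ≤ 128 * (C / K * B * wt p.1 ^ 5) / gap R K p ^ 3 := by
          gcongr
          norm_num
      _ = _ := by ring
  refine ⟨hpure, fun k => ?_⟩
  rcases jetIndex_cases k with rfl | rfl | ⟨-, ⟨j, h⟩ | ⟨j, h⟩ | ⟨j, l, h⟩⟩
  · exact hpure' 0
  · exact hpure' 1
  · rw [h]
    exact hfirst v hv (fun q hq => (hest q hq).2.2.1) j
  · rw [h, eulerOp_partialX_comm hv j hp]
    exact hfirst _ hev (fun q hq => (hest q hq).2.2.2.1) j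
  · rw [h]
    have e1 : ∀ q ∈ cone n I T R K, ‖partialX l v q‖
        ≤ 2 ^ (1 + 2) * (C / K * B * wt q.1 ^ 5) / gap R K q ^ (1 + 1) := fun q hq =>
      norm_partialX_le_of_weighted hv (M := fun s => C / K * B * wt s ^ 5)
        (fun q hq => (hest q hq).2.2.2.2) l hq
    have e2 := norm_partialX_le_of_weighted (hv.dirDeriv (0, Pi.single l 1))
      (M := fun s => 2 ^ (1 + 2) * (C / K * B * wt s ^ 5)) e1 j hp
    refine e2.trans (le_of_eq ?_)
    ring

theorem cone_mono {I I' : Set ℝ} {T T' R K K' : ℝ} (hI : I' ⊆ I) (hT : T' ≤ T) (hK : K ≤ K') :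
    cone n I' T' R K' ⊆ cone n I T R K := by
  rintro p ⟨h1, h2, h3⟩
  refine ⟨hI h1, h2.trans_le hT, h3.trans_le ?_⟩
  have := mul_le_mul_of_nonneg_right hK (wt_pos p.1).le
  unfold gap; linarith

theorem gap_anti {R K K' : ℝ} (hK : K ≤ K') (p : LogCover × (Fin n → ℂ)) :
    gap R K' p ≤ gap R K p := by
  have := mul_le_mul_of_nonneg_right hK (wt_pos p.1).le
  unfold gap; linarith

theorem gap_le_one {R K : ℝ} (hR : R ≤ 1) (hK : 0 ≤ K) (p : LogCover × (Fin n → ℂ)) :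
    gap R K p ≤ 1 := by
  have := mul_nonneg hK (wt_pos p.1).le
  unfold gap; linarith [norm_nonneg p.2]

theorem mul_wt_lt_of_mem_cone {I : Set ℝ} {T R K : ℝ} {p : LogCover × (Fin n → ℂ)}
    (hp : p ∈ cone n I T R K) : K * wt p.1 < R := by
  have : 0 < gap R K p := hp.2.2
  unfold gap at this; linarith [norm_nonneg p.2]

theorem norm_snd_lt_of_mem_cone {I : Set ℝ} {T R K : ℝ} (hK : 0 ≤ K) {p : LogCover × (Fin n → ℂ)}
    (hp : p ∈ cone n I T R K) : ‖p.2‖ < R := by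
  have : 0 < gap R K p := hp.2.2
  unfold gap at this; nlinarith [wt_pos p.1]

theorem RayBounded.congr {Ω : Set (LogCover × (Fin n → ℂ))} {f g : LogCover × (Fin n → ℂ) → ℂ}
    (hΩ : IsOpen Ω) (hray : ∀ p ∈ Ω, ∀ σ : ℝ, 0 ≤ σ → (p.1 - σ, p.2) ∈ Ω)
    (hf : RayBounded Ω f) (h : Set.EqOn g f Ω) : RayBounded Ω g := by
  intro p hp
  obtain ⟨r, hr, M, hM⟩ := hf p hp
  obtain ⟨r', hr', hb⟩ := Metric.isOpen_iff.1 hΩ p hp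
  refine ⟨min r r', lt_min hr hr', M, fun q hq σ hσ => ?_⟩
  rw [h (hray q (hb (Metric.ball_subset_ball (min_le_right _ _) hq)) σ hσ)]
  exact hM q (Metric.ball_subset_ball (min_le_left _ _) hq) σ hσ

/-- On a cone the weights are locally bounded. -/
theorem exists_weight_bound {I : Set ℝ} (hI : IsOpen I) {T R K : ℝ} {p : LogCover × (Fin n → ℂ)}
    (hp : p ∈ cone n I T R K) (a b : ℕ) :
    ∃ r > 0, ∃ M : ℝ, 0 ≤ M ∧ Metric.ball p r ⊆ cone n I T R K ∧
      ∀ q ∈ Metric.ball p r, wt q.1 ^ a / gap R K q ^ b ≤ M := by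
  have h1 : ContinuousAt (fun q : LogCover × (Fin n → ℂ) => wt q.1 ^ a / gap R K q ^ b) p := by
    refine ContinuousAt.div ?_ ?_ (pow_ne_zero _ hp.2.2.ne')
    · exact ((continuous_wt.comp continuous_fst).pow a).continuousAt
    · exact ((continuous_gap R K).pow b).continuousAt
  have h2 := h1.eventually (eventually_le_nhds (lt_add_one (wt p.1 ^ a / gap R K p ^ b)))
  obtain ⟨r, hr, hb⟩ := Metric.mem_nhds_iff.1
    (inter_mem h2 ((isOpen_cone (n := n) hI T R K).mem_nhds hp))
  have hpos : 0 ≤ wt p.1 ^ a / gap R K p ^ b :=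
    div_nonneg (pow_nonneg (wt_pos _).le _) (pow_nonneg hp.2.2.le _)
  exact ⟨r, hr, _, by linarith, fun q hq => (hb hq).2, fun q hq => (hb hq).1⟩

/-- Towards `t = 0` along a ray `wt` decreases and `gap` increases, so a local bound on the weight
serves for the whole ray. -/
theorem rayBounded_of_weighted {I : Set ℝ} (hI : IsOpen I) {T R K B : ℝ} (hK : 0 ≤ K) (hB : 0 ≤ B)
    {f : LogCover × (Fin n → ℂ) → ℂ} {a b : ℕ}
    (hf : ∀ p ∈ cone n I T R K, ‖f p‖ ≤ B * wt p.1 ^ a / gap R K p ^ b) :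
    RayBounded (cone n I T R K) f := by
  intro p hp
  obtain ⟨r, hr, M, hM0, hsub, hM⟩ := exists_weight_bound hI hp a b
  refine ⟨r, hr, B * M, fun q hq σ hσ => ?_⟩
  refine (hf _ (cone_sub_mem hK (hsub hq) hσ)).trans
    ((weight_ray_le hK (hsub hq) hB a b hσ).trans ?_)
  rw [mul_div_assoc]
  exact mul_le_mul_of_nonneg_left (hM q hq) hB

/-- The right inverse of `charOp lam₁ lam₂` given by integration along rays. -/
noncomputable def charInv (lam₁ lam₂ : ℂ) (f : LogCover × (Fin n → ℂ) → ℂ) :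
    LogCover × (Fin n → ℂ) → ℂ :=
  rayInt lam₁ (rayInt lam₂ f)

theorem charInv_spec {lam₁ lam₂ : ℂ} (h₁ : lam₁.re < 0) (h₂ : lam₂.re < 0)
    {f : LogCover × (Fin n → ℂ) → ℂ} {Ω : Set (LogCover × (Fin n → ℂ))} (hΩ : IsOpen Ω)
    (hray : ∀ p ∈ Ω, ∀ σ : ℝ, 0 ≤ σ → (p.1 - σ, p.2) ∈ Ω)
    (hf : AnalyticOnNhd ℂ f Ω) (hb : RayBounded Ω f) :
    AnalyticOnNhd ℂ (charInv lam₁ lam₂ f) Ω ∧ RayBounded Ω (charInv lam₁ lam₂ f) ∧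
      RayBounded Ω (eulerOp (charInv lam₁ lam₂ f)) ∧
      ∀ p ∈ Ω, charOp lam₁ lam₂ (charInv lam₁ lam₂ f) p = f p := by
  have hy := analyticOnNhd_rayInt h₂ hΩ hray hf hb
  have hyb := rayBounded_rayInt h₂ hb
  have hw : AnalyticOnNhd ℂ (charInv lam₁ lam₂ f) Ω := analyticOnNhd_rayInt h₁ hΩ hray hy hyb
  have hwb : RayBounded Ω (charInv lam₁ lam₂ f) := rayBounded_rayInt h₁ hyb
  have hew : Set.EqOn (eulerOp (charInv lam₁ lam₂ f))
      (fun p => lam₁ * charInv lam₁ lam₂ f p + rayInt lam₂ f p) Ω := fun p hp =>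
    eulerOp_rayInt h₁ hΩ hray hy hyb hp
  refine ⟨hw, hwb, RayBounded.congr hΩ hray ?_ hew, fun p hp => ?_⟩
  · intro p hp
    obtain ⟨r, hr, M, hM⟩ := hwb p hp
    obtain ⟨r', hr', M', hM'⟩ := hyb p hp
    refine ⟨min r r', lt_min hr hr', ‖lam₁‖ * M + M', fun q hq σ hσ => (norm_add_le _ _).trans ?_⟩
    rw [norm_mul]
    have := hM q (Metric.ball_subset_ball (min_le_left _ _) hq) σ hσ
    have := hM' q (Metric.ball_subset_ball (min_le_right _ _) hq) σ hσ
    gcongr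
  · have hevw : Set.EqOn (fun q => eulerOp (charInv lam₁ lam₂ f) q - lam₁ * charInv lam₁ lam₂ f q)
        (rayInt lam₂ f) Ω := fun q hq => by simp only [hew hq]; ring
    have h5 := dirDeriv_congr hΩ hevw (1, 0) hp
    rw [charOp_eq hw hp]
    have h6 := hevw hp
    simp only at h6
    have h7 := eulerOp_rayInt h₂ hΩ hray hf hb hp
    change dirDeriv (1, 0) _ p = _ at h7
    change dirDeriv (1, 0) (fun q => eulerOp (charInv lam₁ lam₂ f) q
      - lam₁ * charInv lam₁ lam₂ f q) p
      - lam₂ * (eulerOp (charInv lam₁ lam₂ f) p - lam₁ * charInv lam₁ lam₂ f p) = f p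
    rw [h5, h6, h7]; ring

theorem charInv_add_period (lam₁ lam₂ : ℂ) {f : LogCover × (Fin n → ℂ) → ℂ}
    {a : LogCover × (Fin n → ℂ)} (h : ∀ p, f (p + a) = f p) (p : LogCover × (Fin n → ℂ)) :
    charInv lam₁ lam₂ f (p + a) = charInv lam₁ lam₂ f p :=
  rayInt_add_period _ (rayInt_add_period _ h) p

theorem eulerOp_sub {w w' : LogCover × (Fin n → ℂ) → ℂ}
    {Ω : Set (LogCover × (Fin n → ℂ))} (hw : AnalyticOnNhd ℂ w Ω)
    (hw' : AnalyticOnNhd ℂ w' Ω) :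
    Set.EqOn (eulerOp (fun p => w p - w' p)) (fun p => eulerOp w p - eulerOp w' p) Ω :=
  dirDeriv_sub hw hw' (1, 0)

theorem charOp_sub {lam₁ lam₂ : ℂ} {w w' : LogCover × (Fin n → ℂ) → ℂ}
    {Ω : Set (LogCover × (Fin n → ℂ))} (hΩ : IsOpen Ω) (hw : AnalyticOnNhd ℂ w Ω)
    (hw' : AnalyticOnNhd ℂ w' Ω) {p : LogCover × (Fin n → ℂ)} (hp : p ∈ Ω) :
    charOp lam₁ lam₂ (fun p => w p - w' p) p = charOp lam₁ lam₂ w p - charOp lam₁ lam₂ w' p := by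
  have h1 := eulerOp_sub hw hw'
  have h2 := dirDeriv_congr hΩ h1 (1, 0) hp
  have hew : AnalyticOnNhd ℂ (eulerOp w) Ω := hw.dirDeriv (1, 0)
  have hew' : AnalyticOnNhd ℂ (eulerOp w') Ω := hw'.dirDeriv (1, 0)
  have h3 := eulerOp_sub hew hew' hp
  simp only at h3
  have h4 : eulerOp (eulerOp (fun p => w p - w' p)) p
      = eulerOp (eulerOp w) p - eulerOp (eulerOp w') p := h2.trans h3
  have h5 := h1 hp
  simp only at h5
  simp only [charOp, h4, h5]
  ring

/-! ### The contraction property of the right-hand side. -/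

/-- The estimates of `exists_remainder_bound`. -/
structure RemainderBound (Δ : Set (JetSpace n)) (F : JetSpace n → ℂ) (lam₁ lam₂ : ℂ)
    (ρ C : ℝ) : Prop where
  pos : 0 < ρ
  le_one : ρ ≤ 1
  one_le : 1 ≤ C
  mem : ∀ (t : ℂ) (x : Fin n → ℂ) (z : JetIndex n → ℂ), ‖t‖ < ρ → ‖x‖ < ρ → ‖z‖ < ρ →
    ((t, x, z) : JetSpace n) ∈ Δ
  zero_le : ∀ (t : ℂ) (x : Fin n → ℂ), ‖t‖ < ρ → ‖x‖ < ρ →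
    ‖remainder F lam₁ lam₂ (t, x, 0)‖ ≤ C * ‖t‖
  sub_le : ∀ (t : ℂ) (x : Fin n → ℂ) (z z' : JetIndex n → ℂ) (m a b : ℝ), ‖t‖ < ρ → ‖x‖ < ρ →
    m < ρ → ‖z‖ ≤ m → ‖z'‖ ≤ m → (∀ k, ‖z k - z' k‖ ≤ a) →
    (∀ i, ‖z (JetIndex.pure n i) - z' (JetIndex.pure n i)‖ ≤ b) →
    ‖remainder F lam₁ lam₂ (t, x, z) - remainder F lam₁ lam₂ (t, x, z')‖
      ≤ C * (‖t‖ + m) * a + C * ‖x‖ * b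

/-- The estimates of `exists_jet_estimates`. -/
def JetEstimate (n : ℕ) (lam₁ lam₂ : ℂ) (C : ℝ) : Prop :=
  ∀ (I : Set ℝ) (T R K B : ℝ) (v : LogCover × (Fin n → ℂ) → ℂ),
    IsOpen I → R ≤ 1 → 1 ≤ K → 0 ≤ B →
    AnalyticOnNhd ℂ v (cone n I T R K) → RayBounded (cone n I T R K) v →
    RayBounded (cone n I T R K) (eulerOp v) →
    (∀ p ∈ cone n I T R K, ‖charOp lam₁ lam₂ v p‖ ≤ B * wt p.1 ^ 7 / gap R K p ^ 3) →
    ∀ p ∈ cone n I T R K,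
      (∀ i, ‖jetOp (JetIndex.pure n i) v p‖ ≤ C * B * wt p.1 ^ 7 / gap R K p ^ 3) ∧
      ∀ k, ‖jetOp k v p‖ ≤ C / K * B * wt p.1 ^ 5 / gap R K p ^ 3

section

variable {Δ : Set (JetSpace n)} {F : JetSpace n → ℂ} {lam₁ lam₂ : ℂ} {ρ C C₁ : ℝ}

theorem norm_jet_le {w : LogCover × (Fin n → ℂ) → ℂ} {p : LogCover × (Fin n → ℂ)} {m : ℝ}
    (h : ∀ k, ‖jetOp k w p‖ ≤ m) : ‖fun k => jetOp k w p‖ ≤ m :=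
  (pi_norm_le_iff_of_nonneg ((norm_nonneg _).trans (h (JetIndex.pure n 0)))).2 h

theorem small_of_mem_cone {I : Set ℝ} {T R K C' : ℝ} (hR : R ≤ 1)
    (hC' : 1 ≤ C') (hK : 1 ≤ K) (hKρ : C' < ρ * K)
    {p : LogCover × (Fin n → ℂ)} (hp : p ∈ cone n I T R K) :
    wt p.1 ≤ 1 ∧ wt p.1 < 1 / K ∧ ‖LogCover.proj p.1‖ ≤ wt p.1 ^ 2 ∧ ‖LogCover.proj p.1‖ < ρ ∧
      C' * wt p.1 ^ 2 < ρ := by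
  have hK0 : 0 < K := by linarith
  have hW := wt_pos p.1
  have h1 := mul_wt_lt_of_mem_cone hp
  have hW1 : wt p.1 ≤ 1 := by nlinarith
  have hWK : wt p.1 < 1 / K := by rw [lt_div_iff₀ hK0]; linarith
  have ht : ‖LogCover.proj p.1‖ ≤ wt p.1 ^ 2 := by
    rw [← wt_pow_seven]; exact pow_le_pow_of_le_one hW.le hW1 (by norm_num)
  have h2 : C' * wt p.1 ^ 2 < ρ := by
    calc C' * wt p.1 ^ 2 ≤ C' * wt p.1 := by
          gcongr; exact pow_le_of_le_one hW.le hW1 (by norm_num)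
      _ < C' * (1 / K) := by gcongr
      _ ≤ ρ := by rw [mul_one_div, div_le_iff₀ hK0]; exact hKρ.le
  refine ⟨hW1, hWK, ht, ?_, h2⟩
  nlinarith [sq_nonneg (wt p.1)]

/-- The contraction estimate. -/
theorem remainder_jet_contraction (hF : RemainderBound Δ F lam₁ lam₂ ρ C) (hC₁ : 1 ≤ C₁)
    (hJ : JetEstimate n lam₁ lam₂ C₁) {I : Set ℝ} (hI : IsOpen I) {T R K B C' : ℝ}
    (hR : R ≤ 1) (hRρ : R ≤ ρ) (hRC : 32 * C * C₁ * R ≤ 1) (hC' : 1 ≤ C') (hK : 1 ≤ K)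
    (hKC : 32 * C * C₁ * (1 + C') ≤ K) (hKρ : C' < ρ * K) (hB : 0 ≤ B)
    {w w' : LogCover × (Fin n → ℂ) → ℂ} (hw : AnalyticOnNhd ℂ w (cone n I T R K))
    (hw' : AnalyticOnNhd ℂ w' (cone n I T R K))
    (hwb : RayBounded (cone n I T R K) w) (hwb' : RayBounded (cone n I T R K) w')
    (hewb : RayBounded (cone n I T R K) (eulerOp w))
    (hewb' : RayBounded (cone n I T R K) (eulerOp w'))
    (hj : ∀ p ∈ cone n I T R K, ∀ k, ‖jetOp k w p‖ ≤ C' * wt p.1 ^ 2)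
    (hj' : ∀ p ∈ cone n I T R K, ∀ k, ‖jetOp k w' p‖ ≤ C' * wt p.1 ^ 2)
    (hd : ∀ p ∈ cone n I T R K, ‖charOp lam₁ lam₂ w p - charOp lam₁ lam₂ w' p‖
      ≤ B * wt p.1 ^ 7 / gap R K p ^ 3) :
    ∀ p ∈ cone n I T R K, ‖remainder F lam₁ lam₂ (jet w p) - remainder F lam₁ lam₂ (jet w' p)‖
      ≤ B / 16 * wt p.1 ^ 7 / gap R K p ^ 3 := by
  intro p hp
  have hopen : IsOpen (cone n I T R K) := isOpen_cone hI T R K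
  have hK0 : 0 < K := by linarith
  have hray := fun (p : LogCover × (Fin n → ℂ)) (hp : p ∈ cone n I T R K) (σ : ℝ) (hσ : 0 ≤ σ) =>
    cone_sub_mem hK0.le hp hσ
  obtain ⟨hp1, hp2⟩ := hJ I T R K B (fun p => w p - w' p) hI hR hK hB
    (hw.sub hw') (hwb.sub hwb')
    (RayBounded.congr hopen hray (hewb.sub hewb') (eulerOp_sub hw hw'))
    (fun p hp => by rw [charOp_sub hopen hw hw' hp]; exact hd p hp) p hp
  have hsub : ∀ k, jetOp k (fun p => w p - w' p) p = jetOp k w p - jetOp k w' p := fun k =>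
    jetOp_sub hopen hw hw' k hp
  simp only [hsub] at hp1 hp2
  obtain ⟨hW1, hWK, ht, htρ, hm⟩ := small_of_mem_cone hR hC' hK hKρ hp
  have hx := norm_snd_lt_of_mem_cone hK0.le hp
  have h := hF.sub_le (LogCover.proj p.1) p.2 (fun k => jetOp k w p) (fun k => jetOp k w' p)
    (C' * wt p.1 ^ 2) _ _ htρ (hx.trans_le hRρ) hm (norm_jet_le (hj p hp))
    (norm_jet_le (hj' p hp)) hp2 hp1
  have hW := wt_pos p.1
  have hG := hp.2.2
  have hC := hF.one_le
  refine h.trans ?_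
  have e1 : C * (‖LogCover.proj p.1‖ + C' * wt p.1 ^ 2) * (C₁ / K * B * wt p.1 ^ 5 / gap R K p ^ 3)
      ≤ C * (wt p.1 ^ 2 + C' * wt p.1 ^ 2) * (C₁ / K * B * wt p.1 ^ 5 / gap R K p ^ 3) := by
    gcongr
  have e2 : C * (wt p.1 ^ 2 + C' * wt p.1 ^ 2) * (C₁ / K * B * wt p.1 ^ 5 / gap R K p ^ 3)
      = C * C₁ * (1 + C') / K * (B * wt p.1 ^ 7 / gap R K p ^ 3) := by ring
  have e3 : C * ‖p.2‖ * (C₁ * B * wt p.1 ^ 7 / gap R K p ^ 3)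
      ≤ C * R * (C₁ * B * wt p.1 ^ 7 / gap R K p ^ 3) := by gcongr
  have e4 : C * R * (C₁ * B * wt p.1 ^ 7 / gap R K p ^ 3)
      = C * C₁ * R * (B * wt p.1 ^ 7 / gap R K p ^ 3) := by ring
  -- The two halves of the factor `1 / 16`: large `K` handles the components with derivatives in
  -- `x`, small `R` the pure ones.
  have e5 : C * C₁ * (1 + C') / K ≤ 1 / 32 := by
    rw [div_le_iff₀ hK0]; linarith
  have e6 : C * C₁ * R ≤ 1 / 32 := by linarith
  have hX : 0 ≤ B * wt p.1 ^ 7 / gap R K p ^ 3 := by positivity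
  have e7 := mul_le_mul_of_nonneg_right e5 hX
  have e8 := mul_le_mul_of_nonneg_right e6 hX
  calc _ ≤ 1 / 32 * (B * wt p.1 ^ 7 / gap R K p ^ 3) + 1 / 32 * (B * wt p.1 ^ 7 / gap R K p ^ 3) := by
        linarith
    _ = _ := by ring

theorem analyticOnNhd_remainder_jet {w : LogCover × (Fin n → ℂ) → ℂ}
    {Ω : Set (LogCover × (Fin n → ℂ))} (hA1 : AnalyticOnNhd ℂ F Δ) (hw : AnalyticOnNhd ℂ w Ω)
    (hmem : ∀ p ∈ Ω, jet w p ∈ Δ) :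
    AnalyticOnNhd ℂ (fun p => remainder F lam₁ lam₂ (jet w p)) Ω := by
  intro p hp
  have hj : ∀ k, AnalyticAt ℂ (jetOp k w) p := fun k => hw.jetOp k p hp
  have h1 : AnalyticAt ℂ (jet w) p := by
    refine AnalyticAt.prod ?_ (AnalyticAt.prod analyticAt_snd (AnalyticAt.pi fun k => hj k))
    exact analyticAt_cexp.comp analyticAt_fst
  have h2 : AnalyticAt ℂ (fun p => F (jet w p)) p := (hA1 _ (hmem p hp)).comp h1
  exact (h2.sub (analyticAt_const.mul (hj _))).add (analyticAt_const.mul (hj _))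

end

/-! ### Successive approximations on shrinking cones. -/

section

variable {Δ : Set (JetSpace n)} {F : JetSpace n → ℂ} {lam₁ lam₂ : ℂ} {ρ C C₁ : ℝ}

/-- Successive approximations of the right-hand side of the equation along its solution. -/
noncomputable def picard (F : JetSpace n → ℂ) (lam₁ lam₂ : ℂ) :
    ℕ → LogCover × (Fin n → ℂ) → ℂ
  | 0 => 0
  | m + 1 => fun p => remainder F lam₁ lam₂ (jet (charInv lam₁ lam₂ (picard F lam₁ lam₂ m)) p)

/-- `rayInt` and `fderiv` are total and commute with translation, so periodicity holds everywhere,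
without reference to a domain. -/
theorem picard_add_period (m : ℕ) (p : LogCover × (Fin n → ℂ)) :
    picard F lam₁ lam₂ m (p + (2 * Real.pi * Complex.I, 0)) = picard F lam₁ lam₂ m p := by
  induction m generalizing p with
  | zero => rfl
  | succ m ih =>
    have h := charInv_add_period lam₁ lam₂ ih
    have hproj : LogCover.proj (p + (2 * Real.pi * Complex.I, 0)).1 = LogCover.proj p.1 := by
      simp only [LogCover.proj, Prod.fst_add, Complex.exp_add, Complex.exp_two_pi_mul_I, mul_one]
    have hsnd : (p + ((2 * Real.pi * Complex.I, 0) : LogCover × (Fin n → ℂ))).2 = p.2 := by simp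
    simp only [picard, jet_eq, jetOp_add_period h, hproj, hsnd]

theorem charInv_zero (lam₁ lam₂ : ℂ) :
    charInv lam₁ lam₂ (0 : LogCover × (Fin n → ℂ) → ℂ) = 0 := by
  funext p; simp [charInv, rayInt]

theorem jetOp_zero (k : JetIndex n) : jetOp k (0 : LogCover × (Fin n → ℂ) → ℂ) = 0 := by
  obtain ⟨L, hL⟩ := jetOp_eq_foldr k
  rw [hL]
  clear hL
  induction L with
  | nil => rfl
  | cons v L ih =>
    rw [List.foldr_cons, ih]; funext p; simp [dirDeriv]

/-- The unknown is the right-hand side `f = charOp w`. The aperture `K (2 - 2^(-m))` grows with `m`,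
so the cones shrink, but only to the cone of aperture `2 * K`. With `a = 2^(-m)`, consecutive
iterates differ by `a ^ 4` while the spare room is of order `a * wt`. Absorbing `gap ^ 3` costs `a ^
(-3)`, so the jets change by at most `(a / 2) * wt ^ 2`. These changes sum to less than `wt ^ 2`,
which keeps the jets in the domain of `F`. -/
theorem picard_step (hA1 : AnalyticOnNhd ℂ F Δ)
    (hF : RemainderBound Δ F lam₁ lam₂ ρ C) (hC₁ : 1 ≤ C₁)
    (hJ : JetEstimate n lam₁ lam₂ C₁) (h₁ : lam₁.re < 0) (h₂ : lam₂.re < 0) {R K : ℝ}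
    (hR : R ≤ 1) (hRρ : R ≤ ρ) (hRC : 32 * C * C₁ * R ≤ 1) (hK : 1 ≤ K)
    (hKC : 64 * C * C₁ ≤ K) (hKρ : 1 < ρ * K) (m : ℕ) :
    let Ω := cone n Set.univ 0 R (K * (2 - (1 / 2) ^ m))
    let f := picard F lam₁ lam₂
    AnalyticOnNhd ℂ (f m) Ω ∧ AnalyticOnNhd ℂ (f (m + 1)) Ω ∧
    (∀ p ∈ Ω, ‖f m p‖ ≤ 2 * C * (1 - (1 / 2) ^ m) * wt p.1 ^ 7 /
      gap R (K * (2 - (1 / 2) ^ m)) p ^ 3) ∧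
    (∀ p ∈ Ω, ‖f (m + 1) p - f m p‖ ≤ C * (1 / 16) ^ m * wt p.1 ^ 7 /
      gap R (K * (2 - (1 / 2) ^ m)) p ^ 3) ∧
    (∀ p ∈ Ω, ∀ k, ‖jetOp k (charInv lam₁ lam₂ (f m)) p‖ ≤ (1 - (1 / 2) ^ m) * wt p.1 ^ 2) := by
  have hC := hF.one_le
  have hK0 : 0 < K := by linarith
  induction m with
  | zero =>
    have hKK : K * (2 - (1 / 2) ^ 0) = K := by ring
    simp only [hKK]
    have hf1 : ∀ p, picard F lam₁ lam₂ 1 p = remainder F lam₁ lam₂ (LogCover.proj p.1, p.2, 0) := by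
      intro p
      simp only [picard, jet_eq, charInv_zero, jetOp_zero]
      rfl
    refine ⟨fun p _ => analyticAt_const, ?_, ?_, ?_, ?_⟩
    · refine analyticOnNhd_remainder_jet hA1 (fun p _ => ?_) (fun p hp => ?_)
      · simp only [picard, charInv_zero]; exact analyticAt_const
      · obtain ⟨-, -, -, htρ, -⟩ := small_of_mem_cone hR le_rfl hK hKρ hp
        simp only [picard, charInv_zero, jet_eq, jetOp_zero]
        refine hF.mem _ _ _ htρ ((norm_snd_lt_of_mem_cone hK0.le hp).trans_le hRρ) ?_
        change ‖(0 : JetIndex n → ℂ)‖ < ρ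
        rw [norm_zero]; exact hF.pos
    · intro p _
      simp [picard]
    · intro p hp
      obtain ⟨-, -, -, htρ, -⟩ := small_of_mem_cone hR le_rfl hK hKρ hp
      have h := hF.zero_le _ _ htρ ((norm_snd_lt_of_mem_cone hK0.le hp).trans_le hRρ)
      rw [hf1]
      simp only [picard, Pi.zero_apply, sub_zero, pow_zero, mul_one]
      refine h.trans ?_
      rw [← wt_pow_seven]
      have hG := hp.2.2
      have hW := wt_pos p.1
      refine le_div_self (by positivity) (by positivity) (pow_le_one₀ hG.le (gap_le_one hR hK0.le p))
    · intro p _ k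
      simp [picard, charInv_zero, jetOp_zero]
  | succ m ih =>
    obtain ⟨ha, ha', hb, hd, hj⟩ := ih
    set a : ℝ := (1 / 2) ^ m with hadef
    have ha0 : 0 < a := by positivity
    have ha1 : a ≤ 1 := pow_le_one₀ (by norm_num) (by norm_num)
    have has : (1 / 2 : ℝ) ^ (m + 1) = a / 2 := by rw [pow_succ]; ring
    have h16 : (1 / 16 : ℝ) ^ m = a ^ 4 := by rw [hadef, ← pow_mul, mul_comm, pow_mul]; norm_num
    have h16s : (1 / 16 : ℝ) ^ (m + 1) = a ^ 4 / 16 := by rw [pow_succ, h16]; ring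
    rw [h16] at hd
    simp only [has, h16s]
    set f := picard F lam₁ lam₂ with hf
    set K₁ := K * (2 - a) with hK₁
    set K₂ := K * (2 - a / 2) with hK₂
    have hKK₁ : K ≤ K₁ := by rw [hK₁]; nlinarith
    have hKK₂ : K₁ ≤ K₂ := by rw [hK₁, hK₂]; nlinarith
    have hK₁0 : 0 < K₁ := by linarith
    have hK₂0 : 0 < K₂ := by linarith
    have hopen₁ : IsOpen (cone n Set.univ 0 R K₁) := isOpen_cone isOpen_univ _ _ _
    have hray₁ := fun (p : LogCover × (Fin n → ℂ)) (hp : p ∈ cone n Set.univ 0 R K₁) (σ : ℝ)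
      (hσ : 0 ≤ σ) => cone_sub_mem hK₁0.le hp hσ
    have hsub : cone n Set.univ 0 R K₂ ⊆ cone n Set.univ 0 R K₁ :=
      cone_mono subset_rfl le_rfl hKK₂
    have hwt : ∀ p ∈ cone n Set.univ 0 R K₂, ∀ B : ℝ, 0 ≤ B →
        B * wt p.1 ^ 7 / gap R K₁ p ^ 3 ≤ B * wt p.1 ^ 7 / gap R K₂ p ^ 3 := by
      intro p hp B hB
      have hG := hp.2.2
      have hW := wt_pos p.1
      have := gap_anti (R := R) hKK₂ p
      gcongr
    have hb1 : ∀ p ∈ cone n Set.univ 0 R K₁, ‖f (m + 1) p‖ ≤ 2 * C * (1 - a / 2) * wt p.1 ^ 7 /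
        gap R K₁ p ^ 3 := by
      intro p hp
      have hG := hp.2.2
      have hW := wt_pos p.1
      have e1 : ‖f (m + 1) p‖ ≤ ‖f (m + 1) p - f m p‖ + ‖f m p‖ := by
        simpa using norm_add_le (f (m + 1) p - f m p) (f m p)
      refine (e1.trans (add_le_add (hd p hp) (hb p hp))).trans ?_
      rw [← add_div, ← add_mul]
      have : C * a ^ 4 + 2 * C * (1 - a) ≤ 2 * C * (1 - a / 2) := by
        have : a ^ 4 ≤ a := pow_le_of_le_one ha0.le ha1 (by norm_num)
        nlinarith
      gcongr
    have hB1 : 0 ≤ 2 * C * (1 - a / 2) := by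
      have : 0 ≤ 1 - a / 2 := by linarith
      positivity
    have hB0 : 0 ≤ 2 * C * (1 - a) := by
      have : 0 ≤ 1 - a := by linarith
      positivity
    obtain ⟨hw0, hwb0, hewb0, hP0⟩ := charInv_spec h₁ h₂ hopen₁ hray₁ ha
      (rayBounded_of_weighted isOpen_univ hK₁0.le hB0 hb)
    obtain ⟨hw1, hwb1, hewb1, hP1⟩ := charInv_spec h₁ h₂ hopen₁ hray₁ ha'
      (rayBounded_of_weighted isOpen_univ hK₁0.le hB1 hb1)
    have hjd : ∀ p ∈ cone n Set.univ 0 R K₁, ∀ k,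
        ‖jetOp k (charInv lam₁ lam₂ (f (m + 1))) p - jetOp k (charInv lam₁ lam₂ (f m)) p‖
          ≤ C₁ / K₁ * (C * a ^ 4) * wt p.1 ^ 5 / gap R K₁ p ^ 3 := by
      intro p hp k
      have := (hJ Set.univ 0 R K₁ (C * a ^ 4)
        (fun p => charInv lam₁ lam₂ (f (m + 1)) p - charInv lam₁ lam₂ (f m) p)
        isOpen_univ hR (hK.trans hKK₁) (by positivity) (hw1.sub hw0) (hwb1.sub hwb0)
        (RayBounded.congr hopen₁ hray₁ (hewb1.sub hewb0) (eulerOp_sub hw1 hw0))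
        (fun p hp => by
          rw [charOp_sub hopen₁ hw1 hw0 hp, hP1 p hp, hP0 p hp]; exact hd p hp) p hp).2 k
      rwa [jetOp_sub hopen₁ hw1 hw0 k hp] at this
    have hj1 : ∀ p ∈ cone n Set.univ 0 R K₂, ∀ k,
        ‖jetOp k (charInv lam₁ lam₂ (f (m + 1))) p‖ ≤ (1 - a / 2) * wt p.1 ^ 2 := by
      intro p hp k
      have hG := hp.2.2
      have hW := wt_pos p.1
      -- On the smaller cone the gap of the larger one is bounded below by the change of aperture
      -- times `wt`; this turns `wt ^ 5 / gap ^ 3` into `wt ^ 2`.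
      have hgap : K * (a / 2) * wt p.1 ≤ gap R K₁ p := by
        have : gap R K₁ p = gap R K₂ p + K * (a / 2) * wt p.1 := by
          simp only [gap, hK₁, hK₂]; ring
        linarith
      have e1 := hjd p (hsub hp) k
      have e2 : C₁ / K₁ * (C * a ^ 4) * wt p.1 ^ 5 / gap R K₁ p ^ 3
          ≤ C₁ / K * (C * a ^ 4) * wt p.1 ^ 5 / (K * (a / 2) * wt p.1) ^ 3 := by gcongr
      have e3 : C₁ / K * (C * a ^ 4) * wt p.1 ^ 5 / (K * (a / 2) * wt p.1) ^ 3
          = (8 * C * C₁ / K ^ 4) * a * wt p.1 ^ 2 := by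
        field_simp
        ring
      have e4 : 8 * C * C₁ / K ^ 4 ≤ 1 / 2 := by
        rw [div_le_iff₀ (by positivity)]
        have : K ≤ K ^ 4 := le_self_pow₀ hK (by norm_num)
        nlinarith [mul_pos (show (0 : ℝ) < C by linarith) (show (0 : ℝ) < C₁ by linarith)]
      have e5 : (8 * C * C₁ / K ^ 4) * a * wt p.1 ^ 2 ≤ 1 / 2 * a * wt p.1 ^ 2 := by gcongr
      have e6 := hj p (hsub hp) k
      have e7 := norm_add_le (jetOp k (charInv lam₁ lam₂ (f (m + 1))) p
        - jetOp k (charInv lam₁ lam₂ (f m)) p) (jetOp k (charInv lam₁ lam₂ (f m)) p)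
      rw [sub_add_cancel] at e7
      calc _ ≤ 1 / 2 * a * wt p.1 ^ 2 + (1 - a) * wt p.1 ^ 2 := by linarith
        _ = _ := by ring
    have hj1' : ∀ p ∈ cone n Set.univ 0 R K₂, ∀ k,
        ‖jetOp k (charInv lam₁ lam₂ (f (m + 1))) p‖ ≤ 1 * wt p.1 ^ 2 := fun p hp k =>
      (hj1 p hp k).trans (by gcongr; linarith)
    have hj0' : ∀ p ∈ cone n Set.univ 0 R K₂, ∀ k,
        ‖jetOp k (charInv lam₁ lam₂ (f m)) p‖ ≤ 1 * wt p.1 ^ 2 := fun p hp k =>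
      (hj p (hsub hp) k).trans (by gcongr; linarith)
    have hKρ₂ : 1 < ρ * K₂ := hKρ.trans_le (by have := hF.pos; gcongr; linarith)
    refine ⟨ha'.mono hsub, ?_, fun p hp => (hb1 p (hsub hp)).trans (hwt p hp _ hB1), ?_, hj1⟩
    · refine analyticOnNhd_remainder_jet hA1 (hw1.mono hsub) (fun p hp => ?_)
      obtain ⟨-, -, -, htρ, hm⟩ := small_of_mem_cone hR le_rfl (by linarith) hKρ₂ hp
      exact hF.mem _ _ _ htρ ((norm_snd_lt_of_mem_cone hK₂0.le hp).trans_le hRρ)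
        ((norm_jet_le (hj1' p hp)).trans_lt hm)
    · have := remainder_jet_contraction hF hC₁ hJ isOpen_univ (T := 0) (R := R) (K := K₂)
        (B := C * a ^ 4) (C' := 1) hR hRρ hRC le_rfl (by linarith) (by linarith) hKρ₂
        (by positivity) (hw1.mono hsub) (hw0.mono hsub) (hwb1.mono hsub) (hwb0.mono hsub)
        (hewb1.mono hsub) (hewb0.mono hsub) hj1' hj0'
        (fun p hp => by
          rw [hP1 p (hsub hp), hP0 p (hsub hp)]
          exact (hd p (hsub hp)).trans (hwt p hp _ (by positivity)))
      intro p hp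
      refine (this p hp).trans (le_of_eq ?_)
      ring

end

/-! ### Existence of a periodic solution and uniqueness of small solutions. -/

section

variable {Δ : Set (JetSpace n)} {F : JetSpace n → ℂ} {lam₁ lam₂ : ℂ} {ρ C C₁ : ℝ}

/-- Existence of a solution near the origin which is periodic in the logarithmic variable. -/
theorem exists_periodic_solution (hA1 : AnalyticOnNhd ℂ F Δ)
    (hF : RemainderBound Δ F lam₁ lam₂ ρ C) (hC₁ : 1 ≤ C₁)
    (hJ : JetEstimate n lam₁ lam₂ C₁) (h₁ : lam₁.re < 0) (h₂ : lam₂.re < 0) {R : ℝ}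
    (hR : R ≤ 1) (hRρ : R ≤ ρ) (hRC : 32 * C * C₁ * R ≤ 1) :
    ∃ (K : ℝ) (w : LogCover × (Fin n → ℂ) → ℂ), 1 ≤ K ∧
      AnalyticOnNhd ℂ w (cone n Set.univ 0 R K) ∧ RayBounded (cone n Set.univ 0 R K) w ∧
      RayBounded (cone n Set.univ 0 R K) (eulerOp w) ∧
      (∀ p ∈ cone n Set.univ 0 R K, ∀ k, ‖jetOp k w p‖ ≤ wt p.1 ^ 2) ∧
      (∀ p ∈ cone n Set.univ 0 R K,
        charOp lam₁ lam₂ w p = remainder F lam₁ lam₂ (jet w p)) ∧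
      (∀ p ∈ cone n Set.univ 0 R K,
        ‖charOp lam₁ lam₂ w p‖ ≤ 2 * C * wt p.1 ^ 7 / gap R K p ^ 3) ∧
      ∀ p, w (p + (2 * Real.pi * Complex.I, 0)) = w p := by
  have hC := hF.one_le
  have hρ := hF.pos
  -- The summands secure in turn `1 ≤ K`, the contraction with jet constant `C' = 1`, and `1 < ρ *
  -- K`. The final aperture is `2 * K`, an upper bound for all the apertures of `picard_step`.
  set K : ℝ := 1 + 64 * C * C₁ + 1 / ρ with hKdef
  have hCC : 1 ≤ C * C₁ := by nlinarith
  have hρi : 0 < 1 / ρ := by positivity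
  have hK : 1 ≤ K := by rw [hKdef]; nlinarith
  have hKC : 64 * C * C₁ ≤ K := by rw [hKdef]; linarith
  have hKρ : 1 < ρ * K := by
    rw [hKdef]
    have : ρ * (1 / ρ) = 1 := by field_simp
    nlinarith
  have step := picard_step hA1 hF hC₁ hJ h₁ h₂ hR hRρ hRC hK hKC hKρ
  have hK0 : 0 < K := by linarith
  have h2K0 : 0 < 2 * K := by linarith
  set f := picard F lam₁ lam₂ with hf
  set Ω := cone n Set.univ 0 R (2 * K) with hΩ
  have hopen : IsOpen Ω := isOpen_cone isOpen_univ _ _ _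
  have hray := fun (p : LogCover × (Fin n → ℂ)) (hp : p ∈ Ω) (σ : ℝ) (hσ : 0 ≤ σ) =>
    cone_sub_mem h2K0.le hp hσ
  have hpow : ∀ m : ℕ, (1 / 2 : ℝ) ^ m ≤ 1 := fun m => pow_le_one₀ (by norm_num) (by norm_num)
  have hKm : ∀ m : ℕ, K * (2 - (1 / 2) ^ m) ≤ 2 * K := fun m => by
    have : (0 : ℝ) < (1 / 2) ^ m := by positivity
    nlinarith
  have hsub : ∀ m : ℕ, Ω ⊆ cone n Set.univ 0 R (K * (2 - (1 / 2) ^ m)) := fun m =>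
    cone_mono subset_rfl le_rfl (hKm m)
  have hwt : ∀ m, ∀ p ∈ Ω, ∀ B : ℝ, 0 ≤ B →
      B * wt p.1 ^ 7 / gap R (K * (2 - (1 / 2) ^ m)) p ^ 3 ≤ B * (wt p.1 ^ 7 / gap R (2 * K) p ^ 3) := by
    intro m p hp B hB
    rw [← mul_div_assoc]
    have hG := hp.2.2
    have hW := wt_pos p.1
    have := gap_anti (R := R) (hKm m) p
    gcongr
  have han : ∀ m, AnalyticOnNhd ℂ (f m) Ω := fun m => (step m).1.mono (hsub m)
  have hd : ∀ m, ∀ p ∈ Ω, ‖f (m + 1) p - f m p‖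
      ≤ C * (1 / 16) ^ m * (wt p.1 ^ 7 / gap R (2 * K) p ^ 3) := fun m p hp =>
    ((step m).2.2.2.1 p (hsub m hp)).trans (hwt m p hp _ (by positivity))
  have hbm : ∀ m, ∀ p ∈ Ω, ‖f m p‖ ≤ 2 * C * wt p.1 ^ 7 / gap R (2 * K) p ^ 3 := by
    intro m p hp
    have h0 : 0 ≤ 1 - (1 / 2 : ℝ) ^ m := by linarith [hpow m]
    have h3 : (0 : ℝ) < (1 / 2) ^ m := by positivity
    have hG := hp.2.2
    have hW := wt_pos p.1
    have h4 : 2 * C * (1 - (1 / 2) ^ m) ≤ 2 * C := by nlinarith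
    exact ((step m).2.2.1 p (hsub m hp)).trans ((hwt m p hp _ (by positivity)).trans
      ((mul_le_mul_of_nonneg_right h4 (by positivity)).trans (le_of_eq (by ring))))
  let g : LogCover × (Fin n → ℂ) → ℂ := fun p => ∑' m, (f (m + 1) p - f m p)
  have hgeo : Summable fun m : ℕ => (1 / 16 : ℝ) ^ m :=
    summable_geometric_of_lt_one (by norm_num) (by norm_num)
  have hlim : ∀ p ∈ Ω, Tendsto (fun m => f m p) atTop (𝓝 (g p)) := by
    intro p hp
    have hs : Summable fun m => f (m + 1) p - f m p :=
      Summable.of_norm_bounded ((hgeo.mul_left C).mul_right _) (fun m => hd m p hp)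
    have h5 := hs.hasSum.tendsto_sum_nat
    simp only [Finset.sum_range_sub (fun m => f m p)] at h5
    have h6 : f 0 p = 0 := rfl
    simpa [h6] using h5
  have hgan : AnalyticOnNhd ℂ g Ω := by
    refine analyticOnNhd_of_differentiableOn hopen
      (differentiableOn_tsum_of_locally_summable hopen
        (fun m => ((han (m + 1)).sub (han m)).differentiableOn) fun p hp => ?_)
    obtain ⟨r, hr, M, hM0, hball, hM⟩ := exists_weight_bound isOpen_univ hp 7 3
    refine ⟨r, hr, fun m => C * (1 / 16) ^ m * M, (hgeo.mul_left C).mul_right _, fun m q hq => ?_⟩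
    refine (hd m q (hball hq)).trans ?_
    exact mul_le_mul_of_nonneg_left (hM q hq) (by positivity)
  have hgd : ∀ m, ∀ p ∈ Ω, ‖g p - f m p‖
      ≤ 2 * C * (1 / 16) ^ m * wt p.1 ^ 7 / gap R (2 * K) p ^ 3 := by
    intro m p hp
    have hG := hp.2.2
    have hW := wt_pos p.1
    have h5 := dist_le_of_le_geometric_of_tendsto (1 / 16)
      (C * (wt p.1 ^ 7 / gap R (2 * K) p ^ 3)) (by norm_num)
      (f := fun m => f m p) (a := g p) (fun m => by
        rw [dist_comm, dist_eq_norm]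
        exact (hd m p hp).trans (le_of_eq (by ring))) (hlim p hp) m
    rw [dist_comm, dist_eq_norm] at h5
    refine h5.trans ?_
    rw [div_le_iff₀ (by norm_num)]
    have : 0 ≤ C * (wt p.1 ^ 7 / gap R (2 * K) p ^ 3) * (1 / 16) ^ m := by positivity
    calc _ ≤ C * (wt p.1 ^ 7 / gap R (2 * K) p ^ 3) * (1 / 16) ^ m * (2 * (1 - 1 / 16)) := by
          linarith
      _ = _ := by ring
  have hgb : ∀ p ∈ Ω, ‖g p‖ ≤ 2 * C * wt p.1 ^ 7 / gap R (2 * K) p ^ 3 := fun p hp =>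
    le_of_tendsto (hlim p hp).norm (Eventually.of_forall fun m => hbm m p hp)
  have hrb : ∀ {h : LogCover × (Fin n → ℂ) → ℂ},
      (∀ p ∈ Ω, ‖h p‖ ≤ 2 * C * wt p.1 ^ 7 / gap R (2 * K) p ^ 3) → RayBounded Ω h := fun hh =>
    rayBounded_of_weighted isOpen_univ h2K0.le (by positivity) hh
  obtain ⟨hw, hwb, hewb, hP⟩ := charInv_spec h₁ h₂ hopen hray hgan (hrb hgb)
  -- The jet estimate for the difference turns geometric convergence of the sources into convergence
  -- of the jets, which allows passing to the limit in the recursion.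
  have hjl : ∀ p ∈ Ω, ∀ k, Tendsto (fun m => jetOp k (charInv lam₁ lam₂ (f m)) p) atTop
      (𝓝 (jetOp k (charInv lam₁ lam₂ g) p)) := by
    intro p hp k
    rw [tendsto_iff_norm_sub_tendsto_zero]
    have hle : ∀ m, ‖jetOp k (charInv lam₁ lam₂ (f m)) p - jetOp k (charInv lam₁ lam₂ g) p‖
        ≤ (C₁ / (2 * K) * (2 * C) * wt p.1 ^ 5 / gap R (2 * K) p ^ 3) * (1 / 16) ^ m := by
      intro m
      obtain ⟨hwm, hwbm, hewbm, hPm⟩ := charInv_spec h₁ h₂ hopen hray (han m) (hrb (hbm m))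
      have := (hJ Set.univ 0 R (2 * K) (2 * C * (1 / 16) ^ m)
        (fun p => charInv lam₁ lam₂ g p - charInv lam₁ lam₂ (f m) p)
        isOpen_univ hR (by linarith) (by positivity) (hw.sub hwm) (hwb.sub hwbm)
        (RayBounded.congr hopen hray (hewb.sub hewbm) (eulerOp_sub hw hwm))
        (fun p hp => by
          rw [charOp_sub hopen hw hwm hp, hP p hp, hPm p hp]; exact hgd m p hp) p hp).2 k
      rw [jetOp_sub hopen hw hwm k hp] at this
      rw [norm_sub_rev]
      exact this.trans (le_of_eq (by ring))
    refine squeeze_zero (fun m => norm_nonneg _) hle ?_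
    have := (tendsto_pow_atTop_nhds_zero_of_lt_one (r := (1 / 16 : ℝ)) (by norm_num)
      (by norm_num)).const_mul (C₁ / (2 * K) * (2 * C) * wt p.1 ^ 5 / gap R (2 * K) p ^ 3)
    simpa using this
  have hjb : ∀ p ∈ Ω, ∀ k, ‖jetOp k (charInv lam₁ lam₂ g) p‖ ≤ wt p.1 ^ 2 := by
    intro p hp k
    refine le_of_tendsto (hjl p hp k).norm (Eventually.of_forall fun m => ?_)
    refine ((step m).2.2.2.2 p (hsub m hp) k).trans ?_
    have h3 : (0 : ℝ) < (1 / 2) ^ m := by positivity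
    nlinarith [sq_nonneg (wt p.1)]
  have heq : ∀ p ∈ Ω, charOp lam₁ lam₂ (charInv lam₁ lam₂ g) p
      = remainder F lam₁ lam₂ (jet (charInv lam₁ lam₂ g) p) := by
    intro p hp
    rw [hP p hp]
    obtain ⟨-, -, -, htρ, hm⟩ := small_of_mem_cone hR (le_refl (1 : ℝ)) (by linarith)
      (show 1 < ρ * (2 * K) by nlinarith) hp
    rw [one_mul] at hm
    have hmem : jet (charInv lam₁ lam₂ g) p ∈ Δ :=
      hF.mem _ _ _ htρ ((norm_snd_lt_of_mem_cone h2K0.le hp).trans_le hRρ)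
        ((norm_jet_le (hjb p hp)).trans_lt hm)
    have hcont : ContinuousAt (remainder F lam₁ lam₂) (jet (charInv lam₁ lam₂ g) p) := by
      have h5 : ∀ k : JetIndex n, Continuous fun q : JetSpace n => q.2.2 k := fun k =>
        (continuous_apply k).comp (continuous_snd.comp continuous_snd)
      exact ((hA1 _ hmem).continuousAt.sub (continuous_const.mul (h5 _)).continuousAt).add
        (continuous_const.mul (h5 _)).continuousAt
    have hjt : Tendsto (fun m => jet (charInv lam₁ lam₂ (f m)) p) atTop
        (𝓝 (jet (charInv lam₁ lam₂ g) p)) :=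
      tendsto_const_nhds.prodMk_nhds (tendsto_const_nhds.prodMk_nhds
        (tendsto_pi_nhds.2 fun k => hjl p hp k))
    have h6 : Tendsto (fun m => f (m + 1) p) atTop
        (𝓝 (remainder F lam₁ lam₂ (jet (charInv lam₁ lam₂ g) p))) := hcont.tendsto.comp hjt
    exact tendsto_nhds_unique ((tendsto_add_atTop_iff_nat 1).2 (hlim p hp)) h6
  refine ⟨2 * K, charInv lam₁ lam₂ g, by linarith, hw, hwb, hewb, hjb, heq,
    fun p hp => by rw [hP p hp]; exact hgb p hp, charInv_add_period _ _ fun p => ?_⟩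
  simp only [g, hf, picard_add_period]

/-- Uniqueness of small solutions. -/
theorem eqOn_of_charOp_eq_remainder
    (hF : RemainderBound Δ F lam₁ lam₂ ρ C) (hC₁ : 1 ≤ C₁)
    (hJ : JetEstimate n lam₁ lam₂ C₁) {I : Set ℝ} (hI : IsOpen I) {T R K B C' : ℝ}
    (hR : R ≤ 1) (hRρ : R ≤ ρ) (hRC : 32 * C * C₁ * R ≤ 1) (hC' : 1 ≤ C') (hK : 1 ≤ K)
    (hKC : 32 * C * C₁ * (1 + C') ≤ K) (hKρ : C' < ρ * K) (hB : 0 ≤ B)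
    {w w' : LogCover × (Fin n → ℂ) → ℂ} (hw : AnalyticOnNhd ℂ w (cone n I T R K))
    (hw' : AnalyticOnNhd ℂ w' (cone n I T R K))
    (hwb : RayBounded (cone n I T R K) w) (hwb' : RayBounded (cone n I T R K) w')
    (hewb : RayBounded (cone n I T R K) (eulerOp w))
    (hewb' : RayBounded (cone n I T R K) (eulerOp w'))
    (hj : ∀ p ∈ cone n I T R K, ∀ k, ‖jetOp k w p‖ ≤ C' * wt p.1 ^ 2)
    (hj' : ∀ p ∈ cone n I T R K, ∀ k, ‖jetOp k w' p‖ ≤ C' * wt p.1 ^ 2)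
    (he : ∀ p ∈ cone n I T R K, charOp lam₁ lam₂ w p = remainder F lam₁ lam₂ (jet w p))
    (he' : ∀ p ∈ cone n I T R K, charOp lam₁ lam₂ w' p = remainder F lam₁ lam₂ (jet w' p))
    (hb : ∀ p ∈ cone n I T R K, ‖charOp lam₁ lam₂ w p‖ ≤ B * wt p.1 ^ 7 / gap R K p ^ 3)
    (hb' : ∀ p ∈ cone n I T R K, ‖charOp lam₁ lam₂ w' p‖ ≤ B * wt p.1 ^ 7 / gap R K p ^ 3) :
    Set.EqOn w w' (cone n I T R K) := by
  have hopen : IsOpen (cone n I T R K) := isOpen_cone hI T R K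
  have hK0 : 0 < K := by linarith
  have hray := fun (p : LogCover × (Fin n → ℂ)) (hp : p ∈ cone n I T R K) (σ : ℝ) (hσ : 0 ≤ σ) =>
    cone_sub_mem hK0.le hp hσ
  -- Here no cone has to shrink: the smallness of both jets is assumed, so the contraction is
  -- iterated on a fixed cone and the difference of the sources is zero. The jet estimate with
  -- source bound `0` then gives `w = w'`.
  have key : ∀ m : ℕ, ∀ p ∈ cone n I T R K, ‖charOp lam₁ lam₂ w p - charOp lam₁ lam₂ w' p‖
      ≤ 2 * B * (1 / 16) ^ m * wt p.1 ^ 7 / gap R K p ^ 3 := by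
    intro m
    induction m with
    | zero =>
      intro p hp
      refine ((norm_sub_le _ _).trans (add_le_add (hb p hp) (hb' p hp))).trans (le_of_eq ?_)
      ring
    | succ m ih =>
      intro p hp
      have := remainder_jet_contraction hF hC₁ hJ hI hR hRρ hRC hC' hK hKC hKρ (by positivity)
        hw hw' hwb hwb' hewb hewb' hj hj' ih p hp
      rw [he p hp, he' p hp]
      refine this.trans (le_of_eq ?_)
      rw [pow_succ]; ring
  have hzero : ∀ p ∈ cone n I T R K, charOp lam₁ lam₂ w p - charOp lam₁ lam₂ w' p = 0 := by
    intro p hp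
    rw [← norm_le_zero_iff]
    refine ge_of_tendsto' (f := fun m : ℕ => (2 * B * wt p.1 ^ 7 / gap R K p ^ 3) * (1 / 16) ^ m)
      (x := atTop) ?_ (fun m => (key m p hp).trans (le_of_eq (by ring)))
    have := (tendsto_pow_atTop_nhds_zero_of_lt_one (r := (1 / 16 : ℝ)) (by norm_num)
      (by norm_num)).const_mul (2 * B * wt p.1 ^ 7 / gap R K p ^ 3)
    simpa using this
  intro p hp
  have h5 := (hJ I T R K 0 (fun p => w p - w' p) hI hR hK le_rfl (hw.sub hw') (hwb.sub hwb')
    (RayBounded.congr hopen hray (hewb.sub hewb') (eulerOp_sub hw hw'))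
    (fun p hp => by rw [charOp_sub hopen hw hw' hp, hzero p hp]; simp) p hp).1 0
  rw [jetOp_pure_zero] at h5
  simp only [mul_zero, zero_mul, zero_div, norm_le_zero_iff] at h5
  exact sub_eq_zero.1 h5

end

/-! ### From the growth condition to linear decay in `t`. -/

theorem exists_small_of_growthCondition {I : Set ℝ} {u : LogCover × (Fin n → ℂ) → ℂ}
    (h : GrowthCondition I u) {ε η r₀ : ℝ} (hε : 0 < ε) (hη : 0 < η) (hr₀ : 0 < r₀) :
    ∃ R r : ℝ, 0 < R ∧ R < η ∧ 0 < r ∧ r < r₀ ∧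
      ∀ p ∈ sector I r ×ˢ polydisc n R, ‖u p‖ ≤ ε * R ^ 4 := by
  obtain ⟨L, hL, hlim⟩ := h
  have hε' : (0 : ℝ≥0∞) < ENNReal.ofReal ε := ENNReal.ofReal_pos.2 hε
  have h1 : ∀ᶠ R in 𝓝[>] (0 : ℝ), L R < ENNReal.ofReal ε :=
    eventually_lt_of_limsup_lt (by rw [hlim]; exact hε')
  have h2 : ∀ᶠ R in 𝓝[>] (0 : ℝ), R ∈ Set.Ioo 0 η := Ioo_mem_nhdsGT hη
  obtain ⟨R, ⟨hR1, hR2⟩, hR3⟩ := ((hL.and h1).and h2).exists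
  have h3 := hR1.eventually_lt_const hR2
  have h4 : ∀ᶠ r in 𝓝[>] (0 : ℝ), r ∈ Set.Ioo 0 r₀ := Ioo_mem_nhdsGT hr₀
  obtain ⟨r, hr1, hr2⟩ := (h3.and h4).exists
  refine ⟨R, r, hR3.1, hR3.2, hr2.1, hr2.2, fun p hp => ?_⟩
  have hR4 : 0 < R ^ 4 := pow_pos hR3.1 4
  rw [scaledSup, ENNReal.div_lt_iff (Or.inl (ENNReal.ofReal_pos.2 hR4).ne')
    (Or.inl ENNReal.ofReal_ne_top), ← ENNReal.ofReal_mul hε.le] at hr1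
  have h5 : ‖u p‖ₑ ≤ ENNReal.ofReal (ε * R ^ 4) :=
    (le_iSup₂ (f := fun p (_ : p ∈ sector I r ×ˢ polydisc n R) => ‖u p‖ₑ) p hp).trans hr1.le
  rwa [← ofReal_norm, ENNReal.ofReal_le_ofReal_iff (by positivity)] at h5

/-- Cauchy estimates for the jet in terms of `u` and `t∂ₜu`. -/
theorem norm_jetOp_le_of_weighted {I : Set ℝ} {T R K : ℝ} {u : LogCover × (Fin n → ℂ) → ℂ}
    (hu : AnalyticOnNhd ℂ u (cone n I T R K)) {M : LogCover → ℝ}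
    (hM : ∀ p ∈ cone n I T R K, ‖u p‖ ≤ M p.1) (hM' : ∀ p ∈ cone n I T R K, ‖eulerOp u p‖ ≤ M p.1)
    {p : LogCover × (Fin n → ℂ)} (hp : p ∈ cone n I T R K) {δ : ℝ} (hδ0 : 0 < δ) (hδ1 : δ ≤ 1)
    (hδ : δ ≤ gap R K p) (k : JetIndex n) : ‖jetOp k u p‖ ≤ 32 * M p.1 / δ ^ 2 := by
  have hM0 : 0 ≤ M p.1 := (norm_nonneg _).trans (hM p hp)
  have hδ2 : δ ^ 2 ≤ δ := pow_le_of_le_one hδ0.le hδ1 (by norm_num)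
  have hG : 0 < gap R K p := hp.2.2
  have hpure : M p.1 ≤ 32 * M p.1 / δ ^ 2 := by
    rw [le_div_iff₀ (by positivity)]
    nlinarith
  have hfirst : ∀ g : LogCover × (Fin n → ℂ) → ℂ, AnalyticOnNhd ℂ g (cone n I T R K) →
      (∀ p ∈ cone n I T R K, ‖g p‖ ≤ M p.1) → ∀ j, ‖partialX j g p‖ ≤ 32 * M p.1 / δ ^ 2 := by
    intro g hg hgM j
    have h := norm_partialX_le_of_weighted hg (M := M) (q := 0)
      (fun p hp => by simpa using hgM p hp) j hp
    refine h.trans ?_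
    have h1 : δ ^ 2 ≤ gap R K p ^ (0 + 1) := by rw [zero_add, pow_one]; linarith
    gcongr
    norm_num
  have hev : AnalyticOnNhd ℂ (eulerOp u) (cone n I T R K) := hu.dirDeriv (1, 0)
  rcases jetIndex_cases k with rfl | rfl | ⟨-, ⟨j, h⟩ | ⟨j, h⟩ | ⟨j, l, h⟩⟩
  · rw [jetOp_pure_zero]; exact (hM p hp).trans hpure
  · rw [jetOp_pure_one]; exact (hM' p hp).trans hpure
  · rw [h]; exact hfirst u hu hM j
  · rw [h, eulerOp_partialX_comm hu j hp]; exact hfirst _ hev hM' j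
  · rw [h]
    have h1 : ∀ q ∈ cone n I T R K, ‖partialX l u q‖
        ≤ 2 ^ (0 + 2) * M q.1 / gap R K q ^ (0 + 1) := fun q hq =>
      norm_partialX_le_of_weighted hu (M := M) (q := 0) (fun p hp => by simpa using hM p hp) l hq
    have h2 := norm_partialX_le_of_weighted (hu.dirDeriv (0, Pi.single l 1))
      (M := fun s => 2 ^ (0 + 2) * M s) h1 j hp
    refine h2.trans ?_
    calc 2 ^ (0 + 1 + 2) * (2 ^ (0 + 2) * M p.1) / gap R K p ^ (0 + 1 + 1)
        = 32 * M p.1 / gap R K p ^ 2 := by ring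
      _ ≤ _ := by gcongr

section

variable {Δ : Set (JetSpace n)} {F : JetSpace n → ℂ} {lam₁ lam₂ : ℂ} {ρ C : ℝ}

theorem norm_remainder_jet_le (hF : RemainderBound Δ F lam₁ lam₂ ρ C)
    {u : LogCover × (Fin n → ℂ) → ℂ} {p : LogCover × (Fin n → ℂ)} {m b : ℝ}
    (ht : ‖LogCover.proj p.1‖ < ρ) (hx : ‖p.2‖ < ρ) (hm : m < ρ) (hj : ∀ k, ‖jetOp k u p‖ ≤ m)
    (hb : ∀ i, ‖jetOp (JetIndex.pure n i) u p‖ ≤ b) :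
    ‖remainder F lam₁ lam₂ (jet u p)‖ ≤ C * ‖LogCover.proj p.1‖ +
      (C * (‖LogCover.proj p.1‖ + m) * m + C * ‖p.2‖ * b) := by
  have hm0 : 0 ≤ m := (norm_nonneg _).trans (hj (JetIndex.pure n 0))
  have h1 := hF.zero_le _ _ ht hx
  have h2 := hF.sub_le (LogCover.proj p.1) p.2 (fun k => jetOp k u p) 0 m m b ht hx hm
    (norm_jet_le hj) (by simpa using hm0) (fun k => by simpa using hj k)
    (fun i => by simpa using hb i)
  have h3 := norm_add_le (remainder F lam₁ lam₂ (LogCover.proj p.1, p.2, 0))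
    (remainder F lam₁ lam₂ (LogCover.proj p.1, p.2, fun k => jetOp k u p)
      - remainder F lam₁ lam₂ (LogCover.proj p.1, p.2, 0))
  rw [add_sub_cancel] at h3
  rw [jet_eq]
  exact h3.trans (add_le_add h1 h2)

/-- Giving up `δ` of the radius in `x`, Cauchy's estimates bound the jet by `m = 32 ω / δ ^ 2`. The
remainder is then at most a constant times `|t| + m ^ 2 + ‖x‖ ω`, and two ray integrations without
loss of weight transfer this to `u` and `eulerOp u`. The hypothesis `C₄ * ω ≤ δ ^ 2` keeps the jet
inside the domain of `F`. -/
theorem exists_decay_step (hF : RemainderBound Δ F lam₁ lam₂ ρ C)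
    (h₁ : lam₁.re < 0) (h₂ : lam₂.re < 0) :
    ∃ C₄ : ℝ, 1 ≤ C₄ ∧ ∀ (I : Set ℝ) (T R δ ω : ℝ) (u : LogCover × (Fin n → ℂ) → ℂ),
      Real.exp T ≤ ρ → R ≤ ρ → 0 < δ → δ ≤ 1 → C₄ * ω ≤ δ ^ 2 →
      AnalyticOnNhd ℂ u (cone n I T R 0) →
      (∀ p ∈ cone n I T R 0, charOp lam₁ lam₂ u p = remainder F lam₁ lam₂ (jet u p)) →
      (∀ p ∈ cone n I T R 0, ‖u p‖ ≤ ω) → (∀ p ∈ cone n I T R 0, ‖eulerOp u p‖ ≤ ω) →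
      ∀ p ∈ cone n I T (R - δ) 0,
        ‖u p‖ ≤ C₄ * (Real.exp T + ω ^ 2 / δ ^ 4 + R * ω) ∧
        ‖eulerOp u p‖ ≤ C₄ * (Real.exp T + ω ^ 2 / δ ^ 4 + R * ω) := by
  have hC := hF.one_le
  have hρ := hF.pos
  set a₁ := -lam₁.re with ha₁
  set a₂ := -lam₂.re with ha₂
  have hp₁ : 0 < a₁ := by linarith
  have hp₂ : 0 < a₂ := by linarith
  set l := ‖lam₁‖ with hl
  have hl0 : 0 ≤ l := norm_nonneg _
  have q3 : 0 < 1 / a₂ / a₁ := by positivity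
  have q4 : 0 < 1 / a₂ := by positivity
  have q5 : 0 ≤ l * (1 / a₂ / a₁) := by positivity
  have q6 : 0 < 64 / ρ := by positivity
  set D := 1 / a₂ + 1 / a₂ / a₁ + l * (1 / a₂ / a₁) with hD
  have hD0 : 0 < D := by linarith
  have hDC : 0 < 2048 * C * D := by positivity
  refine ⟨1 + 64 / ρ + 2048 * C * D, by linarith, ?_⟩
  intro I T R δ ω u hT hR hδ0 hδ1 hω hu he hb hb' p hp
  have hω0 : 0 ≤ ω := (norm_nonneg _).trans (hb p (by
    refine ⟨hp.1, hp.2.1, hp.2.2.trans ?_⟩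
    unfold gap; linarith))
  have hR0 : 0 ≤ R := by
    have : 0 < gap (R - δ) 0 p := hp.2.2
    unfold gap at this
    linarith [norm_nonneg p.2]
  set m := 32 * ω / δ ^ 2 with hm
  have hm0 : 0 ≤ m := by positivity
  have hmρ : m ≤ ρ / 2 := by
    rw [hm, div_le_iff₀ (by positivity)]
    have h1 : 64 / ρ * ω ≤ δ ^ 2 := by nlinarith
    have h2 : ρ * (64 / ρ * ω) ≤ ρ * δ ^ 2 := mul_le_mul_of_nonneg_left h1 hρ.le
    have h3 : ρ * (64 / ρ * ω) = 64 * ω := by field_simp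
    linarith
  have hm1 : m ≤ 1 := by linarith [hF.le_one]
  set E := Real.exp T with hE
  have hE0 : 0 < E := Real.exp_pos T
  set A := 2048 * C * (E + ω ^ 2 / δ ^ 4 + R * ω) with hA
  have hA0 : 0 ≤ A := by positivity
  have hsub : cone n I T (R - δ) 0 ⊆ cone n I T R 0 := by
    rintro q ⟨h1, h2, h3⟩
    refine ⟨h1, h2, h3.trans ?_⟩
    unfold gap; linarith
  have hg : ∀ q ∈ cone n I T (R - δ) 0, ‖charOp lam₁ lam₂ u q‖ ≤ A := by
    intro q hq
    rw [he q (hsub hq)]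
    have hδq : δ ≤ gap R 0 q := by
      have : 0 < gap (R - δ) 0 q := hq.2.2
      unfold gap at this ⊢; linarith
    have hj : ∀ k, ‖jetOp k u q‖ ≤ m := fun k =>
      norm_jetOp_le_of_weighted hu (M := fun _ => ω) hb hb' (hsub hq) hδ0 hδ1 hδq k
    have hpure : ∀ i, ‖jetOp (JetIndex.pure n i) u q‖ ≤ ω := by
      intro i
      fin_cases i
      · change ‖jetOp (JetIndex.pure n 0) u q‖ ≤ _
        rw [jetOp_pure_zero]; exact hb q (hsub hq)
      · change ‖jetOp (JetIndex.pure n 1) u q‖ ≤ _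
        rw [jetOp_pure_one]; exact hb' q (hsub hq)
    have ht : ‖LogCover.proj q.1‖ < E := by
      rw [LogCover.proj, Complex.norm_exp]; exact Real.exp_lt_exp.2 hq.2.1
    have hx : ‖q.2‖ < R := norm_snd_lt_of_mem_cone le_rfl (hsub hq)
    refine (norm_remainder_jet_le hF (ht.trans_le hT) (hx.trans_le hR) (by linarith) hj hpure).trans
      ?_
    calc C * ‖LogCover.proj q.1‖ + (C * (‖LogCover.proj q.1‖ + m) * m + C * ‖q.2‖ * ω)
        ≤ C * E + (C * (E + m) * m + C * R * ω) := by gcongr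
      _ = C * (E + E * m + m ^ 2 + R * ω) := by ring
      _ ≤ C * (E + E * 1 + m ^ 2 + R * ω) := by gcongr
      _ = C * (2 * E + 1024 * (ω ^ 2 / δ ^ 4) + R * ω) := by rw [hm]; ring
      _ ≤ C * (2048 * (E + ω ^ 2 / δ ^ 4 + R * ω)) := by
          have : 0 ≤ ω ^ 2 / δ ^ 4 := by positivity
          have : 0 ≤ R * ω := by positivity
          gcongr
          linarith
      _ = A := by rw [hA]; ring
  have hmem := fun (q : LogCover × (Fin n → ℂ)) (hq : q ∈ cone n I T (R - δ) 0) (σ : ℝ)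
    (hσ : 0 ≤ σ) => cone_sub_mem le_rfl hq hσ
  have hu' := hu.mono hsub
  let y : LogCover × (Fin n → ℂ) → ℂ := fun q => eulerOp u q - lam₁ * u q
  have hev : AnalyticOnNhd ℂ (eulerOp u) (cone n I T (R - δ) 0) := hu'.dirDeriv (1, 0)
  have hy : AnalyticOnNhd ℂ y (cone n I T (R - δ) 0) := fun p hp =>
    (hev p hp).sub (analyticAt_const.mul (hu' p hp))
  have hY0 : ∀ q ∈ cone n I T (R - δ) 0, ‖y q‖ ≤ A / a₂ := fun q hq => by
    refine norm_le_of_ray_bound h₂ (fun σ hσ => hy _ (hmem q hq σ hσ)) (M := ω + l * ω)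
      (fun σ hσ => (norm_sub_le _ _).trans ?_) fun σ hσ => ?_
    · rw [norm_mul]
      have := hb _ (hsub (hmem q hq σ hσ))
      have := hb' _ (hsub (hmem q hq σ hσ))
      gcongr
    · have := hg _ (hmem q hq σ hσ)
      rwa [charOp_eq hu' (hmem q hq σ hσ)] at this
  have hV0 : ∀ q ∈ cone n I T (R - δ) 0, ‖u q‖ ≤ A / a₂ / a₁ := fun q hq =>
    norm_le_of_ray_bound h₁ (fun σ hσ => hu' _ (hmem q hq σ hσ)) (M := ω)
      (fun σ hσ => hb _ (hsub (hmem q hq σ hσ))) fun σ hσ => hY0 _ (hmem q hq σ hσ)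
  have hS : 0 ≤ E + ω ^ 2 / δ ^ 4 + R * ω := by positivity
  have hfin : A * D ≤ (1 + 64 / ρ + 2048 * C * D) * (E + ω ^ 2 / δ ^ 4 + R * ω) := by
    rw [hA]
    nlinarith
  constructor
  · refine (hV0 p hp).trans (le_trans ?_ hfin)
    have : A / a₂ / a₁ = A * (1 / a₂ / a₁) := by ring
    rw [this]
    exact mul_le_mul_of_nonneg_left (by linarith) hA0
  · calc ‖eulerOp u p‖ = ‖y p + lam₁ * u p‖ := by congr 1; simp only [y]; ring
      _ ≤ A / a₂ + l * (A / a₂ / a₁) := by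
          refine (norm_add_le _ _).trans (add_le_add (hY0 p hp) ?_)
          rw [norm_mul]
          exact mul_le_mul_of_nonneg_left (hV0 p hp) hl0
      _ = A * (1 / a₂ + l * (1 / a₂ / a₁)) := by ring
      _ ≤ A * D := mul_le_mul_of_nonneg_left (by linarith) hA0
      _ ≤ _ := hfin

end

section

variable {Δ : Set (JetSpace n)} {F : JetSpace n → ℂ} {lam₁ lam₂ : ℂ} {ρ C : ℝ}

/-- Arithmetic of one halving `h → h / 2`, with `δ = R * h / 4`. The `h ^ 6` part contributes `R ^ 8
h ^ 12 / δ ^ 4`, of order `R ^ 4 h ^ 8`, to the quadratic term: initial size `R ^ 4` reproduces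
itself, and `h ^ 8 ≤ h ^ 6`. The part linear in `E` is stable as long as `E` is at most a small
multiple of `(R * h) ^ 4`. -/
theorem quadratic_step_le {C₄ R E h : ℝ} (hC₄ : 1 ≤ C₄) (hR0 : 0 < R) (hRC : 128 * C₄ * R ≤ 1)
    (hE : 0 ≤ E) (hh : 0 < h) (hh1 : h ≤ 1) (hEh : E ≤ 1 / (8192 * C₄ ^ 2) * R ^ 4 * h ^ 4) :
    let ω := R ^ 4 / (2 ^ 17 * C₄) * h ^ 6 + 4 * C₄ * E
    C₄ * ω ≤ (R * h / 4) ^ 2 ∧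
    C₄ * (E + ω ^ 2 / (R * h / 4) ^ 4 + R * ω)
      ≤ R ^ 4 / (2 ^ 17 * C₄) * (h / 2) ^ 6 + 4 * C₄ * E := by
  intro ω
  have hC0 : 0 < C₄ := by linarith
  have hR1 : R ≤ 1 := by nlinarith
  set b := R ^ 4 / (2 ^ 17 * C₄) * h ^ 6 with hb
  have hb0 : 0 ≤ b := by positivity
  have e1 : C₄ * b = R ^ 4 * h ^ 6 / 2 ^ 17 := by rw [hb]; field_simp
  have e2 : C₄ * (4 * C₄ * E) ≤ R ^ 4 * h ^ 4 / 2048 := by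
    calc C₄ * (4 * C₄ * E) ≤ C₄ * (4 * C₄ * (1 / (8192 * C₄ ^ 2) * R ^ 4 * h ^ 4)) := by gcongr
      _ = _ := by field_simp; norm_num
  have hR42 : R ^ 4 ≤ R ^ 2 := pow_le_pow_of_le_one hR0.le hR1 (by norm_num)
  have hh42 : h ^ 4 ≤ h ^ 2 := pow_le_pow_of_le_one hh.le hh1 (by norm_num)
  have hh62 : h ^ 6 ≤ h ^ 2 := pow_le_pow_of_le_one hh.le hh1 (by norm_num)
  have hh86 : h ^ 8 ≤ h ^ 6 := pow_le_pow_of_le_one hh.le hh1 (by norm_num)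
  have e3 : R ^ 4 * h ^ 6 ≤ R ^ 2 * h ^ 2 := by gcongr
  have e4 : R ^ 4 * h ^ 4 ≤ R ^ 2 * h ^ 2 := by gcongr
  have hRh : 0 < R ^ 2 * h ^ 2 := by positivity
  constructor
  · calc C₄ * ω = C₄ * b + C₄ * (4 * C₄ * E) := by simp only [ω]; ring
      _ ≤ (R * h / 4) ^ 2 := by rw [e1]; nlinarith
  · have e5 : ω ^ 2 ≤ 2 * b ^ 2 + 2 * (4 * C₄ * E) ^ 2 := by
      change (b + 4 * C₄ * E) ^ 2 ≤ _
      nlinarith [sq_nonneg (b - 4 * C₄ * E)]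
    have e6 : C₄ * (2 * b ^ 2 / (R * h / 4) ^ 4) ≤ b / 256 := by
      have : C₄ * (2 * b ^ 2 / (R * h / 4) ^ 4)
          = R ^ 4 / (2 ^ 17 * C₄) * h ^ 8 / 256 := by
        rw [hb]; field_simp; norm_num
      rw [this, hb]
      gcongr
    have e7 : C₄ * (2 * (4 * C₄ * E) ^ 2 / (R * h / 4) ^ 4) ≤ C₄ * E := by
      have h7 : C₄ * (2 * (4 * C₄ * E) ^ 2 / (R * h / 4) ^ 4)
          = C₄ * E * (8192 * C₄ ^ 2 * E / (R ^ 4 * h ^ 4)) := by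
        field_simp; ring
      rw [h7]
      refine mul_le_of_le_one_right (by positivity) ?_
      rw [div_le_one (by positivity)]
      calc 8192 * C₄ ^ 2 * E ≤ 8192 * C₄ ^ 2 * (1 / (8192 * C₄ ^ 2) * R ^ 4 * h ^ 4) := by gcongr
        _ = _ := by field_simp
    have e8 : C₄ * (R * ω) ≤ ω / 128 := by
      have : 0 ≤ ω := by positivity
      nlinarith
    have e9 : C₄ * (ω ^ 2 / (R * h / 4) ^ 4) ≤ C₄ * (2 * b ^ 2 / (R * h / 4) ^ 4)
        + C₄ * (2 * (4 * C₄ * E) ^ 2 / (R * h / 4) ^ 4) := by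
      rw [← mul_add, ← add_div]
      gcongr
    have e10 : R ^ 4 / (2 ^ 17 * C₄) * (h / 2) ^ 6 = b / 64 := by rw [hb]; ring
    rw [e10]
    have e11 : ω = b + 4 * C₄ * E := rfl
    have : 0 ≤ C₄ * E := by positivity
    linarith

/-- Solutions which are small in the sense of the growth condition are `O(|t|)`. -/
theorem exists_linear_decay (hF : RemainderBound Δ F lam₁ lam₂ ρ C)
    (h₁ : lam₁.re < 0) (h₂ : lam₂.re < 0) :
    ∃ C₄ : ℝ, 1 ≤ C₄ ∧ ∀ (I : Set ℝ) (T₀ R : ℝ) (u : LogCover × (Fin n → ℂ) → ℂ),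
      Real.exp T₀ ≤ ρ → R ≤ ρ → 0 < R → 128 * C₄ * R ≤ 1 →
      AnalyticOnNhd ℂ u (cone n I T₀ R 0) →
      (∀ p ∈ cone n I T₀ R 0, charOp lam₁ lam₂ u p = remainder F lam₁ lam₂ (jet u p)) →
      (∀ p ∈ cone n I T₀ R 0, ‖u p‖ ≤ R ^ 4 / (2 ^ 17 * C₄)) →
      (∀ p ∈ cone n I T₀ R 0, ‖eulerOp u p‖ ≤ R ^ 4 / (2 ^ 17 * C₄)) →
      ∃ (T C' : ℝ), T ≤ T₀ ∧ 0 ≤ C' ∧ ∀ p ∈ cone n I T (R / 2) 0,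
        ‖u p‖ ≤ C' * wt p.1 ^ 7 ∧ ‖eulerOp u p‖ ≤ C' * wt p.1 ^ 7 := by
  obtain ⟨C₄, hC₄, step⟩ := exists_decay_step (n := n) hF h₁ h₂
  refine ⟨C₄, hC₄, ?_⟩
  intro I T₀ R u hT₀ hRρ hR0 hRC hu he hb hb'
  have hC0 : 0 < C₄ := by linarith
  have hR1 : R ≤ 1 := hRρ.trans hF.le_one
  set c : ℝ := 1 / (8192 * C₄ ^ 2) with hc
  have hc0 : 0 < c := by positivity
  set β : ℝ := R ^ 4 / (2 ^ 17 * C₄) with hβ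
  have hβ0 : 0 < β := by positivity
  -- The iteration is run for `|t| < exp T`, with radii decreasing from `R` towards `R / 2`; smaller
  -- `T` permits more steps.
  have iter : ∀ T ≤ T₀, ∀ k : ℕ, Real.exp T ≤ c * R ^ 4 * ((1 / 2) ^ k) ^ 4 →
      ∀ p ∈ cone n I T (R / 2 + R / 2 * (1 / 2) ^ k) 0,
        ‖u p‖ ≤ β * ((1 / 2) ^ k) ^ 6 + 4 * C₄ * Real.exp T ∧
        ‖eulerOp u p‖ ≤ β * ((1 / 2) ^ k) ^ 6 + 4 * C₄ * Real.exp T := by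
    intro T hT k
    have hsubR : ∀ R' ≤ R, cone n I T R' 0 ⊆ cone n I T₀ R 0 := by
      rintro R' hR' p ⟨h1, h2, h3⟩
      refine ⟨h1, h2.trans_le hT, h3.trans_le ?_⟩
      unfold gap; linarith
    induction k with
    | zero =>
      intro _ p hp
      have hpos : 0 < 4 * C₄ * Real.exp T := by positivity
      have hp' := hsubR _ (by simp) hp
      simp only [pow_zero, one_pow, mul_one]
      exact ⟨(hb p hp').trans (by linarith), (hb' p hp').trans (by linarith)⟩
    | succ k ih =>
      set h : ℝ := (1 / 2) ^ k with hh
      have hh0 : 0 < h := by positivity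
      have hh1 : h ≤ 1 := pow_le_one₀ (by norm_num) (by norm_num)
      have hs : (1 / 2 : ℝ) ^ (k + 1) = h / 2 := by rw [pow_succ]; ring
      rw [hs]
      intro hE p hp
      have hE' : Real.exp T ≤ c * R ^ 4 * h ^ 4 := by
        refine hE.trans ?_
        gcongr
        linarith
      have ih' := ih hE'
      obtain ⟨hq1, hq2⟩ := quadratic_step_le hC₄ hR0 hRC (Real.exp_pos T).le hh0 hh1 hE'
      have hRk : R / 2 + R / 2 * h ≤ R := by nlinarith
      set ω := R ^ 4 / (2 ^ 17 * C₄) * h ^ 6 + 4 * C₄ * Real.exp T with hω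
      have hδ0 : 0 < R * h / 4 := by positivity
      have hδ1 : R * h / 4 ≤ 1 := by nlinarith
      have hrad : R / 2 + R / 2 * (h / 2) = R / 2 + R / 2 * h - R * h / 4 := by ring
      rw [hrad] at hp
      have hω0 : 0 ≤ ω := by positivity
      obtain ⟨h3, h4⟩ := step I T (R / 2 + R / 2 * h) (R * h / 4) ω u
        ((Real.exp_le_exp.2 hT).trans hT₀) (hRk.trans hRρ) hδ0 hδ1 hq1
        (hu.mono (hsubR _ hRk)) (fun p hp => he p (hsubR _ hRk hp))
        (fun p hp => (ih' p hp).1) (fun p hp => (ih' p hp).2) p hp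
      have h5 : C₄ * (Real.exp T + ω ^ 2 / (R * h / 4) ^ 4 + (R / 2 + R / 2 * h) * ω)
          ≤ C₄ * (Real.exp T + ω ^ 2 / (R * h / 4) ^ 4 + R * ω) := by gcongr
      exact ⟨h3.trans (h5.trans hq2), h4.trans (h5.trans hq2)⟩
  have hcR : 0 < c * R ^ 4 := by positivity
  -- Each point `p` is treated with its own `T = re p.1 + 1`, which puts it in the open range `re <
  -- T`; hence the `- 1` and the factor `exp 1`.
  refine ⟨min T₀ (Real.log (c * R ^ 4)) - 1, (16 * β / (c * R ^ 4) + 4 * C₄) * Real.exp 1, ?_, ?_, ?_⟩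
  · linarith [min_le_left T₀ (Real.log (c * R ^ 4))]
  · positivity
  intro p hp
  obtain ⟨hp1, hp2, hp3⟩ := hp
  set T := p.1.re + 1 with hT
  have hT1 : T ≤ T₀ := by linarith [min_le_left T₀ (Real.log (c * R ^ 4))]
  have hT2 : Real.exp T ≤ c * R ^ 4 := by
    rw [← Real.exp_log hcR]
    exact Real.exp_le_exp.2 (by linarith [min_le_right T₀ (Real.log (c * R ^ 4))])
  have hTpos := Real.exp_pos T
  -- The largest number of halvings allowed at this `T`: then `(2^(-k)) ^ 4` is comparable to `exp
  -- T`, so `h ^ 6 ≤ h ^ 4` makes the remaining term `O(|t|)`.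
  obtain ⟨k, hk1, hk2⟩ := exists_nat_pow_near (x := c * R ^ 4 / Real.exp T) (y := 16)
    (by rwa [one_le_div hTpos]) (by norm_num)
  have h16 : ((1 / 2 : ℝ) ^ k) ^ 4 = 1 / 16 ^ k := by
    rw [← pow_mul, mul_comm, pow_mul, ← one_div_pow]; norm_num
  have hkE : Real.exp T ≤ c * R ^ 4 * ((1 / 2) ^ k) ^ 4 := by
    rw [h16, mul_one_div, le_div_iff₀ (by positivity)]
    rw [le_div_iff₀ hTpos] at hk1
    linarith
  have h6 : ((1 / 2 : ℝ) ^ k) ^ 6 ≤ 16 * Real.exp T / (c * R ^ 4) := by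
    have e1 : ((1 / 2 : ℝ) ^ k) ^ 6 ≤ ((1 / 2 : ℝ) ^ k) ^ 4 :=
      pow_le_pow_of_le_one (by positivity) (pow_le_one₀ (by norm_num) (by norm_num)) (by norm_num)
    refine e1.trans ?_
    rw [h16, div_le_div_iff₀ (by positivity) hcR]
    rw [div_lt_iff₀ hTpos, pow_succ (16 : ℝ) k] at hk2
    linarith
  have hpmem : p ∈ cone n I T (R / 2 + R / 2 * (1 / 2) ^ k) 0 := by
    refine ⟨hp1, by linarith, hp3.trans_le ?_⟩
    have : 0 < R / 2 * (1 / 2) ^ k := by positivity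
    unfold gap; linarith
  have hfin : β * ((1 / 2) ^ k) ^ 6 + 4 * C₄ * Real.exp T
      ≤ (16 * β / (c * R ^ 4) + 4 * C₄) * Real.exp 1 * wt p.1 ^ 7 := by
    have e1 : wt p.1 ^ 7 = Real.exp p.1.re := by
      rw [wt_pow_seven, LogCover.proj, Complex.norm_exp]
    have e2 : Real.exp T = Real.exp 1 * wt p.1 ^ 7 := by
      rw [e1, ← Real.exp_add, hT, add_comm]
    calc β * ((1 / 2) ^ k) ^ 6 + 4 * C₄ * Real.exp T
        ≤ β * (16 * Real.exp T / (c * R ^ 4)) + 4 * C₄ * Real.exp T := by gcongr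
      _ = _ := by rw [e2]; ring
  obtain ⟨h3, h4⟩ := iter T hT1 k hkE p hpmem
  exact ⟨h3.trans hfin, h4.trans hfin⟩

end

/-! ### Descent of periodic functions and removal of the singularity at `t = 0`. -/

open MeasureTheory in
/-- A function of `(t, x)` on a polydisc which is holomorphic for `t ≠ 0`, bounded, and holomorphic
in `t` for every fixed `x`, is holomorphic. -/
theorem analyticOnNhd_of_removable_hyperplane {g : ℂ × (Fin n → ℂ) → ℂ} {r R M : ℝ} (hr : 0 < r)
    (hg : DifferentiableOn ℂ g {q | q.1 ≠ 0 ∧ ‖q.1‖ < r ∧ ‖q.2‖ < R})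
    (hM : ∀ q : ℂ × (Fin n → ℂ), ‖q.1‖ < r → ‖q.2‖ < R → ‖g q‖ ≤ M)
    (hg' : ∀ x : Fin n → ℂ, ‖x‖ < R → DifferentiableOn ℂ (fun t => g (t, x)) (Metric.ball 0 r)) :
    AnalyticOnNhd ℂ g {q | ‖q.1‖ < r / 2 ∧ ‖q.2‖ < R} := by
  set U : Set (ℂ × (Fin n → ℂ)) := {q | ‖q.1‖ < r / 2 ∧ ‖q.2‖ < R} with hU
  have hUo : IsOpen U :=
    (isOpen_lt continuous_fst.norm continuous_const).inter
      (isOpen_lt continuous_snd.norm continuous_const)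
  have hr2 : 0 < r / 2 := by linarith
  set c : ℝ → ℂ := circleMap 0 (r / 2) with hc
  have hcn : ∀ θ, ‖c θ‖ = r / 2 := fun θ => by simp [hc]; linarith
  have hcc : Continuous c := continuous_circleMap _ _
  let V : Set ((ℂ × (Fin n → ℂ)) × ℂ) :=
    {q | q.1.1 ≠ q.2 ∧ q.2 ≠ 0 ∧ ‖q.2‖ < r ∧ ‖q.1.2‖ < R}
  have hV : IsOpen V := by
    have c1 : Continuous fun q : (ℂ × (Fin n → ℂ)) × ℂ => q.1.1 := by fun_prop
    have c2 : Continuous fun q : (ℂ × (Fin n → ℂ)) × ℂ => q.1.2 := by fun_prop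
    exact (isOpen_ne_fun c1 continuous_snd).inter ((isOpen_ne_fun continuous_snd
      continuous_const).inter ((isOpen_lt continuous_snd.norm continuous_const).inter
      (isOpen_lt c2.norm continuous_const)))
  -- The Cauchy kernel on the circle `|ζ| = r / 2` samples `g` only at `ζ ≠ 0`, where it is jointly
  -- holomorphic. Holomorphy in `t` alone at `t = 0` serves only to identify the integral with `g`.
  let H : (ℂ × (Fin n → ℂ)) × ℂ → ℂ := fun q => (q.2 - q.1.1)⁻¹ * g (q.2, q.1.2)
  have hH : AnalyticOnNhd ℂ H V := by
    refine analyticOnNhd_of_differentiableOn hV (DifferentiableOn.mul ?_ ?_)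
    · refine DifferentiableOn.inv (by fun_prop) fun q hq => sub_ne_zero.2 hq.1.symm
    · exact hg.comp (f := fun q : (ℂ × (Fin n → ℂ)) × ℂ => (q.2, q.1.2)) (by fun_prop)
        fun q hq => hq.2
  have hmemV : ∀ q ∈ U, ∀ θ, (q, c θ) ∈ V := fun q hq θ => by
    refine ⟨fun h => ?_, fun h => ?_, ?_, hq.2⟩
    · have h1 := hq.1
      simp only at h
      rw [h, hcn] at h1
      exact lt_irrefl _ h1
    · have h1 := hcn θ
      simp only at h
      rw [h, norm_zero] at h1
      linarith
    · change ‖c θ‖ < r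
      rw [hcn]; linarith
  have hfd : ∀ q ∈ U, ∀ θ, HasFDerivAt (fun q => deriv c θ * H (q, c θ))
      (deriv c θ • (fderiv ℂ H (q, c θ)).comp (ContinuousLinearMap.inl ℂ (ℂ × (Fin n → ℂ)) ℂ)) q := by
    intro q hq θ
    refine HasFDerivAt.const_mul ?_ _
    exact HasFDerivAt.comp (g := H) (f := fun q => (q, c θ)) q
      (hH _ (hmemV q hq θ)).differentiableAt.hasFDerivAt (hasFDerivAt_prodMk_left q (c θ))
  have hdc : Continuous (deriv c) := by
    have : deriv c = fun θ => circleMap 0 (r / 2) θ * Complex.I := by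
      funext θ; simp [hc, deriv_circleMap]
    rw [this]; fun_prop
  have hpc : ∀ q : ℂ × (Fin n → ℂ), Continuous fun θ => (q, c θ) := fun q =>
    continuous_const.prodMk hcc
  have key := hasFDerivAt_integral_of_locally_bounded
    (μ := volume.restrict (Set.Ioc (0 : ℝ) (2 * Real.pi)))
    (f := fun (q : ℂ × (Fin n → ℂ)) (θ : ℝ) => deriv c θ * H (q, c θ)) hUo
    (ae_of_all _ fun θ q hq => (hfd q hq θ).differentiableAt.differentiableWithinAt)
    (fun q hq => (hdc.mul (hH.continuousOn.comp_continuous (hpc q)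
      (hmemV q hq))).aestronglyMeasurable)
    (fun q hq => by
      simp only [fun θ => (hfd q hq θ).fderiv]
      refine (hdc.smul ?_).aestronglyMeasurable
      exact (hH.fderiv.continuousOn.comp_continuous (hpc q) (hmemV q hq)).clm_comp
        continuous_const)
    (fun q hq => by
      have hd : 0 < r / 2 - ‖q.1‖ := sub_pos.2 hq.1
      obtain ⟨e, he, hball⟩ := Metric.isOpen_iff.1 hUo q hq
      refine ⟨min e ((r / 2 - ‖q.1‖) / 2), lt_min he (by linarith),
        fun _ => r / 2 * (((r / 2 - ‖q.1‖) / 2)⁻¹ * M), integrable_const _,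
        ae_of_all _ fun θ y hy => ?_⟩
      have hyU := hball (Metric.ball_subset_ball (min_le_left _ _) hy)
      have hy2 := Metric.ball_subset_ball (min_le_right _ _) hy
      have h1 : ‖y.1 - q.1‖ < (r / 2 - ‖q.1‖) / 2 := by
        have := (norm_fst_le (y - q)).trans_lt (mem_ball_iff_norm.1 hy2)
        simpa using this
      have h2 : (r / 2 - ‖q.1‖) / 2 ≤ ‖c θ - y.1‖ := by
        have e1 : ‖c θ‖ ≤ ‖c θ - y.1‖ + ‖y.1 - q.1‖ + ‖q.1‖ := by
          calc ‖c θ‖ = ‖(c θ - y.1) + (y.1 - q.1) + q.1‖ := by congr 1; ring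
            _ ≤ _ := norm_add₃_le
        rw [hcn] at e1
        linarith
      have h3 : ‖deriv c θ‖ = r / 2 := by
        simp only [hc, deriv_circleMap]
        rw [norm_mul, Complex.norm_I, mul_one]; exact hcn θ
      rw [norm_mul, h3, norm_mul, norm_inv]
      have h4 := hM (c θ, y.2) (by rw [hcn]; linarith) hyU.2
      exact mul_le_mul_of_nonneg_left (mul_le_mul (inv_anti₀ (by linarith) h2) h4 (norm_nonneg _)
        (inv_nonneg.2 (by linarith))) hr2.le)
  have hdiff : DifferentiableOn ℂ (fun q => (2 * Real.pi * Complex.I)⁻¹ *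
      ∫ θ in Set.Ioc (0 : ℝ) (2 * Real.pi), deriv c θ * H (q, c θ)) U := fun q hq =>
    ((key q hq).2.const_mul _).differentiableAt.differentiableWithinAt
  refine analyticOnNhd_of_differentiableOn hUo (hdiff.congr fun q hq => ?_)
  have h1 : DifferentiableOn ℂ (fun t => g (t, q.2)) (Metric.closedBall 0 (r / 2)) :=
    (hg' q.2 hq.2).mono (Metric.closedBall_subset_ball (by linarith))
  have h2 := h1.circleIntegral_sub_inv_smul (w := q.1) (by simpa using hq.1)
  rw [circleIntegral, intervalIntegral.integral_of_le Real.two_pi_pos.le] at h2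
  have h3 : ∫ θ in Set.Ioc (0 : ℝ) (2 * Real.pi), deriv c θ * H (q, c θ)
      = (2 * Real.pi * Complex.I) * g q := by
    simpa only [smul_eq_mul] using h2
  rw [h3, inv_mul_cancel_left₀ (by simp [Real.pi_ne_zero])]

theorem wt_eq_rpow (s : LogCover) : wt s = ‖LogCover.proj s‖ ^ (1 / 7 : ℝ) := by
  rw [LogCover.proj, Complex.norm_exp, ← Real.exp_mul, wt]; congr 1; ring

/-- A bounded holomorphic function near the origin which is periodic in the logarithmic
variable descends to a holomorphic function of `(t, x)`. -/
theorem exists_descent {R K r₀ : ℝ} (hR : 0 < R) (hK : 0 < K) (hr₀ : 0 < r₀)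
    {w : LogCover × (Fin n → ℂ) → ℂ} (hw : AnalyticOnNhd ℂ w (cone n Set.univ 0 R K))
    (hb : ∀ p ∈ cone n Set.univ 0 R K, ‖w p‖ ≤ wt p.1 ^ 2)
    (hper : ∀ p, w (p + (2 * Real.pi * Complex.I, 0)) = w p) :
    ∃ r : ℝ, 0 < r ∧ r ≤ r₀ ∧ ∃ v : ℂ × (Fin n → ℂ) → ℂ,
      AnalyticOnNhd ℂ v {q | ‖q.1‖ < r ∧ ‖q.2‖ < R / 2} ∧
      ∀ (s : LogCover) (x : Fin n → ℂ), ‖LogCover.proj s‖ < r → ‖x‖ < R / 2 →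
        (s, x) ∈ cone n Set.univ 0 R K ∧ v (LogCover.proj s, x) = w (s, x) := by
  set r : ℝ := min r₀ (min 1 ((R / (2 * K)) ^ 7)) with hrdef
  have hRK : 0 < R / (2 * K) := by positivity
  have hr : 0 < r := lt_min hr₀ (lt_min one_pos (by positivity))
  have hr1 : r ≤ 1 := (min_le_right _ _).trans (min_le_left _ _)
  have hrR : r ≤ (R / (2 * K)) ^ 7 := (min_le_right _ _).trans (min_le_right _ _)
  have hcone : ∀ (s : LogCover) (x : Fin n → ℂ), ‖LogCover.proj s‖ < r → ‖x‖ < R / 2 →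
      (s, x) ∈ cone n Set.univ 0 R K := by
    intro s x hs hx
    refine ⟨trivial, ?_, ?_⟩
    · have : Real.exp s.re < 1 := by
        rw [← Complex.norm_exp]; exact hs.trans_le hr1
      exact Real.exp_lt_one_iff.1 this
    · have h1 : wt s < R / (2 * K) := by
        refine lt_of_pow_lt_pow_left₀ 7 hRK.le ?_
        rw [wt_pow_seven]; exact hs.trans_le hrR
      have h2 : K * wt s < R / 2 := by
        calc K * wt s < K * (R / (2 * K)) := by gcongr
          _ = R / 2 := by field_simp
      simp only [gap]; linarith
  -- The value `0` at `t = 0` is the correct one, since `w` is bounded by `wt ^ 2`, which tends to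
  -- `0` with `t`.
  let g : ℂ × (Fin n → ℂ) → ℂ := fun q => if q.1 = 0 then 0 else w (Complex.log q.1, q.2)
  have hgw : ∀ (s : LogCover) (x : Fin n → ℂ), g (LogCover.proj s, x) = w (s, x) := by
    intro s x
    have hne : LogCover.proj s ≠ 0 := Complex.exp_ne_zero s
    simp only [g, if_neg hne]
    have h1 : Complex.exp (Complex.log (LogCover.proj s)) = Complex.exp s := Complex.exp_log hne
    obtain ⟨k, hk⟩ := Complex.exp_eq_exp_iff_exists_int.1 h1
    have hp : Function.Periodic (fun s : ℂ => w (s, x)) (2 * Real.pi * Complex.I) := fun s => by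
      have := hper (s, x)
      simpa using this
    have := hp.int_mul k s
    rw [hk]; exact this
  have hgb : ∀ q : ℂ × (Fin n → ℂ), ‖q.1‖ < r → ‖q.2‖ < R / 2 →
      ‖g q‖ ≤ (‖q.1‖ ^ (1 / 7 : ℝ)) ^ 2 := by
    rintro ⟨t, x⟩ ht hx
    rcases eq_or_ne t 0 with rfl | hne
    · simp [g]
    · have hexp : LogCover.proj (Complex.log t) = t := Complex.exp_log hne
      have h1 := hgw (Complex.log t) x
      rw [hexp] at h1
      rw [h1]
      have h2 := hb _ (hcone (Complex.log t) x (by rwa [hexp]) hx)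
      rwa [wt_eq_rpow, hexp] at h2
  have hdiff : ∀ q : ℂ × (Fin n → ℂ), q.1 ≠ 0 → ‖q.1‖ < r → ‖q.2‖ < R / 2 →
      DifferentiableAt ℂ g q := by
    rintro ⟨t₀, x₀⟩ hne ht hx
    simp only at hne ht hx
    -- A branch of the logarithm holomorphic near `t₀`, also when `t₀` is on the cut of the
    -- principal branch; by periodicity any branch gives the same `g`.
    let L : ℂ × (Fin n → ℂ) → LogCover × (Fin n → ℂ) := fun q =>
      (Complex.log (q.1 / t₀) + Complex.log t₀, q.2)
    have hL : DifferentiableAt ℂ L (t₀, x₀) := by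
      refine DifferentiableAt.prodMk (DifferentiableAt.add_const _ ?_) differentiableAt_snd
      have h1 : DifferentiableAt ℂ (fun q : ℂ × (Fin n → ℂ) => q.1 / t₀) (t₀, x₀) := by
        simp only [div_eq_mul_inv]; fun_prop
      refine h1.clog ?_
      simp [hne]
    have hL0 : L (t₀, x₀) = (Complex.log t₀, x₀) := by simp [L, hne]
    have hexp : LogCover.proj (Complex.log t₀) = t₀ := Complex.exp_log hne
    have hwL : DifferentiableAt ℂ (w ∘ L) (t₀, x₀) := by
      refine DifferentiableAt.comp _ ?_ hL
      rw [hL0]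
      exact (hw _ (hcone _ _ (by rwa [hexp]) hx)).differentiableAt
    refine hwL.congr_of_eventuallyEq ?_
    have : ∀ᶠ q : ℂ × (Fin n → ℂ) in 𝓝 (t₀, x₀), q.1 ≠ 0 :=
      continuousAt_fst.eventually_ne hne
    filter_upwards [this] with q hq
    have h1 := hgw (Complex.log (q.1 / t₀) + Complex.log t₀) q.2
    have h2 : LogCover.proj (Complex.log (q.1 / t₀) + Complex.log t₀) = q.1 := by
      rw [LogCover.proj, Complex.exp_add, Complex.exp_log (div_ne_zero hq hne), Complex.exp_log hne,
        div_mul_cancel₀ _ hne]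
    rw [h2] at h1
    exact h1
  have hsep : ∀ x : Fin n → ℂ, ‖x‖ < R / 2 →
      DifferentiableOn ℂ (fun t => g (t, x)) (Metric.ball 0 r) := by
    intro x hx t ht
    have hpt : ∀ t : ℂ, t ≠ 0 → ‖t‖ < r → DifferentiableAt ℂ (fun t => g (t, x)) t :=
      fun t hne ht => DifferentiableAt.comp (f := fun t : ℂ => (t, x)) t (hdiff (t, x) hne ht hx)
        (differentiableAt_id.prodMk (differentiableAt_const x))
    rcases eq_or_ne t 0 with rfl | hne
    · refine (Complex.analyticAt_of_differentiable_on_punctured_nhds_of_continuousAt ?_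
        ?_).differentiableAt.differentiableWithinAt
      · have h1 : ∀ᶠ t in 𝓝[≠] (0 : ℂ), t ∈ Metric.ball (0 : ℂ) r :=
          nhdsWithin_le_nhds (Metric.ball_mem_nhds 0 hr)
        filter_upwards [h1, self_mem_nhdsWithin] with t h1 h2
        exact hpt t h2 (by simpa using h1)
      · have h0 : g (0, x) = 0 := by simp [g]
        rw [ContinuousAt, h0]
        have hlim : Tendsto (fun t : ℂ => (‖t‖ ^ (1 / 7 : ℝ)) ^ 2) (𝓝 0) (𝓝 0) := by
          have h2 : Continuous fun t : ℂ => (‖t‖ ^ (1 / 7 : ℝ)) ^ 2 :=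
            (continuous_norm.rpow_const fun _ => Or.inr (by norm_num)).pow 2
          have h3 := h2.tendsto 0
          simpa using h3
        refine squeeze_zero_norm' ?_ hlim
        filter_upwards [Metric.ball_mem_nhds (0 : ℂ) hr] with t ht
        exact hgb (t, x) (by simpa using ht) hx
    · exact (hpt t hne (by simpa using ht)).differentiableWithinAt
  have han := analyticOnNhd_of_removable_hyperplane (g := g) (r := r) (R := R / 2) (M := 1) hr
    (fun q hq => (hdiff q hq.1 hq.2.1 hq.2.2).differentiableWithinAt)
    (fun q h1 h2 => (hgb q h1 h2).trans
      (pow_le_one₀ (by positivity) (Real.rpow_le_one (norm_nonneg _) (h1.le.trans hr1) (by norm_num))))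
    hsep
  refine ⟨r / 2, by linarith, by linarith [min_le_left r₀ (min 1 ((R / (2 * K)) ^ 7))], g, han,
    fun s x hs hx => ⟨hcone s x (by linarith) hx, hgw s x⟩⟩

/-! ### From the given solution to the uniqueness theorem, and propagation of the equality. -/

theorem norm_proj (s : LogCover) : ‖LogCover.proj s‖ = Real.exp (Complex.re s) :=
  Complex.norm_exp s

theorem mem_cone_zero_iff {I : Set ℝ} {T R : ℝ} {p : LogCover × (Fin n → ℂ)} :
    p ∈ cone n I T R 0 ↔ Complex.im p.1 ∈ I ∧ Complex.re p.1 < T ∧ ‖p.2‖ < R := by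
  simp [cone, gap]

section

variable {Δ : Set (JetSpace n)} {F : JetSpace n → ℂ} {lam₁ lam₂ : ℂ} {ρ C C₁ : ℝ}

/-- A solution satisfying the growth condition is `O(|t|)` on a smaller sector. -/
theorem exists_linear_bound_of_growthCondition (hF : RemainderBound Δ F lam₁ lam₂ ρ C)
    (h₁ : lam₁.re < 0) (h₂ : lam₂.re < 0)
    {I : Set ℝ} (hI : IsOpen I) (hIne : I.Nonempty) {r₀ R₀ η : ℝ} (hr₀ : 0 < r₀) (hR₀ : 0 < R₀)
    (hη : 0 < η) {u : LogCover × (Fin n → ℂ) → ℂ}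
    (hu : IsHolomorphicSolution Δ F (sector I r₀ ×ˢ polydisc n R₀) u)
    (hgrowth : GrowthCondition I u) :
    ∃ (θ : ℝ) (J : Set ℝ) (T R C' : ℝ), IsOpen J ∧ θ ∈ J ∧ J ⊆ I ∧ T ≤ 0 ∧ 0 < R ∧ R ≤ η ∧ 0 ≤ C' ∧
      cone n J T R 0 ⊆ sector I r₀ ×ˢ polydisc n R₀ ∧
      ∀ p ∈ cone n J T R 0, ‖u p‖ ≤ C' * wt p.1 ^ 7 ∧ ‖eulerOp u p‖ ≤ C' * wt p.1 ^ 7 := by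
  obtain ⟨C₄, hC₄, hdecay⟩ := exists_linear_decay hF h₁ h₂
  obtain ⟨θ, hθ⟩ := hIne
  obtain ⟨ε, hε, hball⟩ := Metric.isOpen_iff.1 hI θ hθ
  set δ := min (ε / 2) 1 with hδdef
  have hδ : 0 < δ := lt_min (by linarith) one_pos
  have hδ1 : δ ≤ 1 := min_le_right _ _
  have hδε : 2 * δ ≤ ε := by have := min_le_left (ε / 2) 1; linarith
  have hρ := hF.pos
  have hC₄0 : 0 < C₄ := by linarith
  obtain ⟨R, r, hR, hRη, hr, hrr₀, hsmall⟩ :=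
    -- The growth condition says nothing of `eulerOp u`, which is bounded by Cauchy's estimate on a
    -- disc of radius `δ` in `s`. That costs a factor `2 / δ`, hence the factor `δ / 2` in `ε`
    -- relative to the threshold `1 / (2 ^ 17 * C₄)`, and a smaller interval of arguments.
    exists_small_of_growthCondition hgrowth (ε := δ / (2 ^ 18 * C₄))
      (η := min (min R₀ η) (min ρ (1 / (128 * C₄)))) (by positivity) (by positivity) hr₀
  simp only [lt_min_iff] at hRη
  obtain ⟨⟨hRR₀, hRη⟩, hRρ, hRC⟩ := hRη
  have hsub : cone n (Metric.ball θ (2 * δ)) (Real.log r) R 0 ⊆ sector I r ×ˢ polydisc n R := by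
    intro p hp
    obtain ⟨h1, h2, h3⟩ := mem_cone_zero_iff.1 hp
    refine ⟨⟨hball (Metric.ball_subset_ball hδε h1), ?_⟩, h3⟩
    rw [norm_proj]
    exact (Real.lt_log_iff_exp_lt hr).1 h2
  have hsub' : sector I r ×ˢ polydisc n R ⊆ sector I r₀ ×ˢ polydisc n R₀ :=
    Set.prod_mono (fun s hs => ⟨hs.1, hs.2.trans hrr₀⟩) (fun x (hx : ‖x‖ < R) => hx.trans hRR₀)
  set T₀ := min (Real.log r - 1) (Real.log ρ) with hT₀
  have hT₀r : T₀ ≤ Real.log r - 1 := min_le_left _ _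
  have hshift : ∀ p ∈ cone n (Metric.ball θ δ) T₀ R 0, ∀ z : ℂ, ‖z‖ < δ →
      p + z • ((1, 0) : LogCover × (Fin n → ℂ)) ∈
        cone n (Metric.ball θ (2 * δ)) (Real.log r) R 0 := by
    intro p hp z hz
    obtain ⟨h1, h2, h3⟩ := mem_cone_zero_iff.1 hp
    refine mem_cone_zero_iff.2 ⟨?_, ?_, by simpa using h3⟩
    · have h4 := (Complex.abs_im_le_norm z).trans_lt hz
      rw [Metric.mem_ball, Real.dist_eq, abs_lt] at h1 ⊢
      rw [abs_lt] at h4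
      constructor <;> simp <;> linarith [h1.1, h1.2, h4.1, h4.2]
    · have h4 := (Complex.re_le_norm z).trans_lt hz
      simp
      linarith
  have hcone : cone n (Metric.ball θ δ) T₀ R 0 ⊆ sector I r ×ˢ polydisc n R := fun p hp => by
    simpa using hsub (hshift p hp 0 (by simpa using hδ))
  have han : AnalyticOnNhd ℂ u (sector I r ×ˢ polydisc n R) := hu.holomorphic.mono hsub'
  have hub : ∀ p ∈ sector I r ×ˢ polydisc n R, ‖u p‖ ≤ δ / 2 * (R ^ 4 / (2 ^ 17 * C₄)) :=
    fun p hp => (hsmall p hp).trans_eq (by field_simp)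
  have hR4 : 0 ≤ R ^ 4 / (2 ^ 17 * C₄) := by positivity
  obtain ⟨T, C', hT, hC', hb⟩ := hdecay (Metric.ball θ δ) T₀ R u
    ((Real.exp_le_exp.2 (min_le_right _ _)).trans_eq (Real.exp_log hρ)) hRρ.le hR
    (by rw [lt_div_iff₀ (by positivity)] at hRC; linarith)
    (han.mono hcone) (fun p hp => eulerOp_eulerOp_eq_iff.1 (hu.equation p (hsub' (hcone hp))))
    (fun p hp => (hub p (hcone hp)).trans (mul_le_of_le_one_left hR4 (by linarith)))
    (fun p hp => by
      have := norm_dirDeriv_le han (p := p) (v := (1, 0)) hδ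
        (fun z hz => hsub (hshift p hp z hz)) (fun z hz => hub _ (hsub (hshift p hp z hz)))
      rw [← eulerOp_eq_dirDeriv] at this
      refine this.trans_eq ?_
      field_simp)
  have hhalf : cone n (Metric.ball θ δ) (min T 0) (R / 2) 0 ⊆
      cone n (Metric.ball θ δ) T (R / 2) 0 :=
    cone_mono subset_rfl (min_le_left _ _) le_rfl
  refine ⟨θ, Metric.ball θ δ, min T 0, R / 2, C', Metric.isOpen_ball, Metric.mem_ball_self hδ,
    (Metric.ball_subset_ball (by linarith)).trans hball, min_le_right _ _, by linarith,
    by linarith, hC', fun p hp => ?_, fun p hp => hb p (hhalf hp)⟩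
  obtain ⟨h1, h2, h3⟩ := mem_cone_zero_iff.1 (hhalf hp)
  exact hsub' (hcone (mem_cone_zero_iff.2 ⟨h1, h2.trans_le hT, by linarith⟩))

/-- A solution which is `O(|t|)` has small derivatives on a cone. -/
theorem exists_jet_bound_of_linear_bound (hF : RemainderBound Δ F lam₁ lam₂ ρ C)
    {I : Set ℝ} {T R C' : ℝ} (hR : 0 < R) (hR1 : R ≤ 1) (hRρ : R ≤ ρ) (hC' : 0 ≤ C')
    {u : LogCover × (Fin n → ℂ) → ℂ} (hu : AnalyticOnNhd ℂ u (cone n I T R 0))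
    (hb : ∀ p ∈ cone n I T R 0, ‖u p‖ ≤ C' * wt p.1 ^ 7 ∧ ‖eulerOp u p‖ ≤ C' * wt p.1 ^ 7)
    (he : ∀ p ∈ cone n I T R 0, charOp lam₁ lam₂ u p = remainder F lam₁ lam₂ (jet u p)) :
    ∃ D B : ℝ, 1 ≤ D ∧ 0 ≤ B ∧ ∀ K : ℝ, 1 ≤ K → D < ρ * K → ∀ p ∈ cone n I T (R / 2) K,
      (∀ k, ‖jetOp k u p‖ ≤ D * wt p.1 ^ 2) ∧
      ‖charOp lam₁ lam₂ u p‖ ≤ B * wt p.1 ^ 7 / gap (R / 2) K p ^ 3 := by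
  have hC0 : 0 ≤ C := by linarith [hF.one_le]
  -- Cauchy's estimate at distance `R / 2`: `32 / (R / 2) ^ 2 = 128 / R ^ 2`. `D` does not depend on
  -- `K`, so `K` may be chosen afterwards.
  set D := 1 + 128 * C' / R ^ 2 with hD
  have hD1 : 1 ≤ D := by rw [hD]; linarith [show 0 ≤ 128 * C' / R ^ 2 by positivity]
  have hD0 : 0 ≤ D := by linarith
  refine ⟨D, C + C * (1 + D) * D + C * D, hD1, by positivity, fun K hK hKρ p hp => ?_⟩
  obtain ⟨hw1, -, -, hpρ, hDρ⟩ := small_of_mem_cone (by linarith) hD1 hK hKρ hp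
  have hx := norm_snd_lt_of_mem_cone (by linarith) hp
  have hp0 : p ∈ cone n I T R 0 := mem_cone_zero_iff.2 ⟨hp.1, hp.2.1, by linarith⟩
  have hw := wt_pos p.1
  have hj : ∀ k, ‖jetOp k u p‖ ≤ D * wt p.1 ^ 7 := fun k => by
    refine (norm_jetOp_le_of_weighted hu (M := fun s => C' * wt s ^ 7) (fun q hq => (hb q hq).1)
      (fun q hq => (hb q hq).2) hp0 (δ := R / 2) (by linarith) (by linarith)
      (by simp only [gap]; linarith) k).trans ?_
    rw [hD, add_mul]
    have : 32 * (C' * wt p.1 ^ 7) / (R / 2) ^ 2 = 128 * C' / R ^ 2 * wt p.1 ^ 7 := by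
      field_simp; ring
    rw [this]
    linarith [pow_pos hw 7]
  have h72 : wt p.1 ^ 7 ≤ wt p.1 ^ 2 := pow_le_pow_of_le_one hw.le hw1 (by norm_num)
  have h71 : wt p.1 ^ 7 ≤ 1 := pow_le_one₀ hw.le hw1
  have hD72 := mul_le_mul_of_nonneg_left h72 hD0
  refine ⟨fun k => (hj k).trans hD72, ?_⟩
  rw [he p hp0]
  have hx1 : ‖p.2‖ ≤ 1 := by linarith
  have hrem := norm_remainder_jet_le hF hpρ (by linarith) (hD72.trans_lt hDρ) hj (fun i => hj _)
  rw [← wt_pow_seven] at hrem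
  have h7 : 0 ≤ wt p.1 ^ 7 := by positivity
  have hg := hp.2.2
  have hg1 := gap_le_one (R := R / 2) (K := K) (by linarith) (by linarith) p
  rw [le_div_iff₀ (by positivity)]
  have hg3 : gap (R / 2) K p ^ 3 ≤ 1 := pow_le_one₀ hg.le hg1
  refine (mul_le_of_le_one_right (norm_nonneg _) hg3).trans (hrem.trans ?_)
  have e1 : C * (wt p.1 ^ 7 + D * wt p.1 ^ 7) * (D * wt p.1 ^ 7)
      ≤ C * (1 + D) * D * wt p.1 ^ 7 := by
    have : C * (1 + D) * D * wt p.1 ^ 7 * wt p.1 ^ 7 ≤ C * (1 + D) * D * wt p.1 ^ 7 :=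
      mul_le_of_le_one_right (by positivity) h71
    linarith
  have e2 : C * ‖p.2‖ * (D * wt p.1 ^ 7) ≤ C * D * wt p.1 ^ 7 := by
    have : C * D * wt p.1 ^ 7 * ‖p.2‖ ≤ C * D * wt p.1 ^ 7 :=
      mul_le_of_le_one_right (by positivity) hx1
    linarith
  linarith

end

/-- Two functions holomorphic on `{arg t ∈ I, |t| < r, ‖x‖ < R}` agree as soon as they agree on a
cone. -/
theorem eq_of_eqOn_cone {I J : Set ℝ} (hIconn : I.OrdConnected) (hJ : IsOpen J)
    {θ : ℝ} (hθ : θ ∈ J) (hJI : J ⊆ I) {r T R R' K : ℝ} (hr : 0 < r) (hR : 0 < R) (hR' : 0 < R')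
    {u w : LogCover × (Fin n → ℂ) → ℂ}
    (hu : AnalyticOnNhd ℂ u (sector I r ×ˢ polydisc n R))
    (hw : AnalyticOnNhd ℂ w (sector I r ×ˢ polydisc n R))
    (h : Set.EqOn u w (cone n J T R' K)) : Set.EqOn u w (sector I r ×ˢ polydisc n R) := by
  have hS : sector I r = Complex.imLm ⁻¹' I ∩ Complex.reLm ⁻¹' Set.Iio (Real.log r) := by
    ext s
    simp only [sector, LogCover.arg, norm_proj, Set.mem_ofPred_eq, Set.mem_inter_iff,
      Set.mem_preimage, Set.mem_Iio, Real.lt_log_iff_exp_lt hr]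
    rfl
  -- In the logarithmic coordinate a sector is a half-strip, so the product is convex and the
  -- identity theorem needs only one point with an open neighbourhood of agreement.
  have hconv : Convex ℝ (sector I r ×ˢ polydisc n R) := by
    refine Convex.prod ?_ ?_
    · rw [hS]
      exact (hIconn.convex.linear_preimage _).inter ((convex_Iio _).linear_preimage _)
    · have : polydisc n R = Metric.ball 0 R := by ext x; simp [polydisc]
      rw [this]
      exact convex_ball _ _
  obtain ⟨S, hS1, hS2⟩ : ∃ S : ℝ, S < min (Real.log r) T ∧ K * Real.exp (S / 7) < R' := by
    have h1 : Tendsto (fun S : ℝ => K * Real.exp (S / 7)) atBot (𝓝 (K * 0)) :=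
      (Real.tendsto_exp_atBot.comp (tendsto_id.atBot_div_const (by norm_num))).const_mul K
    rw [mul_zero] at h1
    exact ((eventually_lt_atBot _).and (h1.eventually_lt_const hR')).exists
  rw [lt_min_iff] at hS1
  have hp : ((⟨S, θ⟩, 0) : LogCover × (Fin n → ℂ)) ∈ cone n J T R' K := by
    refine ⟨hθ, hS1.2, ?_⟩
    simp only [gap, wt, norm_zero]
    linarith
  refine hu.eqOn_of_preconnected_of_eventuallyEq hw hconv.isPreconnected
    (z₀ := (⟨S, θ⟩, 0)) ⟨⟨hJI hθ, ?_⟩, ?_⟩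
    (h.eventuallyEq_of_mem ((isOpen_cone hJ _ _ _).mem_nhds hp))
  · rw [norm_proj]
    exact (Real.lt_log_iff_exp_lt hr).1 hS1.1
  · simpa [polydisc] using hR

end

theorem theorem3 (n : ℕ) (Δ : Set (JetSpace n)) (F : JetSpace n → ℂ)
    (hΔ : IsOpen Δ) (hΔ0 : (0 : JetSpace n) ∈ Δ)
    (hA1 : AnalyticOnNhd ℂ F Δ)
    (hA2 : ∀ x : Fin n → ℂ, ((0, x, 0) : JetSpace n) ∈ Δ → F (0, x, 0) = 0)
    (hA3 : ∀ k : JetIndex n, 0 < ∑ j, k.multi j →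
      ∀ x : Fin n → ℂ, ((0, x, 0) : JetSpace n) ∈ Δ → partialZ F k (0, x, 0) = 0)
    (hexp : ∀ lam : ℂ, IsCharExponent F 0 lam → lam.re < 0)
    (I : Set ℝ) (hIopen : IsOpen I) (hIconn : I.OrdConnected) (hIne : I.Nonempty)
    (r₀ R₀ : ℝ) (hr₀ : 0 < r₀) (hR₀ : 0 < R₀)
    (u : LogCover × (Fin n → ℂ) → ℂ)
    (hu : IsHolomorphicSolution Δ F (sector I r₀ ×ˢ polydisc n R₀) u)
    (hgrowth : GrowthCondition I u) :
    ∃ (U : Set (ℂ × (Fin n → ℂ))) (v : ℂ × (Fin n → ℂ) → ℂ),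
      IsOpen U ∧ (0, 0) ∈ U ∧ AnalyticOnNhd ℂ v U ∧
      ∀ s ∈ sector I r₀, ∀ x ∈ polydisc n R₀,
        (LogCover.proj s, x) ∈ U → v (LogCover.proj s, x) = u (s, x) := by
  obtain ⟨lam₁, lam₂, h₁, h₂, hs, hp⟩ := exists_charExponents hexp
  obtain ⟨ρ, C, f1, f2, f3, f4, f5, f6⟩ := exists_remainder_bound hΔ hΔ0 hA1 hA2 hA3 hs hp
  have hF : RemainderBound Δ F lam₁ lam₂ ρ C := ⟨f1, f2, f3, f4, f5, f6⟩
  obtain ⟨C₁, hC₁, hJE⟩ := exists_jet_estimates (n := n) h₁ h₂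
  have hJE : JetEstimate n lam₁ lam₂ C₁ := hJE
  have hC0 : 0 < C := by linarith
  have hC₁0 : 0 < C₁ := by linarith
  obtain ⟨θ, J, T, R, C', hJ, hθ, hJI, hT, hR, hRη, hC', hsub, hb⟩ :=
    exists_linear_bound_of_growthCondition hF h₁ h₂ hIopen hIne hr₀ hR₀
      (η := min (min R₀ ρ) (1 / (32 * C * C₁))) (by positivity) hu hgrowth
  simp only [le_min_iff] at hRη
  obtain ⟨⟨hRR₀, hRρ⟩, hRC⟩ := hRη
  rw [le_div_iff₀ (by positivity)] at hRC
  have hR1 : R ≤ 1 := hRρ.trans f2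
  have hRC' : 32 * C * C₁ * (R / 2) ≤ 1 := by
    linarith [show 0 ≤ R * (32 * C * C₁) by positivity]
  have han : AnalyticOnNhd ℂ u (cone n J T R 0) := hu.holomorphic.mono hsub
  have heu : ∀ p ∈ cone n J T R 0, charOp lam₁ lam₂ u p = remainder F lam₁ lam₂ (jet u p) :=
    fun p hp => eulerOp_eulerOp_eq_iff.1 (hu.equation p (hsub hp))
  obtain ⟨D, B, hD, hB, hjb⟩ :=
    exists_jet_bound_of_linear_bound hF hR hR1 hRρ hC' han hb heu
  obtain ⟨K₁, w, hK₁, hw, hwb, hewb, hjw, hew, hcw, hper⟩ :=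
    exists_periodic_solution hA1 hF hC₁ hJE h₁ h₂ (R := R / 2) (by linarith) (by linarith) hRC'
  -- The aperture is enlarged beyond that of `w`, because the jets of `u` are controlled only with
  -- the constant `D`.
  obtain ⟨K, hKK₁, hKC, hKρ⟩ : ∃ K, K₁ ≤ K ∧ 32 * C * C₁ * (1 + D) ≤ K ∧ D < ρ * K := by
    have hKρ : ∀ᶠ K : ℝ in atTop, D < ρ * K :=
      (tendsto_id.const_mul_atTop f1).eventually_gt_atTop D
    obtain ⟨K, h⟩ := ((eventually_ge_atTop K₁).and
      ((eventually_ge_atTop (32 * C * C₁ * (1 + D))).and hKρ)).exists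
    exact ⟨K, h⟩
  have hK : 1 ≤ K := hK₁.trans hKK₁
  have hsw : cone n J T (R / 2) K ⊆ cone n Set.univ 0 (R / 2) K₁ :=
    cone_mono (Set.subset_univ _) hT hKK₁
  have hsu : cone n J T (R / 2) K ⊆ cone n J T R 0 := fun p hp => mem_cone_zero_iff.2
    ⟨hp.1, hp.2.1, by linarith [norm_snd_lt_of_mem_cone (by linarith) hp]⟩
  have hray : ∀ {f : LogCover × (Fin n → ℂ) → ℂ},
      (∀ p ∈ cone n J T R 0, ‖f p‖ ≤ C' * wt p.1 ^ 7) → RayBounded (cone n J T (R / 2) K) f :=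
    fun h => rayBounded_of_weighted hJ (by linarith) hC' (a := 7) (b := 0)
      fun p hp => by simpa using h p (hsu hp)
  have heq : Set.EqOn u w (cone n J T (R / 2) K) := by
    refine eqOn_of_charOp_eq_remainder hF hC₁ hJE hJ (by linarith) (by linarith) hRC' hD hK hKC hKρ
      (B := max B (2 * C)) (hB.trans (le_max_left _ _)) (han.mono hsu) (hw.mono hsw)
      (hray fun p hp => (hb p hp).1) (hwb.mono hsw) (hray fun p hp => (hb p hp).2) (hewb.mono hsw)
      (fun p hp => (hjb K hK hKρ p hp).1) (fun p hp k => (hjw p (hsw hp) k).trans ?_)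
      (fun p hp => heu p (hsu hp)) (fun p hp => hew p (hsw hp))
      (fun p hp => (hjb K hK hKρ p hp).2.trans ?_) (fun p hp => (hcw p (hsw hp)).trans ?_)
    · exact le_mul_of_one_le_left (sq_nonneg _) hD
    · have := hp.2.2
      have := wt_pos p.1
      gcongr
      exact le_max_left _ _
    · have := hp.2.2
      have := wt_pos p.1
      gcongr
      · exact le_max_right _ _
      · exact gap_anti hKK₁ p
  obtain ⟨r, hr, hrr₀, v, hv, hvw⟩ := exists_descent (by linarith) (by linarith) hr₀ hw
    (fun p hp => by simpa only [jetOp_pure_zero] using hjw p hp (JetIndex.pure n 0)) hper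
  refine ⟨{q | ‖q.1‖ < r ∧ ‖q.2‖ < R / 2 / 2}, v, ?_, ?_, hv, fun s hs x hx hq => ?_⟩
  · exact (isOpen_lt continuous_fst.norm continuous_const).inter
      (isOpen_lt continuous_snd.norm continuous_const)
  · exact ⟨by simpa using hr, by simpa using hR⟩
  -- The equality was obtained only for arguments in `J`; since `w` exists for all arguments, it
  -- extends to the whole interval `I`.
  have key := eq_of_eqOn_cone hIconn hJ hθ hJI hr (R := R / 2 / 2) (by linarith) (by linarith)
    (hu.holomorphic.mono (Set.prod_mono (fun s hs => ⟨hs.1, hs.2.trans_le hrr₀⟩)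
      (fun x (hx : ‖x‖ < R / 2 / 2) => show ‖x‖ < R₀ by linarith)))
    (hw.mono fun p hp => (hvw p.1 p.2 hp.1.2 hp.2).1) heq
  rw [(hvw s x hq.1 hq.2).2, key (show (s, x) ∈ _ from ⟨⟨hs.1, hq.1⟩, hq.2⟩)]
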